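/- Let $G$ be a finite digraph with $n$ vertices and $m$ edges, let $s\in V(G)$ be a source vertex, and let $\lambda,k\ge 0$ be integers. A spanning subgraph $H$ of $G$ is called a $(\lambda,k)$-fault tolerant reachability subgraph ($(\lambda,k)$-FTRS) of $G$ (with respect to $s$) if for every set $F$ of at most $k$ edges of $G$, and likewise for every set $F$ of at most $k$ vertices of $G$, and for every vertex $v\in V(G)$, there are $\lambda$ pairwise edge-disjoint directed paths from $s$ to $v$ in $G-F$ if and only if there are $\lambda$ pairwise edge-disjoint directed paths from $s$ to $v$ in $H-F$. Then there is a $(\lambda,k)$-FTRS $H$ of $G$ in which every vertex has in-degree at most $(k+\lambda)\,4^{k+\lambda}$. Further, there is an algorithm, i.e. a fixed program for a word RAM with unit-cost addition, subtraction, comparison and indirect addressing and with words of $O(\log(n+m+\lambda+k+2))$ bits, that, given $n$, $m$, $s$, $\lambda$, $k$ and a list of the edges of $G$, outputs a list of the edges of such an $H$ in time $O\bigl(4^{k+\lambda}(k+\lambda)^2(m+n)m+1\bigr)$, where the constants hidden in the $O$-notation are absolute. -/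

import Mathlib

/-! ## Digraphs, failures, edge-disjoint paths, fault tolerant subgraphs

A digraph is Mathlib's `Digraph V`: its edges are ordered pairs `(u, v)` with `G.Adj u v`, and
`H ≤ G` says that `H` is a spanning subgraph of `G` (same vertices, fewer edges). -/

namespace FTRS

variable {V : Type*}

/-- The set `E(G)` of edges of a digraph. -/
def edgeSet (G : Digraph V) : Set (V × V) := {e | G.Adj e.1 e.2}

/-- The number of edges of a (finite) digraph. -/
noncomputable def numEdges (G : Digraph V) : ℕ := (edgeSet G).ncard

/-- The in-degree of a vertex of a (finite) digraph. -/
noncomputable def inDegree (G : Digraph V) (v : V) : ℕ := {u | G.Adj u v}.ncard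

/-- `G - F` for a set `F` of edges. -/
def deleteEdges (G : Digraph V) (F : Set (V × V)) : Digraph V where
  Adj u v := G.Adj u v ∧ (u, v) ∉ F

/-- `G - F` for a set `F` of vertices: every edge with an endpoint in `F` is removed. (The vertices
of `F` are kept as isolated vertices, so that no nontrivial path meets them.) -/
def deleteVerts (G : Digraph V) (F : Set V) : Digraph V where
  Adj u v := G.Adj u v ∧ u ∉ F ∧ v ∉ F

/-- `p` is the vertex sequence of a directed path from `s` to `v` in `G`. -/
structure IsPath (G : Digraph V) (s v : V) (p : List V) : Prop where
  chain : p.IsChain G.Adj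
  nodup : p.Nodup
  head : p.head? = some s
  last : p.getLast? = some v

/-- The edges traversed by a path given by its vertex sequence. -/
def pathEdges (p : List V) : List (V × V) := p.zip p.tail

/-- There are `l` pairwise edge-disjoint paths from `s` to `v` in `G`. -/
def HasDisjointPaths (G : Digraph V) (l : ℕ) (s v : V) : Prop :=
  ∃ P : Fin l → List V, (∀ i, IsPath G s v (P i)) ∧
    ∀ i j, i ≠ j → (pathEdges (P i)).Disjoint (pathEdges (P j))

/-- `H` is an `(l, k)`-fault tolerant reachability subgraph of `G` with respect to the source `s`,
for failures of at most `k` edges and also for failures of at most `k` vertices. -/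
structure IsFTRS (G : Digraph V) (s : V) (l k : ℕ) (H : Digraph V) : Prop where
  spanning_subgraph : H ≤ G
  edge_failures : ∀ F : Finset (V × V), (F : Set (V × V)) ⊆ edgeSet G → F.card ≤ k → ∀ v : V,
    (HasDisjointPaths (deleteEdges G F) l s v ↔ HasDisjointPaths (deleteEdges H F) l s v)
  vertex_failures : ∀ F : Finset V, F.card ≤ k → ∀ v : V,
    (HasDisjointPaths (deleteVerts G F) l s v ↔ HasDisjointPaths (deleteVerts H F) l s v)

end FTRS

/-! ## A word RAM with a step count

The machine has registers `0, 1, 2, …` and arrays `0, 1, 2, …`, all holding natural numbers; a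
program, being a finite object, uses only finitely many registers and arrays. (Finitely many
arrays are the same as one memory, up to a constant factor, by interleaving their cells.)
Every instruction and every evaluation of a test takes one step. Every value that an instruction
writes has to be less than the word bound `W`; otherwise the execution is stuck. -/

namespace RAM

/-- A memory state. -/
@[ext] structure State where
  reg : ℕ → ℕ
  arr : ℕ → ℕ → ℕ

/-- The elementary instructions; `x y z i` are register numbers and `a` is an array number. -/
inductive Instr where
  /-- `x := c` -/
  | const (x c : ℕ)
  /-- `x := y` -/
  | move (x y : ℕ)
  /-- `x := y + z` -/
  | add (x y z : ℕ)
  /-- `x := max (y - z) 0` -/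
  | sub (x y z : ℕ)
  /-- `x := a[i]` -/
  | load (x a i : ℕ)
  /-- `a[i] := x` -/
  | store (a i x : ℕ)

/-- The value that an instruction writes. -/
def Instr.value (σ : State) : Instr → ℕ
  | .const _ c => c
  | .move _ y => σ.reg y
  | .add _ y z => σ.reg y + σ.reg z
  | .sub _ y z => σ.reg y - σ.reg z
  | .load _ a i => σ.arr a (σ.reg i)
  | .store _ _ x => σ.reg x

/-- The state with register `x` set to `v`. -/
def State.setReg (σ : State) (x v : ℕ) : State :=
  { σ with reg := Function.update σ.reg x v }

/-- The state with cell `i` of array `a` set to `v`. -/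
def State.setArr (σ : State) (a i v : ℕ) : State :=
  { σ with arr := Function.update σ.arr a (Function.update (σ.arr a) i v) }

/-- The effect of an instruction on the memory. -/
def Instr.apply (σ : State) (I : Instr) : State :=
  match I with
  | .const x _ => σ.setReg x (I.value σ)
  | .move x _ => σ.setReg x (I.value σ)
  | .add x _ _ => σ.setReg x (I.value σ)
  | .sub x _ _ => σ.setReg x (I.value σ)
  | .load x _ _ => σ.setReg x (I.value σ)
  | .store a i _ => σ.setArr a (σ.reg i) (I.value σ)

/-- Tests comparing two registers. -/
inductive Test where
  | lt (x y : ℕ)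
  | eq (x y : ℕ)

/-- The truth value of a test. -/
def Test.Holds (σ : State) : Test → Prop
  | .lt x y => σ.reg x < σ.reg y
  | .eq x y => σ.reg x = σ.reg y

/-- Programs. -/
inductive Prog where
  | skip
  | instr (I : Instr)
  | seq (p q : Prog)
  | ite (b : Test) (p q : Prog)
  | loop (b : Test) (p : Prog)

/-- `Exec W p σ t τ`: with word bound `W`, the program `p` started in `σ` halts in `τ` after exactly
`t` steps. `Prog.loop b p` is `while b do p`. -/
inductive Exec (W : ℕ) : Prog → State → ℕ → State → Prop where
  | skip (σ : State) : Exec W .skip σ 1 σ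
  | instr (I : Instr) (σ : State) (h : I.value σ < W) : Exec W (.instr I) σ 1 (I.apply σ)
  | seq {p q : Prog} {σ τ υ : State} {t₁ t₂ : ℕ} (h₁ : Exec W p σ t₁ τ) (h₂ : Exec W q τ t₂ υ) :
      Exec W (.seq p q) σ (t₁ + t₂) υ
  | ite_true {b : Test} {p q : Prog} {σ τ : State} {t : ℕ} (hb : b.Holds σ)
      (h : Exec W p σ t τ) : Exec W (.ite b p q) σ (t + 1) τ
  | ite_false {b : Test} {p q : Prog} {σ τ : State} {t : ℕ} (hb : ¬ b.Holds σ)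
      (h : Exec W q σ t τ) : Exec W (.ite b p q) σ (t + 1) τ
  | loop_true {b : Test} {p : Prog} {σ τ υ : State} {t₁ t₂ : ℕ} (hb : b.Holds σ)
      (h₁ : Exec W p σ t₁ τ) (h₂ : Exec W (.loop b p) τ t₂ υ) :
      Exec W (.loop b p) σ (t₁ + t₂ + 1) υ
  | loop_false {b : Test} {p : Prog} {σ : State} (hb : ¬ b.Holds σ) : Exec W (.loop b p) σ 1 σ

end RAM

namespace FTRS

/-- The first `m` cells of the arrays `tail` and `head` list the edges of `G`, each exactly once, in
some order: the `i`-th edge leads from `tail i` to `head i`. -/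
def IsEdgeList {n : ℕ} (G : Digraph (Fin n)) (m : ℕ) (tail head : ℕ → ℕ) : Prop :=
  Set.BijOn (fun i => (tail i, head i)) (Set.Iio m)
    ((fun e : Fin n × Fin n => ((e.1 : ℕ), (e.2 : ℕ))) '' edgeSet G)

/-- `σ` is an initial memory for the input `G, s, l, k`: registers `0, …, 4` hold the number of
vertices, the number of edges, `s`, `l` and `k`; arrays `0` and `1` hold an edge list of `G`;
everything else is `0`. -/
structure IsInput {n : ℕ} (G : Digraph (Fin n)) (s : Fin n) (l k : ℕ) (σ : RAM.State) : Prop where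
  reg_zero : σ.reg 0 = n
  reg_one : σ.reg 1 = numEdges G
  reg_two : σ.reg 2 = s
  reg_three : σ.reg 3 = l
  reg_four : σ.reg 4 = k
  reg_rest : ∀ r, 5 ≤ r → σ.reg r = 0
  edges : IsEdgeList G (numEdges G) (σ.arr 0) (σ.arr 1)
  arr_pad : ∀ a i, numEdges G ≤ i → σ.arr a i = 0
  arr_rest : ∀ a i, 2 ≤ a → σ.arr a i = 0

/-- `σ` is a final memory for the output `H`: register `5` holds the number of edges of `H` and
arrays `2` and `3` hold an edge list of `H`. -/
structure IsOutput {n : ℕ} (H : Digraph (Fin n)) (σ : RAM.State) : Prop where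
  reg_five : σ.reg 5 = numEdges H
  edges : IsEdgeList H (numEdges H) (σ.arr 2) (σ.arr 3)

end FTRS

/-! Reduction to reachability. If `H - F` lacks `l` edge-disjoint paths to `v`, Menger's theorem
gives a cut `C` of fewer than `l` edges; if `G - F` has `l` such paths, one of them avoids `C`. So
it suffices that `H` preserves plain reachability from `s` under mixed failures of at most `l + k -
1` edges and vertices (`isFTRS_of_mixed`).

Reduction to small out-degree. Replace the out-edges of each vertex by a linked list of nodes, one
per edge: the vertex has a single arc into its list, and a list node has one arc to the head of its
edge and one to the next list node. Out-degrees are at most 2, and 1 at the source. The failure of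
an edge or of a vertex becomes the failure of one arc (`isFTRS_subgraphOf`).

Thinning out the arcs into one vertex `v ≠ s`. Put `K = l + k - 1` and `S 0 = {s}`. Let `R i` be the
farthest minimum cut that contains `S i` and avoids `v`, and let `S (i + 1)` be `R i` with the heads
of its leaving arcs, without `v`. Since `R i` has no more leaving arcs than `S i`, the out-degree
bound gives `S i` at most `2 ^ i` leaving arcs (`Layer.card_out_le`). A maximum flow from `S K` to
`v` thus has value `q ≤ 2 ^ K` and uses at most `2 ^ K + 2` arcs into `v`; all other arcs into `v`
are deleted.

Suppose that at most `K` failures cut `v` off after the deletion but not before. Let `X` be what `s`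
still reaches, and `T` a residually closed set that contains `S K` and avoids `v`; then `T` is a
minimum cut. Some deleted arc leads from `X` to `v`, and its tail is outside `T`. Comparing with the
farthest cuts `R i` one after the other, each contributing one extra arc by submodularity, every set
that contains `X ∩ S K` and avoids `v` has more than `K` leaving arcs (`Layer.lt_card_out`). Apply
this to `X ∩ T`: submodularity for `X` and `T` leaves fewer than `q` arcs out of `X ∪ T`, against
the flow (`preserves_of_layer`). Thinning out one vertex after the other composes.

The algorithm does exactly this. A backward search from `v` in the residual graph takes linear time.
It either finds an augmenting path, or its unvisited nodes form the farthest minimum cut and yield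
the next layer. A flow stays a flow when its source grows, so there are at most `2 ^ K + K + 1`
rounds per edge. The pure existence statement is read off from a run of the program. -/

/-! ## Cuts and unit flows in multidigraphs -/

namespace ArcGraph

variable {V α : Type*} (tl hd : α → V)

open scoped Classical in
/-- The arcs of `A` that leave `X`. -/
noncomputable def out (A : Finset α) (X : Set V) : Finset α :=
  A.filter fun a => tl a ∈ X ∧ hd a ∉ X

open scoped Classical in
/-- The net number of arcs of `R` that leave `X`. -/
noncomputable def net (R : Finset α) (X : Set V) : ℤ :=
  ∑ a ∈ R, ((if tl a ∈ X then 1 else 0) - (if hd a ∈ X then 1 else 0))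

/-- `R` is a unit flow in `A` of value `q` from `S` to `v`. -/
structure IsFlow (A R : Finset α) (S : Set V) (v : V) (q : ℕ) : Prop where
  subset : R ⊆ A
  net_eq : ∀ X : Set V, S ⊆ X → v ∉ X → net tl hd R X = q

/-- Adjacency in the residual graph. -/
def Res (A R : Finset α) (x y : V) : Prop :=
  ∃ a ∈ A, (a ∉ R ∧ tl a = x ∧ hd a = y) ∨ (a ∈ R ∧ hd a = x ∧ tl a = y)

/-- Adjacency in `A - D`. -/
def Step (A D : Finset α) (x y : V) : Prop := ∃ a ∈ A, a ∉ D ∧ tl a = x ∧ hd a = y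

/-- Reachability in `A - D`. -/
def Reach (A D : Finset α) : V → V → Prop := Relation.ReflTransGen (Step tl hd A D)

/-- Deleting at most `k` arcs, everything reachable from `s` in `A` is reachable in `A'`. -/
def Preserves (A A' : Finset α) (s : V) (k : ℕ) : Prop :=
  ∀ D : Finset α, D.card ≤ k → ∀ w, Reach tl hd A D s w → Reach tl hd A' D s w

variable {tl hd}

theorem mem_out {A : Finset α} {X : Set V} {a : α} :
    a ∈ out tl hd A X ↔ a ∈ A ∧ tl a ∈ X ∧ hd a ∉ X := by
  simp [out]

/-- Submodularity of the cut function, which holds for each arc separately. -/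
theorem card_out_union_add_inter (A : Finset α) (X Y : Set V) :
    (out tl hd A (X ∪ Y)).card + (out tl hd A (X ∩ Y)).card ≤
      (out tl hd A X).card + (out tl hd A Y).card := by
  classical
  simp only [out, Finset.card_filter, ← Finset.sum_add_distrib]
  refine Finset.sum_le_sum fun a _ => ?_
  by_cases h1 : tl a ∈ X <;> by_cases h2 : tl a ∈ Y <;> by_cases h3 : hd a ∈ X <;>
    by_cases h4 : hd a ∈ Y <;> simp [h1, h2, h3, h4]

theorem card_out_mono {A A' : Finset α} (h : A' ⊆ A) (X : Set V) :
    (out tl hd A' X).card ≤ (out tl hd A X).card :=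
  Finset.card_le_card fun a ha => by
    rw [mem_out] at ha ⊢
    exact ⟨h ha.1, ha.2⟩

-- Arc by arc, the capacity of a cut exceeds the net flow across it by the number of residual arcs
-- leaving it. Weak duality, tightness at residually closed sets and strictness elsewhere are all
-- read off from this identity.
open scoped Classical in
theorem card_out_eq {A R : Finset α} (h : R ⊆ A) (X : Set V) :
    ((out tl hd A X).card : ℤ) = net tl hd R X +
      (A.filter fun a => (a ∉ R ∧ tl a ∈ X ∧ hd a ∉ X) ∨ (a ∈ R ∧ hd a ∈ X ∧ tl a ∉ X)).card := by
  have h1 : net tl hd R X = ∑ a ∈ A, if a ∈ R then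
      (((if tl a ∈ X then 1 else 0) - (if hd a ∈ X then 1 else 0)) : ℤ) else 0 := by
    rw [← Finset.sum_filter, Finset.filter_mem_eq_inter, Finset.inter_eq_right.2 h, net]
  rw [h1]
  simp only [out, Finset.card_filter, Nat.cast_sum, ← Finset.sum_add_distrib]
  refine Finset.sum_congr rfl fun a _ => ?_
  by_cases h1 : tl a ∈ X <;> by_cases h3 : hd a ∈ X <;>
    by_cases h4 : a ∈ R <;> simp [h1, h3, h4]

namespace IsFlow

variable {A R : Finset α} {S X : Set V} {v : V} {q : ℕ}

theorem le_card_out (h : IsFlow tl hd A R S v q) (hS : S ⊆ X) (hv : v ∉ X) :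
    q ≤ (out tl hd A X).card := by
  have := card_out_eq (tl := tl) (hd := hd) h.subset X
  rw [h.net_eq X hS hv] at this
  omega

theorem card_out_eq_of_closed (h : IsFlow tl hd A R S v q) (hS : S ⊆ X) (hv : v ∉ X)
    (hX : ∀ x y, x ∈ X → Res tl hd A R x y → y ∈ X) : (out tl hd A X).card = q := by
  classical
  have h1 := card_out_eq (tl := tl) (hd := hd) h.subset X
  rw [h.net_eq X hS hv, Finset.filter_eq_empty_iff.2] at h1
  · simpa using h1
  · rintro a ha (⟨h2, h3, h4⟩ | ⟨h2, h3, h4⟩)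
    · exact h4 (hX _ _ h3 ⟨a, ha, Or.inl ⟨h2, rfl, rfl⟩⟩)
    · exact h4 (hX _ _ h3 ⟨a, ha, Or.inr ⟨h2, rfl, rfl⟩⟩)

theorem lt_card_out (h : IsFlow tl hd A R S v q) (hS : S ⊆ X) (hv : v ∉ X) {x y : V}
    (hx : x ∈ X) (hy : y ∉ X) (hxy : Res tl hd A R x y) : q < (out tl hd A X).card := by
  classical
  have h1 := card_out_eq (tl := tl) (hd := hd) h.subset X
  rw [h.net_eq X hS hv] at h1
  obtain ⟨a, ha, h2⟩ := hxy
  have : 0 < (A.filter fun a => (a ∉ R ∧ tl a ∈ X ∧ hd a ∉ X) ∨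
      (a ∈ R ∧ hd a ∈ X ∧ tl a ∉ X)).card := by
    refine Finset.card_pos.2 ⟨a, Finset.mem_filter.2 ⟨ha, ?_⟩⟩
    rcases h2 with ⟨h2, rfl, rfl⟩ | ⟨h2, rfl, rfl⟩
    · exact Or.inl ⟨h2, hx, hy⟩
    · exact Or.inr ⟨h2, hx, hy⟩
  omega

/-- A residual path from inside `X` to `v` leaves `X` along some residual arc, so the cut is not
tight. This makes the set of nodes without a residual path to `v` the farthest minimum cut. -/
theorem lt_card_out_of_reach (h : IsFlow tl hd A R S v q) (hS : S ⊆ X) (hv : v ∉ X) {x : V}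
    (hx : x ∈ X) (hxv : Relation.ReflTransGen (Res tl hd A R) x v) :
    q < (out tl hd A X).card := by
  induction hxv using Relation.ReflTransGen.head_induction_on with
  | refl => exact absurd hx hv
  | @head a c hab _ ih =>
    by_cases hc : c ∈ X
    · exact ih hc
    · exact h.lt_card_out hS hv hx hc hab

theorem mono_source (h : IsFlow tl hd A R S v q) (hS : S ⊆ X) : IsFlow tl hd A R X v q :=
  ⟨h.subset, fun _ hY => h.net_eq _ (hS.trans hY)⟩

theorem mono_arcs {A' : Finset α} (h : IsFlow tl hd A R S v q) (hR : R ⊆ A') :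
    IsFlow tl hd A' R S v q :=
  ⟨hR, h.net_eq⟩

end IsFlow

theorem net_insert [DecidableEq α] {R : Finset α} {a : α} (ha : a ∉ R) (X : Set V)
    [DecidablePred (· ∈ X)] : net tl hd (insert a R) X = net tl hd R X +
      ((if tl a ∈ X then 1 else 0) - (if hd a ∈ X then 1 else 0)) := by
  classical
  rw [net, net, Finset.sum_insert ha, add_comm]
  congr

theorem net_erase [DecidableEq α] {R : Finset α} {a : α} (ha : a ∈ R) (X : Set V)
    [DecidablePred (· ∈ X)] : net tl hd (R.erase a) X = net tl hd R X -
      ((if tl a ∈ X then 1 else 0) - (if hd a ∈ X then 1 else 0)) := by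
  have := net_insert (tl := tl) (hd := hd) (Finset.notMem_erase a R) X
  rw [Finset.insert_erase ha] at this
  linarith

/-- The sources that arise from `s` by repeatedly passing to a farthest minimum cut and to the heads
of its arcs. -/
inductive Layer (tl hd : α → V) (A : Finset α) (s v : V) : ℕ → Set V → Prop
  | zero : Layer tl hd A s v 0 {s}
  | succ {i : ℕ} {S R : Set V} (hL : Layer tl hd A s v i S) (hSR : S ⊆ R) (hv : v ∉ R)
      (hmin : (out tl hd A R).card ≤ (out tl hd A S).card)
      (hfar : ∀ X : Set V, R ⊆ X → v ∉ X → (∃ a ∈ A, hd a ∈ X ∧ hd a ∉ R) →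
        (out tl hd A R).card < (out tl hd A X).card) :
      Layer tl hd A s v (i + 1) {x | x ≠ v ∧ (x ∈ R ∨ ∃ a ∈ A, tl a ∈ R ∧ hd a = x)}

namespace Layer

variable {A : Finset α} {s v : V} {i : ℕ} {S : Set V}

theorem notMem (h : Layer tl hd A s v i S) (hs : s ≠ v) : v ∉ S := by
  cases h with
  | zero => simpa using hs.symm
  | succ => simp

theorem source_mem (h : Layer tl hd A s v i S) (hs : s ≠ v) : s ∈ S := by
  induction h with
  | zero => simp
  | succ hL hSR hv hmin hfar ih => exact ⟨hs, Or.inl (hSR ih)⟩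

-- An arc leaving the next layer either goes from `R` straight to `v`, or starts at the head,
-- different from `v`, of an arc leaving `R`. Each arc leaving `R` accounts for at most one arc of
-- the first kind or two of the second, so the count at most doubles.
open scoped Classical in
theorem card_out_le (h : Layer tl hd A s v i S) (hs : (A.filter fun a => tl a = s).card ≤ 1)
    (hA : ∀ x, (A.filter fun a => tl a = x).card ≤ 2) : (out tl hd A S).card ≤ 2 ^ i := by
  induction h with
  | zero =>
    refine le_trans (Finset.card_le_card fun a ha => ?_) hs
    rw [mem_out] at ha
    simpa using ⟨ha.1, ha.2.1⟩
  | @succ i S R hL hSR hv hmin hfar ih =>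
    set O := out tl hd A R
    have h1 : out tl hd A {x | x ≠ v ∧ (x ∈ R ∨ ∃ a ∈ A, tl a ∈ R ∧ hd a = x)} ⊆
        (O.filter fun a => hd a = v) ∪ (O.filter fun a => hd a ≠ v).biUnion
          fun b => A.filter fun a => tl a = hd b := by
      intro a ha
      simp only [mem_out, Set.mem_ofPred_eq, not_and, not_or, not_exists] at ha
      obtain ⟨ha, ⟨h2, h3⟩, h4⟩ := ha
      simp only [Finset.mem_union, Finset.mem_filter, Finset.mem_biUnion]
      by_cases h5 : tl a ∈ R
      · have h6 : hd a = v := by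
          by_contra h6
          exact (h4 h6).2 a ha h5 rfl
        exact Or.inl ⟨mem_out.2 ⟨ha, h5, h6 ▸ hv⟩, h6⟩
      · obtain ⟨b, hb, h6, h7⟩ := h3.resolve_left h5
        exact Or.inr ⟨b, ⟨mem_out.2 ⟨hb, h6, h7 ▸ h5⟩, h7 ▸ h2⟩, ha, h7.symm⟩
    have h2 : ((O.filter fun a => hd a ≠ v).biUnion
        fun b => A.filter fun a => tl a = hd b).card ≤ (O.filter fun a => hd a ≠ v).card * 2 :=
      Finset.card_biUnion_le_card_mul _ _ _ fun b _ => hA _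
    have h3 := (Finset.card_le_card h1).trans (Finset.card_union_le _ _)
    have h4 := Finset.card_filter_add_card_filter_not (s := O) (fun a => hd a = v)
    have h5 : (2 : ℕ) ^ (i + 1) = 2 * 2 ^ i := pow_succ' 2 i
    have h6 : O.card ≤ 2 ^ i := hmin.trans ih
    simp only [ne_eq] at h2 h3 h4 ⊢
    omega

/-- Here `hX` says that `X` is spanned from `s` by arcs inside `X`. As `tl e` lies in `X` but not in
`R`, an arc `f` inside `X` leaves `R`; its head belongs to the next layer, hence to `Z`. So `Z ∪ R`
passes strictly beyond the farthest cut `R`, and submodularity makes the cut of `Z` larger than that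
of `Z ∩ R`, to which induction applies. At layer zero, a `Z` without leaving arcs would contain `X`,
and then also `v`. -/
theorem lt_card_out (h : Layer tl hd A s v i S) (hs : s ≠ v) {X : Set V} (hsX : s ∈ X)
    (hX : ∀ Y : Set V, s ∈ Y → (∀ a ∈ A, tl a ∈ X → tl a ∈ Y → hd a ∈ X → hd a ∈ Y) → X ⊆ Y)
    {e : α} (he : e ∈ A) (heX : tl e ∈ X) (hev : hd e = v) (heS : tl e ∉ S) (hvX : v ∉ X)
    {Z : Set V} (hZ : X ∩ S ⊆ Z) (hvZ : v ∉ Z) : i < (out tl hd A Z).card := by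
  induction h generalizing Z with
  | zero =>
    by_contra h0
    have h1 : out tl hd A Z = ∅ := Finset.card_eq_zero.1 (by omega)
    have h2 : ∀ a ∈ A, tl a ∈ Z → hd a ∈ Z := fun a ha h3 => by
      by_contra h4
      have : a ∈ out tl hd A Z := mem_out.2 ⟨ha, h3, h4⟩
      simp [h1] at this
    have h3 : X ⊆ Z := hX Z (hZ ⟨hsX, rfl⟩) fun a ha _ h4 _ => h2 a ha h4
    exact hvZ (hev ▸ h2 e he (h3 heX))
  | @succ i S R hL hSR hv hmin hfar ih =>
    have heR : tl e ∉ R := fun h1 => heS ⟨fun h2 => hvX (h2 ▸ heX), Or.inl h1⟩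
    have hsR : s ∈ R := hSR (hL.source_mem hs)
    obtain ⟨f, hf, h1, h2, h3, h4⟩ : ∃ f ∈ A, tl f ∈ X ∧ tl f ∈ R ∧ hd f ∈ X ∧ hd f ∉ R := by
      by_contra! hcon
      exact heR (hX R hsR (fun a ha h1 h2 h3 => hcon a ha h1 h2 h3) heX)
    have h5 : hd f ∈ Z := hZ ⟨h3, fun h6 => hvX (h6 ▸ h3), Or.inr ⟨f, hf, h2, rfl⟩⟩
    have h6 := hfar (Z ∪ R) Set.subset_union_right (by simp [hv, hvZ])
      ⟨f, hf, Or.inl h5, h4⟩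
    have h7 := card_out_union_add_inter (tl := tl) (hd := hd) A Z R
    have h8 := ih (fun h8 => heR (hSR h8)) (Z := Z ∩ R)
      (fun x hx => ⟨hZ ⟨hx.1, fun h9 => hv (h9 ▸ hSR hx.2), Or.inl (hSR hx.2)⟩, hSR hx.2⟩)
      (fun h9 => hvZ h9.1)
    omega

end Layer

theorem Preserves.trans {A A' A'' : Finset α} {s : V} {k : ℕ} (h : Preserves tl hd A A' s k)
    (h' : Preserves tl hd A' A'' s k) : Preserves tl hd A A'' s k :=
  fun D hD w hw => h' D hD w (h D hD w hw)

theorem Preserves.refl (A : Finset α) (s : V) (k : ℕ) : Preserves tl hd A A s k :=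
  fun _ _ _ h => h

/-- A path can fail to survive only where it uses a lost arc, and that arc ends in `v`; so it
suffices to be able to reach `v` anew. -/
theorem preserves_of_reach {A A' : Finset α} {s v : V} {k : ℕ}
    (hAA : ∀ a ∈ A, a ∉ A' → hd a = v)
    (hv : ∀ D : Finset α, D.card ≤ k → Reach tl hd A D s v → Reach tl hd A' D s v) :
    Preserves tl hd A A' s k := by
  intro D hD w hw
  induction hw with
  | refl => exact .refl
  | @tail b c hb hbc ih =>
    obtain ⟨a, ha, haD, rfl, rfl⟩ := hbc
    by_cases h : a ∈ A'
    · exact ih.tail ⟨a, h, haD, rfl, rfl⟩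
    · have h1 := hAA a ha h
      rw [h1]
      exact hv D hD (h1 ▸ hb.tail ⟨a, ha, haD, rfl, rfl⟩)

theorem preserves_source {A A' : Finset α} {s : V} {k : ℕ}
    (hAA : ∀ a ∈ A, a ∉ A' → hd a = s) : Preserves tl hd A A' s k :=
  preserves_of_reach hAA fun _ _ _ => .refl

/-- Of the arcs into `v`, only those used by a maximum flow from the `k`-th layer are needed. -/
theorem preserves_of_layer {A A' R : Finset α} {s v : V} {k q : ℕ} {S T : Set V} (hs : s ≠ v)
    (hL : Layer tl hd A s v k S) (hR : IsFlow tl hd A R S v q) (hST : S ⊆ T) (hvT : v ∉ T)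
    (hT : ∀ x y, x ∈ T → Res tl hd A R x y → y ∈ T) (hA : A' ⊆ A)
    (hAA : ∀ a ∈ A, a ∉ A' → hd a = v ∧ a ∉ R) : Preserves tl hd A A' s k := by
  refine preserves_of_reach (fun a ha h => (hAA a ha h).1) fun D hD hr => ?_
  by_contra hnr
  set X : Set V := {x | Reach tl hd A' D s x} with hXdef
  have hsX : s ∈ X := Relation.ReflTransGen.refl
  have hvX : v ∉ X := hnr
  obtain ⟨e, he, heD, heX, heX'⟩ : ∃ e ∈ A, e ∉ D ∧ tl e ∈ X ∧ hd e ∉ X := by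
    by_contra! hcon
    have hcl : ∀ w, Reach tl hd A D s w → w ∈ X := fun w hw => by
      induction hw with
      | refl => exact hsX
      | tail _ hbc ih =>
        obtain ⟨a, ha, haD, rfl, rfl⟩ := hbc
        exact hcon a ha haD ih
    exact hvX (hcl v hr)
  have heA : e ∉ A' := fun h => heX' (Relation.ReflTransGen.tail heX ⟨e, h, heD, rfl, rfl⟩)
  obtain ⟨hev, heR⟩ := hAA e he heA
  have hRA : R ⊆ A' := fun a ha => by
    by_contra h
    exact (hAA a (hR.subset ha) h).2 ha
  -- A lost arc carries no flow, so from a tail in `T` it would be a residual arc into `v`.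
  have hnT : ∀ a ∈ A, a ∉ A' → tl a ∉ T := fun a ha h h1 => by
    obtain ⟨h2, h3⟩ := hAA a ha h
    exact hvT (hT _ _ h1 ⟨a, ha, Or.inl ⟨h3, rfl, h2⟩⟩)
  have hconn : ∀ Y : Set V, s ∈ Y →
      (∀ a ∈ A, tl a ∈ X → tl a ∈ Y → hd a ∈ X → hd a ∈ Y) → X ⊆ Y := by
    intro Y hsY hY x hx
    induction hx with
    | refl => exact hsY
    | tail hb hbc ih =>
      have hc := hb.tail hbc
      obtain ⟨a, ha, haD, rfl, rfl⟩ := hbc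
      exact hY a (hA ha) hb ih hc
  have h1 : k < (out tl hd A (X ∩ T)).card :=
    hL.lt_card_out hs hsX hconn he heX hev (fun h => hnT e he heA (hST h)) hvX
      (Set.inter_subset_inter_right X hST) (fun h => hvX h.1)
  -- Lost arcs start outside `T`, so they do not leave `X ∩ T`.
  have h2 : (out tl hd A (X ∩ T)).card ≤ (out tl hd A' (X ∩ T)).card :=
    Finset.card_le_card fun a ha => by
      rw [mem_out] at ha ⊢
      refine ⟨?_, ha.2⟩
      by_contra h
      exact hnT a ha.1 h ha.2.1.2
  have h3 : (out tl hd A' X).card ≤ k := by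
    refine (Finset.card_le_card fun a ha => ?_).trans hD
    rw [mem_out] at ha
    by_contra h
    exact ha.2.2 (Relation.ReflTransGen.tail ha.2.1 ⟨a, ha.1, h, rfl, rfl⟩)
  -- In `A'` the cuts `X` and `T` have at most `k` and `q` arcs, whereas `X ∩ T` has more than `k`
  -- and `X ∪ T` at least `q`: a contradiction.
  have h4 := card_out_union_add_inter (tl := tl) (hd := hd) A' X T
  have h5 : q ≤ (out tl hd A' (X ∪ T)).card :=
    (hR.mono_arcs hRA).le_card_out (hST.trans Set.subset_union_right) (by simp [hvX, hvT])
  have h6 := hR.card_out_eq_of_closed hST hvT hT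
  have h7 := card_out_mono (tl := tl) (hd := hd) hA T
  omega

-- The net flow out of the complement of `v` is the number of flow arcs into `v` minus the number
-- out of `v`. Flow passing through `v` is limited by its out-degree.
open scoped Classical in
theorem IsFlow.card_into_le {A R : Finset α} {S : Set V} {v : V} {q : ℕ}
    (hR : IsFlow tl hd A R S v q) (hv : v ∉ S) (hloop : ∀ a ∈ A, hd a = v → tl a ≠ v) :
    (R.filter fun a => hd a = v).card ≤ q + (A.filter fun a => tl a = v).card := by
  have h1 := hR.net_eq {v}ᶜ (by simpa using hv) (by simp)
  have h2 : net tl hd R {v}ᶜ =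
      (R.filter fun a => hd a = v).card - ((R.filter fun a => tl a = v).card : ℤ) := by
    simp only [net, Finset.card_filter, Nat.cast_sum, ← Finset.sum_sub_distrib]
    refine Finset.sum_congr rfl fun a ha => ?_
    by_cases h3 : hd a = v
    · simp [h3, hloop a (hR.subset ha) h3]
    · by_cases h4 : tl a = v <;> simp [h3, h4]
  have h3 : (R.filter fun a => tl a = v).card ≤ (A.filter fun a => tl a = v).card :=
    Finset.card_le_card (Finset.filter_subset_filter _ hR.subset)
  omega

end ArcGraph

/-! ## Menger's theorem for edge-disjoint paths in digraphs -/

theorem Relation.ReflTransGen.exists_nodup_isChain {V : Type*} {r : V → V → Prop} {x y : V}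
    (h : Relation.ReflTransGen r x y) :
    ∃ p : List V, p.IsChain r ∧ p.Nodup ∧ p.head? = some x ∧ p.getLast? = some y := by
  induction h using Relation.ReflTransGen.head_induction_on with
  | refl => exact ⟨[y], by simp, by simp, by simp, by simp⟩
  | @head a c hac _ ih =>
    obtain ⟨p, h1, h2, h3, h4⟩ := ih
    by_cases ha : a ∈ p
    · obtain ⟨l₁, l₂, rfl⟩ := List.append_of_mem ha
      refine ⟨a :: l₂, h1.right_of_append, (List.nodup_append.1 h2).2.1, rfl, ?_⟩
      simpa using h4
    · cases p with
      | nil => simp at h3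
      | cons b t =>
        obtain rfl : b = c := by simpa using h3
        exact ⟨a :: b :: t, List.IsChain.cons_cons hac h1, List.nodup_cons.2 ⟨ha, h2⟩, rfl,
          by simpa using h4⟩

namespace ArcGraph

variable {V α : Type*} {tl hd : α → V}

-- Augmentation along a simple residual path, from its end backwards. The last clause is what the
-- induction needs: an arc changes its status only if its residual start lies on the path. The start
-- of the next arc is not on the part already treated, so that arc still has its original status.
open scoped Classical in
theorem exists_augment {A R : Finset α} (hRA : R ⊆ A) (p : List V) {x y : V}
    (hc : p.IsChain (Res tl hd A R)) (hn : p.Nodup) (hx : p.head? = some x)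
    (hy : p.getLast? = some y) :
    ∃ R' ⊆ A, (∀ X : Set V, net tl hd R' X =
      net tl hd R X + ((if x ∈ X then 1 else 0) - (if y ∈ X then 1 else 0))) ∧
      ∀ a, (a ∈ R' ↔ a ∈ R) ∨ (if a ∈ R then hd a else tl a) ∈ p := by
  induction p generalizing x with
  | nil => simp at hx
  | cons b t ih =>
    obtain rfl : b = x := by simpa using hx
    cases t with
    | nil =>
      obtain rfl : b = y := by simpa using hy
      exact ⟨R, hRA, by simp, fun a => Or.inl Iff.rfl⟩
    | cons c t =>
      rw [List.isChain_cons_cons] at hc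
      rw [List.nodup_cons] at hn
      obtain ⟨R', h1, h2, h3⟩ := ih hc.2 hn.2 (x := c) rfl (by simpa using hy)
      obtain ⟨a, ha, ⟨h4, rfl, rfl⟩ | ⟨h4, rfl, rfl⟩⟩ := hc.1
      · have h5 : a ∉ R' := by
          rcases h3 a with h5 | h5
          · rwa [h5]
          · rw [if_neg h4] at h5
            exact absurd h5 hn.1
        refine ⟨insert a R', Finset.insert_subset ha h1, fun X => ?_, fun b => ?_⟩
        · rw [net_insert h5, h2]
          ring
        · by_cases hb : b = a
          · subst hb
            simp [h4]
          · rcases h3 b with h6 | h6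
            · simp [hb, h6]
            · exact Or.inr (List.mem_cons_of_mem _ h6)
      · have h5 : a ∈ R' := by
          rcases h3 a with h5 | h5
          · rwa [h5]
          · rw [if_pos h4] at h5
            exact absurd h5 hn.1
        refine ⟨R'.erase a, (Finset.erase_subset _ _).trans h1, fun X => ?_, fun b => ?_⟩
        · rw [net_erase h5, h2]
          ring
        · by_cases hb : b = a
          · subst hb
            simp [h4]
          · rcases h3 b with h6 | h6
            · simp [hb, h6]
            · exact Or.inr (List.mem_cons_of_mem _ h6)

/-- If `v` cannot be reached in the residual graph, the reachable set is a cut of exactly `q` arcs;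
so a flow below every cut size can be augmented. -/
theorem exists_isFlow {A : Finset α} {s v : V} {l : ℕ}
    (h : ∀ X : Set V, s ∈ X → v ∉ X → l ≤ (out tl hd A X).card) :
    ∃ R, IsFlow tl hd A R {s} v l := by
  classical
  suffices ∀ q ≤ l, ∃ R, IsFlow tl hd A R {s} v q from this l le_rfl
  intro q
  induction q with
  | zero => exact fun _ => ⟨∅, Finset.empty_subset _, by simp [net]⟩
  | succ q ih =>
    intro hq
    obtain ⟨R, hR⟩ := ih (by omega)
    have hr : Relation.ReflTransGen (Res tl hd A R) s v := by
      by_contra hr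
      have h1 := h {x | Relation.ReflTransGen (Res tl hd A R) s x} .refl hr
      rw [hR.card_out_eq_of_closed (X := {x | Relation.ReflTransGen (Res tl hd A R) s x})
        (Set.singleton_subset_iff.2 .refl) hr
        fun x y hx hy => Relation.ReflTransGen.tail hx hy] at h1
      omega
    obtain ⟨p, h1, h2, h3, h4⟩ := hr.exists_nodup_isChain
    obtain ⟨R', h5, h6, -⟩ := exists_augment hR.subset p h1 h2 h3 h4
    refine ⟨R', h5, fun X hX hv => ?_⟩
    rw [h6, hR.net_eq X hX hv, if_pos (hX rfl), if_neg hv]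
    push_cast
    ring

end ArcGraph

namespace FTRS

open ArcGraph

variable {V : Type*}

theorem pathEdges_cons_cons (x y : V) (t : List V) :
    pathEdges (x :: y :: t) = (x, y) :: pathEdges (y :: t) := rfl

theorem fst_mem_of_mem_pathEdges {p : List V} {e : V × V} (h : e ∈ pathEdges p) : e.1 ∈ p :=
  (List.of_mem_zip (a := e.1) (b := e.2) h).1

theorem nodup_pathEdges {p : List V} (h : p.Nodup) : (pathEdges p).Nodup := by
  induction p with
  | nil => simp [pathEdges]
  | cons x t ih =>
    cases t with
    | nil => simp [pathEdges]
    | cons y t =>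
      rw [pathEdges_cons_cons, List.nodup_cons]
      rw [List.nodup_cons] at h
      exact ⟨fun h1 => h.1 (fst_mem_of_mem_pathEdges h1), ih h.2⟩

theorem isChain_iff_pathEdges {r : V → V → Prop} {p : List V} :
    p.IsChain r ↔ ∀ e ∈ pathEdges p, r e.1 e.2 := by
  induction p with
  | nil => simp [pathEdges]
  | cons x t ih =>
    cases t with
    | nil => simp [pathEdges]
    | cons y t => simp [pathEdges_cons_cons, ih]

theorem reflTransGen_of_isChain {r : V → V → Prop} {p : List V} {x y : V} (h : p.IsChain r)
    (hx : p.head? = some x) (hy : p.getLast? = some y) : Relation.ReflTransGen r x y := by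
  induction p generalizing x with
  | nil => simp at hx
  | cons b t ih =>
    obtain rfl : b = x := by simpa using hx
    cases t with
    | nil =>
      obtain rfl : b = y := by simpa using hy
      exact .refl
    | cons c t =>
      rw [List.isChain_cons_cons] at h
      exact .head h.1 (ih h.2 rfl (by simpa using hy))

open scoped Classical in
theorem sum_pathEdges (p : List V) {x y : V} (hx : p.head? = some x)
    (hy : p.getLast? = some y) (X : Set V) :
    ((pathEdges p).map fun e =>
      (((if e.1 ∈ X then 1 else 0) - (if e.2 ∈ X then 1 else 0)) : ℤ)).sum =
      (if x ∈ X then 1 else 0) - (if y ∈ X then 1 else 0) := by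
  induction p generalizing x with
  | nil => simp at hx
  | cons b t ih =>
    obtain rfl : b = x := by simpa using hx
    cases t with
    | nil =>
      obtain rfl : b = y := by simpa using hy
      simp [pathEdges]
    | cons c t =>
      rw [pathEdges_cons_cons, List.map_cons, List.sum_cons, ih rfl (by simpa using hy)]
      ring

/-- Only net values matter, so `R` may contain cycles. If `v` were unreachable in `R`, the reachable
set would have net value at most `0`; removing the edges of a simple path lowers every net value
across an `s`-`v` cut by one. -/
theorem exists_disjoint_of_net {s v : V} (l : ℕ) (R : Finset (V × V))
    (hR : ∀ X : Set V, s ∈ X → v ∉ X → net Prod.fst Prod.snd R X = l) :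
    ∃ P : Fin l → List V, (∀ i, (∀ e ∈ pathEdges (P i), e ∈ R) ∧ (P i).Nodup ∧
      (P i).head? = some s ∧ (P i).getLast? = some v) ∧
      ∀ i j, i ≠ j → (pathEdges (P i)).Disjoint (pathEdges (P j)) := by
  classical
  induction l generalizing R with
  | zero => exact ⟨fun i => i.elim0, fun i => i.elim0, fun i => i.elim0⟩
  | succ l ih =>
    have hr : Relation.ReflTransGen (fun x y => (x, y) ∈ R) s v := by
      by_contra hr
      have h1 := hR {x | Relation.ReflTransGen (fun x y => (x, y) ∈ R) s x} .refl hr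
      have h2 : net Prod.fst Prod.snd R
          {x | Relation.ReflTransGen (fun x y => (x, y) ∈ R) s x} ≤ 0 := by
        refine Finset.sum_nonpos fun e he => ?_
        by_cases h3 : Relation.ReflTransGen (fun x y => (x, y) ∈ R) s e.1
        · simp [h3, h3.tail (c := e.2) he]
        · by_cases h4 : Relation.ReflTransGen (fun x y => (x, y) ∈ R) s e.2 <;> simp [h3, h4]
      push_cast at h1
      omega
    obtain ⟨p, h1, h2, h3, h4⟩ := hr.exists_nodup_isChain
    rw [isChain_iff_pathEdges] at h1
    have hsub : (pathEdges p).toFinset ⊆ R := fun e he => h1 e (List.mem_toFinset.1 he)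
    obtain ⟨P, hP, hPd⟩ := ih (R \ (pathEdges p).toFinset) fun X hs hv => by
      have h5 := hR X hs hv
      have h6 := sum_pathEdges p h3 h4 X
      rw [← List.sum_toFinset _ (nodup_pathEdges h2), if_pos hs, if_neg hv] at h6
      rw [net, ← Finset.sum_sdiff hsub] at h5
      rw [net]
      push_cast at h5
      linarith
    have hd : ∀ i, (pathEdges p).Disjoint (pathEdges (P i)) := fun i e he he' => by
      have := (hP i).1 e he'
      simp [he] at this
    refine ⟨Fin.cons p P, fun i => ?_, fun i j => ?_⟩
    · induction i using Fin.cases with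
      | zero => exact ⟨h1, h2, h3, h4⟩
      | succ i =>
        refine ⟨fun e he => ?_, (hP i).2⟩
        exact (Finset.mem_sdiff.1 ((hP i).1 e (by simpa using he))).1
    · induction i using Fin.cases with
      | zero =>
        induction j using Fin.cases with
        | zero => simp
        | succ j => exact fun _ => hd j
      | succ i =>
        induction j using Fin.cases with
        | zero => exact fun _ => (hd i).symm
        | succ j => exact fun hij => hPd i j fun h => hij (h ▸ rfl)

/-- **Menger's theorem**: without `l` edge-disjoint paths there is a cut of less than `l` edges. -/
theorem exists_cut_of_not_hasDisjointPaths [Finite V] {G : Digraph V} {l : ℕ} {s v : V}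
    (h : ¬ HasDisjointPaths G l s v) : ∃ (X : Set V) (C : Finset (V × V)), s ∈ X ∧ v ∉ X ∧
      C.card < l ∧ ∀ x y, G.Adj x y → x ∈ X → y ∉ X → (x, y) ∈ C := by
  classical
  by_contra! hcon
  have := Fintype.ofFinite V
  obtain ⟨R, hR⟩ := exists_isFlow (tl := Prod.fst) (hd := Prod.snd)
    (A := Finset.univ.filter fun e : V × V => G.Adj e.1 e.2) (s := s) (v := v) (l := l)
    fun X hs hv => by
      by_contra hlt
      obtain ⟨x, y, h1, h2, h3, h4⟩ := hcon X _ hs hv (not_le.1 hlt)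
      exact h4 (mem_out.2 ⟨by simpa using h1, h2, h3⟩)
  obtain ⟨P, hP, hPd⟩ := exists_disjoint_of_net l R
    fun X hs hv => hR.net_eq X (Set.singleton_subset_iff.2 hs) hv
  refine h ⟨P, fun i => ⟨isChain_iff_pathEdges.2 fun e he => ?_, (hP i).2.1, (hP i).2.2.1,
    (hP i).2.2.2⟩, hPd⟩
  simpa using hR.subset ((hP i).1 e he)

/-- Pigeonhole: fewer than `l` edges cannot meet `l` edge-disjoint paths. -/
theorem HasDisjointPaths.exists_avoiding {G : Digraph V} {l : ℕ} {s v : V}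
    (h : HasDisjointPaths G l s v) {C : Finset (V × V)} (hC : C.card < l) :
    Relation.ReflTransGen (fun x y => G.Adj x y ∧ (x, y) ∉ C) s v := by
  obtain ⟨P, hP, hPd⟩ := h
  by_cases hi : ∃ i, ∀ e ∈ pathEdges (P i), e ∉ C
  · obtain ⟨i, hi⟩ := hi
    refine reflTransGen_of_isChain (isChain_iff_pathEdges.2 fun e he => ?_) (hP i).head (hP i).last
    exact ⟨isChain_iff_pathEdges.1 (hP i).chain e he, hi e he⟩
  · push Not at hi
    choose f hf hfC using hi
    have := Finset.card_le_card_of_injOn f (s := Finset.univ) (t := C) (fun i _ => hfC i)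
      fun i _ j _ hij => by
        by_contra h
        exact hPd i j h (hf i) (hij ▸ hf j)
    simp at this
    omega

theorem HasDisjointPaths.mono {G H : Digraph V} (hGH : ∀ x y, G.Adj x y → H.Adj x y) {l : ℕ}
    {s v : V} (h : HasDisjointPaths G l s v) : HasDisjointPaths H l s v := by
  obtain ⟨P, hP, hPd⟩ := h
  exact ⟨P, fun i => ⟨(hP i).chain.imp hGH, (hP i).nodup, (hP i).head, (hP i).last⟩, hPd⟩

theorem hasDisjointPaths_self (G : Digraph V) (l : ℕ) (s : V) : HasDisjointPaths G l s s :=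
  ⟨fun _ => [s], fun _ => ⟨by simp, by simp, rfl, rfl⟩, fun _ _ _ => by simp [pathEdges]⟩

theorem hasDisjointPaths_zero (G : Digraph V) (s v : V) : HasDisjointPaths G 0 s v :=
  ⟨fun i => i.elim0, fun i => i.elim0, fun i => i.elim0⟩

/-- It suffices to preserve reachability from `s` under mixed failures of less than `l + k` edges
and vertices. -/
theorem isFTRS_of_mixed [Finite V] {G H : Digraph V} {s : V} {l k : ℕ} (hHG : H ≤ G)
    (h : ∀ (C : Finset (V × V)) (F : Finset V) (w : V), C.card + F.card < l + k → s ∉ F →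
      Relation.ReflTransGen (fun x y => G.Adj x y ∧ (x, y) ∉ C ∧ x ∉ F ∧ y ∉ F) s w → w ∉ F →
      Relation.ReflTransGen (fun x y => H.Adj x y ∧ (x, y) ∉ C ∧ x ∉ F ∧ y ∉ F) s w) :
    IsFTRS G s l k H := by
  classical
  have hadj : ∀ x y, H.Adj x y → G.Adj x y := fun x y hxy => hHG hxy
  have hclosed : ∀ {r : V → V → Prop} {X : Set V}, s ∈ X → (∀ x y, r x y → x ∈ X → y ∈ X) →
      ∀ {w}, Relation.ReflTransGen r s w → w ∈ X := by
    intro r X hs hX w hw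
    induction hw with
    | refl => exact hs
    | tail _ hbc ih => exact hX _ _ hbc ih
  refine ⟨hHG, fun F _ hF v => ⟨fun hG => ?_, fun hH =>
    HasDisjointPaths.mono
      (G := deleteEdges H F) (H := deleteEdges G F) (fun x y hxy => ⟨hadj x y hxy.1, hxy.2⟩) hH⟩,
    fun F hF v => ⟨fun hG => ?_, fun hH =>
    HasDisjointPaths.mono
      (G := deleteVerts H F) (H := deleteVerts G F) (fun x y hxy => ⟨hadj x y hxy.1, hxy.2⟩) hH⟩⟩
  · by_contra hH
    obtain ⟨X, C, hs, hv, hC, hX⟩ := exists_cut_of_not_hasDisjointPaths hH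
    -- The failed edges and the Menger cut of `H - F` together form a set of fewer than `l + k`
    -- edges.
    have h1 := h (F ∪ C) ∅ v (by
        have := Finset.card_union_le F C
        simp only [Finset.card_empty]
        omega) (by simp)
      (Relation.ReflTransGen.mono (fun x y hxy => by
        obtain ⟨⟨h1, h2⟩, h3⟩ := hxy
        simpa using ⟨h1, by simpa using h2, h3⟩) _ _ (hG.exists_avoiding hC)) (by simp)
    refine hv (hclosed hs (fun x y hxy hx => ?_) h1)
    by_contra hy
    simp only [Finset.mem_union, not_or] at hxy
    exact hxy.2.1.2 (hX x y ⟨hxy.1, by simpa using hxy.2.1.1⟩ hx hy)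
  · by_contra hH
    rcases Nat.eq_zero_or_pos l with rfl | hl
    · exact hH (hasDisjointPaths_zero _ _ _)
    have hsv : v ≠ s := by
      rintro rfl
      exact hH (hasDisjointPaths_self _ _ _)
    -- A path in `G - F` is nontrivial because `v ≠ s`; its first and last edges show that `s` and
    -- `v` did not fail.
    have hr := hG.exists_avoiding (C := ∅) (by simpa using hl)
    have hsF : s ∉ F := by
      rcases hr.cases_head with h1 | ⟨c, ⟨h1, -⟩, -⟩
      · exact absurd h1.symm hsv
      · simpa using h1.2.1
    have hvF : v ∉ F := by
      rcases hr.cases_tail with h1 | ⟨c, -, ⟨h1, -⟩⟩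
      · exact absurd h1 hsv
      · simpa using h1.2.2
    obtain ⟨X, C, hs, hv, hC, hX⟩ := exists_cut_of_not_hasDisjointPaths hH
    have h1 := h C F v (by omega) hsF
      (Relation.ReflTransGen.mono (fun x y hxy => by
        obtain ⟨⟨h1, h2, h3⟩, h4⟩ := hxy
        exact ⟨h1, h4, by simpa using h2, by simpa using h3⟩) _ _ (hG.exists_avoiding hC)) hvF
    refine hv (hclosed hs (fun x y hxy hx => ?_) h1)
    by_contra hy
    exact hxy.2.1 (hX x y ⟨hxy.1, by simpa using hxy.2.2.1, by simpa using hxy.2.2.2⟩ hx hy)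

end FTRS

/-! ## The auxiliary graph

Vertices `x < n` keep their names, the node `n + 1 + e` stands for the `e`-th edge, and the node `n`
has no outgoing arcs. The out-edges of a vertex `x` are linked into a list that starts at `x`. -/

namespace FTRS

open ArcGraph

/-- One more than the last index `e < j` with `f e = x`, or `0`. -/
def lastBefore (f : ℕ → ℕ) : ℕ → ℕ → ℕ
  | 0, _ => 0
  | j + 1, x => if f j = x then j + 1 else lastBefore f j x

theorem lastBefore_le (f : ℕ → ℕ) (j x : ℕ) : lastBefore f j x ≤ j := by
  induction j with
  | zero => simp [lastBefore]
  | succ j ih =>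
    rw [lastBefore]
    split_ifs <;> omega

theorem of_lastBefore_eq_succ {f : ℕ → ℕ} {j x e : ℕ} (h : lastBefore f j x = e + 1) :
    e < j ∧ f e = x := by
  induction j with
  | zero => simp [lastBefore] at h
  | succ j ih =>
    rw [lastBefore] at h
    split_ifs at h with h1
    · obtain rfl : j = e := by omega
      exact ⟨by omega, h1⟩
    · have := ih h
      exact ⟨by omega, this.2⟩

/-- The tails of the arcs of the auxiliary graph. -/
def auxTl (n m a : ℕ) : ℕ :=
  if a < m then n + 1 + a else if a < 2 * m then n + 1 + (a - m) else a - 2 * m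

/-- The heads of the arcs of the auxiliary graph. -/
def auxHd (n m : ℕ) (tail head : ℕ → ℕ) (a : ℕ) : ℕ :=
  if a < m then head a else if a < 2 * m then n + lastBefore tail (a - m) (tail (a - m))
  else n + lastBefore tail m (a - 2 * m)

section

variable (n m : ℕ) (tail head : ℕ → ℕ)

theorem auxTl_of_lt {a : ℕ} (h : a < m) : auxTl n m a = n + 1 + a := by simp [auxTl, h]

theorem auxTl_add {a : ℕ} (h : a < m) : auxTl n m (m + a) = n + 1 + a := by
  rw [auxTl, if_neg (by omega), if_pos (by omega)]
  omega

theorem auxTl_two_mul_add (a : ℕ) : auxTl n m (2 * m + a) = a := by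
  rw [auxTl, if_neg (by omega), if_neg (by omega)]
  omega

theorem auxHd_of_lt {a : ℕ} (h : a < m) : auxHd n m tail head a = head a := by simp [auxHd, h]

theorem auxHd_add {a : ℕ} (h : a < m) :
    auxHd n m tail head (m + a) = n + lastBefore tail a (tail a) := by
  rw [auxHd, if_neg (by omega), if_pos (by omega), Nat.add_sub_cancel_left]

theorem auxHd_two_mul_add (a : ℕ) :
    auxHd n m tail head (2 * m + a) = n + lastBefore tail m a := by
  rw [auxHd, if_neg (by omega), if_neg (by omega), Nat.add_sub_cancel_left]

theorem arc_cases {a : ℕ} (h : a < 2 * m + n) :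
    a < m ∨ (∃ e < m, a = m + e) ∨ ∃ x < n, a = 2 * m + x := by
  rcases lt_or_ge a m with h1 | h1
  · exact Or.inl h1
  · rcases lt_or_ge a (2 * m) with h2 | h2
    · exact Or.inr (Or.inl ⟨a - m, by omega, by omega⟩)
    · exact Or.inr (Or.inr ⟨a - 2 * m, by omega, by omega⟩)

theorem auxTl_lt {a : ℕ} (h : a < 2 * m + n) : auxTl n m a < n + 1 + m := by
  rcases arc_cases n m h with h1 | ⟨e, he, rfl⟩ | ⟨x, hx, rfl⟩
  · rw [auxTl_of_lt n m h1]; omega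
  · rw [auxTl_add n m he]; omega
  · rw [auxTl_two_mul_add]; omega

theorem auxHd_lt (hh : ∀ e < m, head e < n) {a : ℕ} (h : a < 2 * m + n) :
    auxHd n m tail head a < n + 1 + m := by
  rcases arc_cases n m h with h1 | ⟨e, he, rfl⟩ | ⟨x, hx, rfl⟩
  · rw [auxHd_of_lt n m tail head h1]
    have := hh a h1
    omega
  · rw [auxHd_add n m tail head he]
    have := lastBefore_le tail e (tail e)
    omega
  · rw [auxHd_two_mul_add]
    have := lastBefore_le tail m x
    omega

/-- An arc into a vertex is the arc of an edge. -/
theorem lt_of_auxHd_lt {a : ℕ} (h : a < 2 * m + n) (ha : auxHd n m tail head a < n) : a < m := by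
  rcases arc_cases n m h with h1 | ⟨e, he, rfl⟩ | ⟨x, hx, rfl⟩
  · exact h1
  · rw [auxHd_add n m tail head he] at ha
    omega
  · rw [auxHd_two_mul_add] at ha
    omega

open scoped Classical in
theorem card_auxTl_eq_le_one {x : ℕ} (hx : x < n) :
    ((Finset.range (2 * m + n)).filter fun a => auxTl n m a = x).card ≤ 1 := by
  refine (Finset.card_le_card (t := {2 * m + x}) fun a ha => ?_).trans (by simp)
  simp only [Finset.mem_filter, Finset.mem_range] at ha
  rw [Finset.mem_singleton]
  rcases arc_cases n m ha.1 with h1 | ⟨e, he, rfl⟩ | ⟨y, hy, rfl⟩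
  · rw [auxTl_of_lt n m h1] at ha
    omega
  · rw [auxTl_add n m he] at ha
    omega
  · rw [auxTl_two_mul_add] at ha
    omega

open scoped Classical in
theorem card_auxTl_eq_le_two (x : ℕ) :
    ((Finset.range (2 * m + n)).filter fun a => auxTl n m a = x).card ≤ 2 := by
  rcases lt_or_ge x n with hx | hx
  · exact (card_auxTl_eq_le_one n m hx).trans (by norm_num)
  refine (Finset.card_le_card (t := {x - (n + 1), m + (x - (n + 1))}) fun a ha => ?_).trans
    Finset.card_le_two
  simp only [Finset.mem_filter, Finset.mem_range] at ha
  rw [Finset.mem_insert, Finset.mem_singleton]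
  rcases arc_cases n m ha.1 with h1 | ⟨e, he, rfl⟩ | ⟨y, hy, rfl⟩
  · rw [auxTl_of_lt n m h1] at ha
    omega
  · rw [auxTl_add n m he] at ha
    omega
  · rw [auxTl_two_mul_add] at ha
    omega

variable {n m tail head}

/-- The list of `x` runs through the edges with tail `x` in order of decreasing index, and its
linking arcs never fail. -/
theorem reach_sibling {D : Finset ℕ} (hD : ∀ e < m, m + e ∉ D) {j x e : ℕ} (hj : j ≤ m)
    (he : e < j) (hx : tail e = x) :
    Reach (auxTl n m) (auxHd n m tail head) (Finset.range (2 * m + n)) D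
      (n + lastBefore tail j x) (n + 1 + e) := by
  induction j with
  | zero => omega
  | succ j ih =>
    rw [lastBefore]
    split_ifs with h1
    · rcases Nat.lt_succ_iff_lt_or_eq.1 he with h2 | rfl
      · refine Relation.ReflTransGen.head ⟨m + j, by simp; omega, hD j (by omega), ?_, ?_⟩
          (ih (by omega) h2)
        · rw [auxTl_add n m (by omega)]
          omega
        · rw [auxHd_add n m tail head (by omega), h1]
      · rw [show n + (e + 1) = n + 1 + e by omega]
        exact .refl
    · refine ih (by omega) ?_
      rcases Nat.lt_succ_iff_lt_or_eq.1 he with h2 | rfl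
      · exact h2
      · exact absurd hx h1

end

/-! ### Failures of edges and vertices as failures of arcs -/

section

variable {V : Type*} (φ : V → ℕ) {n m : ℕ} {tail head : ℕ → ℕ}

/-- The spanning subgraph whose edges are those with index in `A`. -/
def subgraphOf (m : ℕ) (tail head : ℕ → ℕ) (A : Finset ℕ) : Digraph V where
  Adj u v := ∃ e < m, e ∈ A ∧ tail e = φ u ∧ head e = φ v

variable {φ}

/-- Paths of the auxiliary graph translate back. The failure of a vertex removes its out-arc only,
so a failed vertex may still be reached; but then it cannot be left, and the list node of an edge is
reached only if the tail of that edge is alive and reached. -/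
theorem reach_subgraphOf (hφ : Function.Injective φ) (hn : ∀ v, φ v < n)
    (hedge : ∀ e < m, ∃ x y : V, tail e = φ x ∧ head e = φ y) {A D : Finset ℕ}
    (hA : A ⊆ Finset.range (2 * m + n)) {C : Finset (V × V)} {F : Finset V} {s : V}
    (hC : ∀ e < m, ∀ x y, tail e = φ x → head e = φ y → (x, y) ∈ C → e ∈ D)
    (hF : ∀ x ∈ F, 2 * m + φ x ∈ D) {z : ℕ}
    (h : Reach (auxTl n m) (auxHd n m tail head) A D (φ s) z) :
    (∀ x, z = φ x → x ∈ F ∨ Relation.ReflTransGen (fun x y =>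
      (subgraphOf φ m tail head A).Adj x y ∧ (x, y) ∉ C ∧ x ∉ F ∧ y ∉ F) s x) ∧
    ∀ e x, z = n + 1 + e → tail e = φ x → x ∉ F ∧ Relation.ReflTransGen (fun x y =>
      (subgraphOf φ m tail head A).Adj x y ∧ (x, y) ∉ C ∧ x ∉ F ∧ y ∉ F) s x := by
  induction h with
  | refl =>
    refine ⟨fun x hx => Or.inr (hφ hx ▸ .refl), fun e x hx => ?_⟩
    have := hn s
    omega
  | tail _ hbc ih =>
    obtain ⟨a, ha, haD, rfl, rfl⟩ := hbc
    rcases arc_cases n m (Finset.mem_range.1 (hA ha)) with h1 | ⟨e, he, rfl⟩ | ⟨x, hx, rfl⟩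
    · obtain ⟨x, y, hx, hy⟩ := hedge a h1
      obtain ⟨h2, h3⟩ := ih.2 a x (auxTl_of_lt n m h1) hx
      rw [auxHd_of_lt n m tail head h1, hy]
      refine ⟨fun y' hy' => ?_, fun e x hx => ?_⟩
      · obtain rfl := hφ hy'
        by_cases hyF : y ∈ F
        · exact Or.inl hyF
        · exact Or.inr (h3.tail ⟨⟨a, h1, ha, hx, hy⟩,
            fun h4 => haD (hC a h1 x y hx hy h4), h2, hyF⟩)
      · have := hn y
        omega
    · rw [auxTl_add n m he] at ih
      rw [auxHd_add n m tail head he]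
      refine ⟨fun x hx => ?_, fun e' x hx hx' => ?_⟩
      · have := hn x
        omega
      · obtain ⟨h2, h3⟩ := of_lastBefore_eq_succ (e := e')
          (show lastBefore tail e (tail e) = e' + 1 by omega)
        exact ih.2 e x rfl (h3 ▸ hx')
    · rw [auxTl_two_mul_add] at ih
      rw [auxHd_two_mul_add]
      refine ⟨fun y hy => ?_, fun e' y hy hy' => ?_⟩
      · have := hn y
        omega
      · obtain ⟨h2, h3⟩ := of_lastBefore_eq_succ (e := e')
          (show lastBefore tail m x = e' + 1 by omega)
        have h4 : x = φ y := h3 ▸ hy'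
        have h5 : y ∉ F := fun h5 => haD (h4 ▸ hF y h5)
        exact ⟨h5, (ih.1 y h4).resolve_left h5⟩

theorem isFTRS_subgraphOf [Finite V] {G : Digraph V} (hφ : Function.Injective φ)
    (hn : ∀ v, φ v < n)
    (hE : Set.BijOn (fun i => (tail i, head i)) (Set.Iio m)
      ((fun e : V × V => (φ e.1, φ e.2)) '' edgeSet G)) {s : V} {l k : ℕ} {A : Finset ℕ}
    (hA : A ⊆ Finset.range (2 * m + n))
    (hP : Preserves (auxTl n m) (auxHd n m tail head) (Finset.range (2 * m + n)) A (φ s)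
      (l + k - 1)) :
    IsFTRS G s l k (subgraphOf φ m tail head A) := by
  classical
  have hedge : ∀ e < m, ∃ x y : V, G.Adj x y ∧ tail e = φ x ∧ head e = φ y := fun e he => by
    obtain ⟨⟨x, y⟩, hxy, h⟩ := hE.mapsTo he
    exact ⟨x, y, hxy, (congrArg Prod.fst h).symm, (congrArg Prod.snd h).symm⟩
  have hidx : ∀ x y, G.Adj x y → ∃ e < m, tail e = φ x ∧ head e = φ y := fun x y hxy => by
    obtain ⟨e, he, h⟩ := hE.surjOn ⟨(x, y), hxy, rfl⟩
    exact ⟨e, he, congrArg Prod.fst h, congrArg Prod.snd h⟩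
  refine isFTRS_of_mixed (fun x y hxy => ?_) fun C F w hCF _ hr hwF => ?_
  · obtain ⟨e, he, -, hx, hy⟩ := hxy
    obtain ⟨x', y', h1, h2, h3⟩ := hedge e he
    obtain rfl : x' = x := hφ (h2 ▸ hx)
    obtain rfl : y' = y := hφ (h3 ▸ hy)
    exact h1
  -- An edge fails as arc `e < m`, a vertex as its unique out-arc `2 * m + φ x`; linking arcs `m +
  -- e` never fail.
  set D₁ : Finset ℕ := (Finset.range m).filter fun e =>
    (tail e, head e) ∈ C.image fun e : V × V => (φ e.1, φ e.2)
  set D₂ : Finset ℕ := F.image fun x => 2 * m + φ x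
  have hD₁ : D₁.card ≤ C.card := by
    refine le_trans ?_ (Finset.card_image_le (s := C) (f := fun e : V × V => (φ e.1, φ e.2)))
    refine Finset.card_le_card_of_injOn (fun i => (tail i, head i))
      (fun e he => (Finset.mem_filter.1 he).2) (hE.injOn.mono fun e he => ?_)
    exact Finset.mem_range.1 (Finset.mem_filter.1 he).1
  have hD₂ : D₂.card ≤ F.card := Finset.card_image_le
  have hD : (D₁ ∪ D₂).card ≤ l + k - 1 := by
    have := Finset.card_union_le D₁ D₂
    omega
  have hC : ∀ e < m, ∀ x y, tail e = φ x → head e = φ y → (e ∈ D₁ ∪ D₂ ↔ (x, y) ∈ C) := by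
    intro e he x y hx hy
    rw [Finset.mem_union, or_iff_left]
    · simp only [D₁, Finset.mem_filter, Finset.mem_range, he, true_and, Finset.mem_image, hx, hy,
        Prod.mk.injEq]
      constructor
      · rintro ⟨⟨a, b⟩, h1, h2, h3⟩
        rwa [← hφ h2, ← hφ h3]
      · exact fun h => ⟨_, h, rfl, rfl⟩
    · simp only [D₂, Finset.mem_image, not_exists, not_and]
      intros
      omega
  have hF : ∀ x, 2 * m + φ x ∈ D₁ ∪ D₂ ↔ x ∈ F := by
    intro x
    rw [Finset.mem_union, or_iff_right]
    · simp only [D₂, Finset.mem_image]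
      constructor
      · rintro ⟨y, h1, h2⟩
        rwa [← hφ (show φ y = φ x by omega)]
      · exact fun h => ⟨_, h, rfl⟩
    · simp only [D₁, Finset.mem_filter, Finset.mem_range, not_and]
      intros
      omega
  have hsib : ∀ e < m, m + e ∉ D₁ ∪ D₂ := by
    intro e he h
    rcases Finset.mem_union.1 h with h | h
    · simp [D₁] at h
    · simp only [D₂, Finset.mem_image] at h
      obtain ⟨x, -, h⟩ := h
      omega
  have h1 : Reach (auxTl n m) (auxHd n m tail head) (Finset.range (2 * m + n)) (D₁ ∪ D₂)
      (φ s) (φ w) := by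
    clear hwF
    induction hr with
    | refl => exact .refl
    | @tail x y _ hxy ih =>
      obtain ⟨h1, h2, h3, -⟩ := hxy
      obtain ⟨e, he, hx, hy⟩ := hidx x y h1
      refine ih.trans (Relation.ReflTransGen.head ⟨2 * m + φ x, ?_, ?_, auxTl_two_mul_add n m _,
        auxHd_two_mul_add n m tail head _⟩ ((reach_sibling hsib le_rfl he hx).tail
          ⟨e, ?_, ?_, auxTl_of_lt n m he, ?_⟩))
      · simpa using hn x
      · rwa [hF]
      · simp
        omega
      · rwa [hC e he x y hx hy]
      · rw [auxHd_of_lt n m tail head he, hy]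
  refine ((reach_subgraphOf hφ hn (fun e he => ?_) hA (fun e he x y hx hy h => ?_)
    (fun x hx => (hF x).2 hx) (hP _ hD _ h1)).1 w rfl).resolve_left hwF
  · obtain ⟨x, y, -, h2⟩ := hedge e he
    exact ⟨x, y, h2⟩
  · exact (hC e he x y hx hy).2 h

/-- Each in-neighbour has an edge with some index in `A`, and the tail of that edge recovers the
neighbour. -/
theorem inDegree_subgraphOf_le (hφ : Function.Injective φ) {A : Finset ℕ} {v : V} {d : ℕ}
    (hd : ((Finset.range m).filter fun e => e ∈ A ∧ head e = φ v).card ≤ d) :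
    inDegree (subgraphOf φ m tail head A) v ≤ d := by
  classical
  refine le_trans ?_ hd
  rw [inDegree, ← Set.ncard_coe_finset]
  have h : ∀ u ∈ {u | (subgraphOf φ m tail head A).Adj u v},
      ∃ e < m, e ∈ A ∧ tail e = φ u ∧ head e = φ v := fun u hu => hu
  choose! f hf using h
  refine Set.ncard_le_ncard_of_injOn f (fun u hu => ?_) (fun u hu u' hu' h => ?_)
    (Finset.finite_toSet _)
  · simpa using ⟨(hf u hu).1, (hf u hu).2.1, (hf u hu).2.2.2⟩
  · refine hφ ?_
    rw [← (hf u hu).2.2.1, ← (hf u' hu').2.2.1, h]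

end

end FTRS

/-! ## A program logic for the word RAM -/

namespace RAM

/-- The registers that an instruction may write. -/
def Instr.regs : Instr → List ℕ
  | .const x _ => [x]
  | .move x _ => [x]
  | .add x _ _ => [x]
  | .sub x _ _ => [x]
  | .load x _ _ => [x]
  | .store _ _ _ => []

/-- The arrays that an instruction may write. -/
def Instr.arrs : Instr → List ℕ
  | .store a _ _ => [a]
  | _ => []

/-- The registers that a program may write. -/
def Prog.regs : Prog → List ℕ
  | .skip => []
  | .instr I => I.regs
  | .seq p q => p.regs ++ q.regs
  | .ite _ p q => p.regs ++ q.regs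
  | .loop _ p => p.regs

/-- The arrays that a program may write. -/
def Prog.arrs : Prog → List ℕ
  | .skip => []
  | .instr I => I.arrs
  | .seq p q => p.arrs ++ q.arrs
  | .ite _ p q => p.arrs ++ q.arrs
  | .loop _ p => p.arrs

/-- `τ` differs from `σ` only in what `p` may write. -/
structure Frame (p : Prog) (σ τ : State) : Prop where
  reg : ∀ r, r ∉ p.regs → τ.reg r = σ.reg r
  arr : ∀ a, a ∉ p.arrs → τ.arr a = σ.arr a

theorem Frame.refl (p : Prog) (σ : State) : Frame p σ σ := ⟨fun _ _ => rfl, fun _ _ => rfl⟩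

theorem Frame.trans {p : Prog} {σ τ υ : State} (h : Frame p σ τ) (h' : Frame p τ υ) :
    Frame p σ υ :=
  ⟨fun r hr => (h'.reg r hr).trans (h.reg r hr), fun a ha => (h'.arr a ha).trans (h.arr a ha)⟩

theorem Frame.mono {p q : Prog} {σ τ : State} (h : Frame p σ τ) (hr : p.regs ⊆ q.regs)
    (ha : p.arrs ⊆ q.arrs) : Frame q σ τ :=
  ⟨fun r h1 => h.reg r fun h2 => h1 (hr h2), fun a h1 => h.arr a fun h2 => h1 (ha h2)⟩

/-- Specifications of programs then mention only what changes; that some register or array is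
untouched is settled by `decide`. -/
theorem Exec.frame {W : ℕ} {p : Prog} {σ τ : State} {t : ℕ} (h : Exec W p σ t τ) :
    Frame p σ τ := by
  induction h with
  | skip => exact .refl _ _
  | instr I σ =>
    cases I <;> constructor <;> intro r hr <;>
      simp_all [Prog.regs, Prog.arrs, Instr.regs, Instr.arrs, Instr.apply, State.setReg,
        State.setArr]
  | seq _ _ ih₁ ih₂ =>
    exact (ih₁.mono (List.subset_append_left _ _) (List.subset_append_left _ _)).trans
      (ih₂.mono (List.subset_append_right _ _) (List.subset_append_right _ _))
  | ite_true _ _ ih => exact ih.mono (List.subset_append_left _ _) (List.subset_append_left _ _)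
  | ite_false _ _ ih => exact ih.mono (List.subset_append_right _ _) (List.subset_append_right _ _)
  | loop_true _ _ _ ih₁ ih₂ => exact Frame.trans (p := .loop _ _) ⟨ih₁.reg, ih₁.arr⟩ ih₂
  | loop_false => exact .refl _ _

/-- `p` started in `σ` halts within `T` steps in a state that satisfies `Q`. -/
def Runs (W : ℕ) (p : Prog) (σ : State) (T : ℕ) (Q : State → Prop) : Prop :=
  ∃ t τ, Exec W p σ t τ ∧ t ≤ T ∧ Q τ

variable {W T T₁ T₂ : ℕ} {p q : Prog} {σ : State} {Q Q₁ Q₂ : State → Prop}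

theorem Runs.mono (h : Runs W p σ T₁ Q₁) (hT : T₁ ≤ T₂)
    (hQ : ∀ τ, Frame p σ τ → Q₁ τ → Q₂ τ) : Runs W p σ T₂ Q₂ := by
  obtain ⟨t, τ, h1, h2, h3⟩ := h
  exact ⟨t, τ, h1, h2.trans hT, hQ τ h1.frame h3⟩

theorem Runs.seq (h₁ : Runs W p σ T₁ Q₁)
    (h₂ : ∀ τ, Frame p σ τ → Q₁ τ → Runs W q τ T₂ Q) : Runs W (.seq p q) σ (T₁ + T₂) Q := by
  obtain ⟨t₁, τ, h1, h2, h3⟩ := h₁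
  obtain ⟨t₂, υ, h4, h5, h6⟩ := h₂ τ h1.frame h3
  exact ⟨t₁ + t₂, υ, .seq h1 h4, by omega, h6⟩

theorem Runs.ite {b : Test} (h₁ : b.Holds σ → Runs W p σ T Q)
    (h₂ : ¬ b.Holds σ → Runs W q σ T Q) : Runs W (.ite b p q) σ (T + 1) Q := by
  by_cases hb : b.Holds σ
  · obtain ⟨t, τ, h1, h2, h3⟩ := h₁ hb
    exact ⟨t + 1, τ, .ite_true hb h1, by omega, h3⟩
  · obtain ⟨t, τ, h1, h2, h3⟩ := h₂ hb
    exact ⟨t + 1, τ, .ite_false hb h1, by omega, h3⟩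

/-- While loops, with a bound `f` for the number of iterations. -/
theorem Runs.while {b : Test} {f₀ : ℕ} {I : ℕ → State → Prop} (h₀ : I f₀ σ)
    (step : ∀ f τ, Frame p σ τ → I f τ → b.Holds τ →
      Runs W p τ T fun υ => ∃ f' < f, I f' υ) :
    Runs W (.loop b p) σ ((T + 1) * f₀ + 1) fun τ => ¬ b.Holds τ ∧ ∃ f, I f τ := by
  suffices ∀ f τ, f ≤ f₀ → Frame p σ τ → I f τ →
      Runs W (.loop b p) τ ((T + 1) * f + 1) fun τ => ¬ b.Holds τ ∧ ∃ f, I f τ from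
    this f₀ σ le_rfl (.refl _ _) h₀
  intro f
  induction f using Nat.strong_induction_on with
  | _ f ih =>
    intro τ hf hτ hI
    by_cases hb : b.Holds τ
    · obtain ⟨t₁, υ, h1, h2, f', h3, h4⟩ := step f τ hτ hI hb
      obtain ⟨t₂, ρ, h5, h6, h7⟩ := ih f' h3 υ (by omega) (hτ.trans h1.frame) h4
      refine ⟨t₁ + t₂ + 1, ρ, .loop_true hb h1 h5, ?_, h7⟩
      -- The drop from `f` to `f'` pays for the body and the test of this iteration.
      have : (T + 1) * (f' + 1) ≤ (T + 1) * f := Nat.mul_le_mul_left _ h3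
      rw [mul_add] at this
      omega
    · exact ⟨1, τ, .loop_false hb, by omega, hb, f, hI⟩

/-- Loops that count the register `c` from `0` up to the value `K` of the register `b`. -/
theorem Runs.for {c b K : ℕ} {I : ℕ → State → Prop} (hb : b ∉ p.regs) (hc : σ.reg c = 0)
    (hK : σ.reg b = K) (h₀ : I 0 σ)
    (step : ∀ j τ, j < K → Frame p σ τ → τ.reg c = j → I j τ →
      Runs W p τ T fun υ => υ.reg c = j + 1 ∧ I (j + 1) υ) :
    Runs W (.loop (.lt c b) p) σ ((T + 1) * K + 1) (I K) := by
  refine (Runs.while (b := .lt c b) (f₀ := K) (T := T)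
    (I := fun f τ => f ≤ K ∧ τ.reg c = K - f ∧ τ.reg b = K ∧ I (K - f) τ)
    ⟨le_rfl, by omega, hK, by simpa using h₀⟩ ?_).mono le_rfl ?_
  · rintro f τ hF ⟨hf, h1, h2, h3⟩ hlt
    have hlt' : τ.reg c < τ.reg b := hlt
    refine (step (K - f) τ (by omega) hF h1 h3).mono le_rfl fun υ hF' h4 =>
      ⟨f - 1, by omega, by omega, ?_, ?_, ?_⟩
    · rw [h4.1]
      omega
    · rw [hF'.reg b hb, h2]
    · rw [show K - (f - 1) = K - f + 1 by omega]
      exact h4.2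
  · rintro τ - ⟨hlt, f, hf, h1, h2, h3⟩
    have hlt' : ¬ τ.reg c < τ.reg b := hlt
    have : f = 0 := by omega
    subst this
    simpa using h3

/-- Weakest preconditions of loop-free programs. -/
def Prog.wp (W : ℕ) : Prog → (State → Prop) → State → Prop
  | .skip, Q, σ => Q σ
  | .instr I, Q, σ => I.value σ < W ∧ Q (I.apply σ)
  | .seq p q, Q, σ => p.wp W (q.wp W Q) σ
  | .ite b p q, Q, σ => (b.Holds σ → p.wp W Q σ) ∧ (¬ b.Holds σ → q.wp W Q σ)
  | .loop _ _, _, _ => False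

/-- The maximal number of steps of a loop-free program. -/
def Prog.cost : Prog → ℕ
  | .skip => 1
  | .instr _ => 1
  | .seq p q => p.cost + q.cost
  | .ite _ p q => max p.cost q.cost + 1
  | .loop _ _ => 0

theorem Runs.of_wp (h : p.wp W Q σ) (hT : p.cost ≤ T) : Runs W p σ T Q := by
  suffices Runs W p σ p.cost Q from this.mono hT fun _ _ => id
  clear hT
  induction p generalizing σ Q with
  | skip => exact ⟨1, σ, .skip σ, le_rfl, h⟩
  | instr I => exact ⟨1, _, .instr I σ h.1, le_rfl, h.2⟩
  | seq p q ih₁ ih₂ => exact (ih₁ h).seq fun τ _ hτ => ih₂ hτ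
  | ite b p q ih₁ ih₂ =>
    exact Runs.ite (fun hb => (ih₁ (h.1 hb)).mono (le_max_left _ _) fun _ _ => id)
      fun hb => (ih₂ (h.2 hb)).mono (le_max_right _ _) fun _ _ => id
  -- The precondition of a loop is `False`, so its nominal cost `0` is never relied upon.
  | loop => exact h.elim

end RAM

/-! ## Searching a residual graph backwards -/

namespace RAM

infixr:60 " ;; " => Prog.seq

attribute [simp] Prog.wp Instr.value Instr.apply State.setReg State.setArr Test.Holds

/-- Registers `2, 6, 7, 8, 10, 12` hold the source, a number of rounds, `0`, `1` and the numbers of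
nodes and arcs of a graph whose arcs are listed in arrays `4` and `5`. -/
structure Env (N M s p : ℕ) (tl hd : ℕ → ℕ) (σ : State) : Prop where
  r2 : σ.reg 2 = s
  r6 : σ.reg 6 = p
  r7 : σ.reg 7 = 0
  r8 : σ.reg 8 = 1
  r10 : σ.reg 10 = N
  r12 : σ.reg 12 = M
  tl : ∀ a < M, σ.arr 4 a = tl a
  hd : ∀ a < M, σ.arr 5 a = hd a

theorem Env.of_frame {N M s p : ℕ} {tl hd : ℕ → ℕ} {σ τ : State} {P : Prog}
    (h : Env N M s p tl hd σ) (hF : Frame P σ τ)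
    (hr : ∀ r ∈ [2, 6, 7, 8, 10, 12], r ∉ P.regs) (ha : ∀ a ∈ [4, 5], a ∉ P.arrs) :
    Env N M s p tl hd τ where
  r2 := (hF.reg 2 (hr 2 (by decide))).trans h.r2
  r6 := (hF.reg 6 (hr 6 (by decide))).trans h.r6
  r7 := (hF.reg 7 (hr 7 (by decide))).trans h.r7
  r8 := (hF.reg 8 (hr 8 (by decide))).trans h.r8
  r10 := (hF.reg 10 (hr 10 (by decide))).trans h.r10
  r12 := (hF.reg 12 (hr 12 (by decide))).trans h.r12
  tl a h1 := (congrFun (hF.arr 4 (ha 4 (by decide))) a).trans (h.tl a h1)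
  hd a h1 := (congrFun (hF.arr 5 (ha 5 (by decide))) a).trans (h.hd a h1)

/-- Set the first cells of the array `a` to `0`, as many as register `b` says. -/
def clear (a b : ℕ) : Prog :=
  .instr (.const 18 0) ;; .loop (.lt 18 b) (.instr (.store a 18 7) ;; .instr (.add 18 18 8))

theorem runs_clear {W a b K : ℕ} {σ : State} (hb : b ≠ 18) (h7 : σ.reg 7 = 0) (h8 : σ.reg 8 = 1)
    (hK : σ.reg b = K) (hW : K < W) :
    Runs W (clear a b) σ (3 * K + 2) fun τ => ∀ x < K, τ.arr a x = 0 := by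
  refine (Runs.seq (T₁ := 1) (T₂ := (2 + 1) * K + 1)
    (.of_wp (Q := fun τ => τ.reg 18 = 0) (by simp; omega) le_rfl)
    fun τ hF hτ => Runs.for (I := fun j τ => ∀ x < j, τ.arr a x = 0)
      (by simpa [Prog.regs, Instr.regs] using hb) hτ ?_ (by simp)
      fun j υ hj hF' hυ hI => .of_wp ?_ le_rfl).mono (by omega) fun _ _ => id
  · rw [hF.reg b (by simpa [Prog.regs, Instr.regs] using hb), hK]
  · have e7 : υ.reg 7 = 0 := by
      rw [hF'.reg 7 (by simp [Prog.regs, Instr.regs]), hF.reg 7 (by decide), h7]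
    have e8 : υ.reg 8 = 1 := by
      rw [hF'.reg 8 (by simp [Prog.regs, Instr.regs]), hF.reg 8 (by decide), h8]
    simp only [Prog.wp, Instr.value, Instr.apply, State.setReg, State.setArr, e7, e8, hυ,
      Function.update_self]
    refine ⟨by omega, by omega, trivial, fun x hx => ?_⟩
    by_cases h : x = j
    · simp [h]
    · rw [Function.update_of_ne h]
      exact hI x (by omega)

section

variable (tl hd ρ : ℕ → ℕ)

/-- The start of an arc of the residual graph; `ρ` marks the reversed arcs. -/
def resSrc (a : ℕ) : ℕ := if ρ a = 0 then tl a else hd a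

/-- The end of an arc of the residual graph; `ρ` marks the reversed arcs. -/
def resTgt (a : ℕ) : ℕ := if ρ a = 0 then hd a else tl a

end

/-- Following the pointer `f` leads to the last element of `{a < b | δ a = 0 ∧ t a = y}`. -/
structure Ptr (δ t : ℕ → ℕ) (b y f : ℕ) : Prop where
  le : f ≤ b
  mem : ∀ a, f = a + 1 → δ a = 0 ∧ t a = y
  last : ∀ c, f ≤ c → c < b → δ c = 0 → t c ≠ y

/-- Link the arcs of the residual graph with the same end into lists. -/
def link : Prog :=
  .instr (.const 18 0) ;; .loop (.lt 18 12) (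
    .instr (.load 24 6 18) ;;
    .ite (.eq 24 7) (
      .instr (.load 25 7 18) ;;
      .ite (.eq 25 7) (.instr (.load 23 5 18)) (.instr (.load 23 4 18)) ;;
      .instr (.load 26 9 23) ;; .instr (.store 10 18 26) ;;
      .instr (.add 27 18 8) ;; .instr (.store 9 23 27)) .skip ;;
    .instr (.add 18 18 8))

section

variable {W N M s p v : ℕ} {tl hd δ ρ ι : ℕ → ℕ} {σ : State}

/-- Arcs are scanned in increasing order. Array `9` holds, for each node, one more than the last
live arc so far that ends there, with `0` for none; array `10` saves the previous value when it is
overwritten. Pointers therefore strictly decrease along every list. -/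
theorem runs_link (hE : Env N M s p tl hd σ) (hW : N + M + p + 2 < W)
    (htl : ∀ a < M, tl a < N) (hhd : ∀ a < M, hd a < N)
    (hδ : ∀ a < M, σ.arr 6 a ≤ 1) (hρ : ∀ a < M, σ.arr 7 a ≤ 1)
    (hfirst : ∀ y < N, σ.arr 9 y = 0) :
    Runs W link σ (15 * M + 2) fun τ =>
      (∀ y < N, Ptr (σ.arr 6) (resTgt tl hd (σ.arr 7)) M y (τ.arr 9 y)) ∧
      ∀ a < M, σ.arr 6 a = 0 → Ptr (σ.arr 6) (resTgt tl hd (σ.arr 7)) a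
        (resTgt tl hd (σ.arr 7) a) (τ.arr 10 a) := by
  refine (Runs.seq (T₁ := 1) (T₂ := (11 + 1) * M + 1)
    (.of_wp (Q := fun τ => τ.reg 18 = 0) (by simp; omega) le_rfl)
    fun τ hF hτ => Runs.for (I := fun j τ =>
      (∀ y < N, Ptr (σ.arr 6) (resTgt tl hd (σ.arr 7)) j y (τ.arr 9 y)) ∧
      ∀ a < j, σ.arr 6 a = 0 → Ptr (σ.arr 6) (resTgt tl hd (σ.arr 7)) a
        (resTgt tl hd (σ.arr 7) a) (τ.arr 10 a))
      (by decide) hτ ?_ ?_ fun j υ hj hF' hυ hI => .of_wp ?_ (by decide)).mono (by omega)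
      fun _ _ => id
  · rw [hF.reg 12 (by decide), hE.r12]
  · refine ⟨fun y hy => ?_, by simp⟩
    rw [hF.arr 9 (by decide), hfirst y hy]
    exact ⟨le_rfl, by simp, by simp⟩
  · have hE' : Env N M s p tl hd υ :=
      (hE.of_frame hF (by decide) (by decide)).of_frame hF' (by decide) (by decide)
    have e6 : υ.arr 6 = σ.arr 6 := by rw [hF'.arr 6 (by decide), hF.arr 6 (by decide)]
    have e7 : υ.arr 7 = σ.arr 7 := by rw [hF'.arr 7 (by decide), hF.arr 7 (by decide)]
    have d1 := hδ j hj
    have d2 := hρ j hj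
    have d3 := htl j hj
    have d4 := hhd j hj
    -- This serves both orientations of arc `j`: the branches of the program load its residual end
    -- from different arrays.
    have hcase : ∀ t, t = resTgt tl hd (σ.arr 7) j → t < N → σ.arr 6 j = 0 →
        υ.arr 9 t < W ∧
        (∀ y < N, Ptr (σ.arr 6) (resTgt tl hd (σ.arr 7)) (j + 1) y
          (Function.update (υ.arr 9) t (j + 1) y)) ∧
        ∀ a < j + 1, σ.arr 6 a = 0 → Ptr (σ.arr 6) (resTgt tl hd (σ.arr 7)) a
        (resTgt tl hd (σ.arr 7) a) (Function.update (υ.arr 10) j (υ.arr 9 t) a) := by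
      rintro t rfl ht h0
      refine ⟨?_, fun y hy => ?_, fun a ha h1 => ?_⟩
      · have := (hI.1 _ ht).le
        omega
      · by_cases h : y = resTgt tl hd (σ.arr 7) j
        · subst h
          rw [Function.update_self]
          exact ⟨le_rfl, fun a ha => by obtain rfl : j = a := by omega
                                        exact ⟨h0, rfl⟩, fun c h1 h2 => by omega⟩
        · rw [Function.update_of_ne h]
          obtain ⟨h1, h2, h3⟩ := hI.1 y hy
          refine ⟨by omega, h2, fun c h4 h5 h6 => ?_⟩
          rcases Nat.lt_succ_iff_lt_or_eq.1 h5 with h7 | rfl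
          · exact h3 c h4 h7 h6
          · exact Ne.symm h
      · by_cases h : a = j
        · subst h
          rw [Function.update_self]
          exact hI.1 _ ht
        · rw [Function.update_of_ne h]
          exact hI.2 a (by omega) h1
    have hskip : σ.arr 6 j ≠ 0 →
        (∀ y < N, Ptr (σ.arr 6) (resTgt tl hd (σ.arr 7)) (j + 1) y (υ.arr 9 y)) ∧
        ∀ a < j + 1, σ.arr 6 a = 0 → Ptr (σ.arr 6) (resTgt tl hd (σ.arr 7)) a
        (resTgt tl hd (σ.arr 7) a) (υ.arr 10 a) := by
      refine fun h0 => ⟨fun y hy => ?_, fun a ha h1 => ?_⟩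
      · obtain ⟨h1, h2, h3⟩ := hI.1 y hy
        refine ⟨by omega, h2, fun c h4 h5 h6 => ?_⟩
        rcases Nat.lt_succ_iff_lt_or_eq.1 h5 with h7 | rfl
        · exact h3 c h4 h7 h6
        · exact absurd h6 h0
      · by_cases h : a = j
        · exact absurd (h ▸ h1) h0
        · exact hI.2 a (by omega) h1
    simp [hυ, hE'.r7, hE'.r8, hE'.tl j hj, hE'.hd j hj, e6, e7, -Order.lt_add_one_iff]
    refine ⟨by omega, fun h0 => ⟨by omega, fun h1 => ⟨by omega, ?_⟩, fun h1 => ⟨by omega, ?_⟩⟩,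
      fun h0 => ⟨by omega, hskip h0⟩⟩
    · obtain ⟨h2, h3⟩ := hcase (hd j) (by simp [resTgt, h1]) d4 h0
      exact ⟨h2, by omega, h3⟩
    · obtain ⟨h2, h3⟩ := hcase (tl j) (by simp [resTgt, h1]) d3 h0
      exact ⟨h2, by omega, h3⟩

end

end RAM

/-! ### The invariant of the backward search -/

namespace RAM

section

variable (N M v : ℕ) (tl hd δ ρ ι : ℕ → ℕ)

/-- Every visited node except `v` has an arc `par x` to a visited node of smaller rank. -/
def IsTree (vis par d : ℕ → ℕ) (b : ℕ) : Prop :=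
  ∀ x < N, vis x ≠ 0 → d x < b ∧ (x = v ∨ (par x < M ∧ δ (par x) = 0 ∧
    resSrc tl hd ρ (par x) = x ∧ resTgt tl hd ρ (par x) < N ∧
    vis (resTgt tl hd ρ (par x)) ≠ 0 ∧ d (resTgt tl hd ρ (par x)) < d x))

/-- The number of arcs that a search has not yet looked at. -/
def remaining (first : ℕ → ℕ) : ℕ :=
  ((Finset.range M).filter fun c => δ c = 0 ∧ c < first (resTgt tl hd ρ c)).card

/-- The invariant of a backward search from `v`; a visited node with mark `ι x = 1` is recorded in
`hit`. -/
structure Search (first vis queue par : ℕ → ℕ) (h cnt hit : ℕ) : Prop where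
  vis_v : vis v ≠ 0
  vis_lt : ∀ x < N, vis x ≤ 1
  h_le : h ≤ cnt
  cnt_eq : cnt = ((Finset.range N).filter fun x => vis x ≠ 0).card
  queue_mem : ∀ i < cnt, queue i < N ∧ vis (queue i) ≠ 0
  pending : ∀ x < N, vis x ≠ 0 → first x = 0 ∨ ∃ i, h ≤ i ∧ i < cnt ∧ queue i = x
  first_mem : ∀ y < N, ∀ a, first y = a + 1 → a < M ∧ δ a = 0 ∧ resTgt tl hd ρ a = y
  done : ∀ c < M, δ c = 0 → first (resTgt tl hd ρ c) ≤ c → vis (resSrc tl hd ρ c) ≠ 0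
  tree : ∃ d, IsTree N M v tl hd δ ρ vis par d cnt
  hit_zero : hit = 0 → ∀ x < N, vis x ≠ 0 → ι x ≠ 1
  hit_succ : ∀ x, hit = x + 1 → x < N ∧ vis x ≠ 0 ∧ ι x = 1

/-- The result of a backward search from `v`. -/
structure Searched (vis par : ℕ → ℕ) (hit : ℕ) : Prop where
  vis_v : vis v ≠ 0
  vis_lt : ∀ x < N, vis x ≤ 1
  closed : ∀ c < M, δ c = 0 → vis (resTgt tl hd ρ c) ≠ 0 → vis (resSrc tl hd ρ c) ≠ 0
  tree : ∃ d, IsTree N M v tl hd δ ρ vis par d N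
  hit_zero : hit = 0 → ∀ x < N, vis x ≠ 0 → ι x ≠ 1
  hit_succ : ∀ x, hit = x + 1 → x < N ∧ vis x ≠ 0 ∧ ι x = 1

end

section

variable {N M v : ℕ} {tl hd δ ρ ι : ℕ → ℕ} {first vis queue par : ℕ → ℕ} {h cnt hit : ℕ}

theorem resSrc_lt (htl : ∀ a < M, tl a < N) (hhd : ∀ a < M, hd a < N) {a : ℕ} (ha : a < M) :
    resSrc tl hd ρ a < N := by
  rw [resSrc]
  split_ifs
  · exact htl a ha
  · exact hhd a ha

theorem resTgt_lt (htl : ∀ a < M, tl a < N) (hhd : ∀ a < M, hd a < N) {a : ℕ} (ha : a < M) :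
    resTgt tl hd ρ a < N := by
  rw [resTgt]
  split_ifs
  · exact hhd a ha
  · exact htl a ha

theorem remaining_le (first : ℕ → ℕ) : remaining M tl hd δ ρ first ≤ M :=
  (Finset.card_filter_le _ _).trans (by simp)

/-- Advancing the list pointer of a node removes at least the arc `a` from those still to be read.
-/
theorem remaining_lt {a f : ℕ} (ha : a < M) (h0 : δ a = 0)
    (hf : first (resTgt tl hd ρ a) = a + 1) (hfa : f ≤ a) :
    remaining M tl hd δ ρ (Function.update first (resTgt tl hd ρ a) f) <
      remaining M tl hd δ ρ first := by
  refine Finset.card_lt_card (Finset.ssubset_iff_of_subset (fun c hc => ?_) |>.2 ⟨a, ?_, ?_⟩)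
  · simp only [Finset.mem_filter, Finset.mem_range] at hc ⊢
    refine ⟨hc.1, hc.2.1, ?_⟩
    by_cases hca : resTgt tl hd ρ c = resTgt tl hd ρ a
    · have := hc.2.2
      rw [hca, Function.update_self] at this
      rw [hca]
      omega
    · have := hc.2.2
      rwa [Function.update_of_ne hca] at this
  · simp [ha, h0, hf]
  · simp [hfa]

namespace Search

theorem cnt_le (hS : Search N M v tl hd δ ρ ι first vis queue par h cnt hit) : cnt ≤ N := by
  rw [hS.cnt_eq]
  exact (Finset.card_filter_le _ _).trans (by simp)

theorem init (hvN : v < N) (hι : ι v ≠ 1)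
    (hfirst : ∀ y < N, Ptr δ (resTgt tl hd ρ) M y (first y)) (hhd : ∀ a < M, resTgt tl hd ρ a < N)
    (hvis : ∀ y < N, vis y = 0) : Search N M v tl hd δ ρ ι first (Function.update vis v 1)
      (Function.update queue 0 v) par 0 1 0 where
  vis_v := by simp
  vis_lt x hx := by
    by_cases hxv : x = v
    · simp [hxv]
    · rw [Function.update_of_ne hxv, hvis x hx]
      omega
  h_le := by omega
  cnt_eq := by
    symm
    rw [Finset.card_eq_one]
    refine ⟨v, Finset.ext fun x => ?_⟩
    simp only [Finset.mem_filter, Finset.mem_range, Finset.mem_singleton]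
    by_cases hx : x = v
    · simp [hx, hvN]
    · rw [Function.update_of_ne hx]
      simpa [hx] using hvis x
  queue_mem i hi := by
    obtain rfl : i = 0 := by omega
    simp [hvN]
  pending x hx hv := by
    by_cases hxv : x = v
    · exact Or.inr ⟨0, by simp [hxv]⟩
    · rw [Function.update_of_ne hxv, hvis x hx] at hv
      exact absurd rfl hv
  first_mem y hy a ha := by
    obtain ⟨h1, h2⟩ := (hfirst y hy).mem a ha
    have := (hfirst y hy).le
    exact ⟨by omega, h1, h2⟩
  done c hc h0 h1 := absurd rfl ((hfirst _ (hhd c hc)).last c h1 hc h0)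
  tree := ⟨fun _ => 0, fun x hx hv => by
    by_cases hxv : x = v
    · exact ⟨Nat.one_pos, Or.inl hxv⟩
    · rw [Function.update_of_ne hxv, hvis x hx] at hv
      exact absurd rfl hv⟩
  hit_zero _ x hx hv := by
    by_cases hxv : x = v
    · rwa [hxv]
    · rw [Function.update_of_ne hxv, hvis x hx] at hv
      exact absurd rfl hv
  hit_succ x hx := by omega

theorem next (hS : Search N M v tl hd δ ρ ι first vis queue par h cnt hit) (hlt : h < cnt)
    (h0 : first (queue h) = 0) : Search N M v tl hd δ ρ ι first vis queue par (h + 1) cnt hit where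
  __ := hS
  h_le := hlt
  pending x hx hv := by
    rcases hS.pending x hx hv with h1 | ⟨i, h1, h2, h3⟩
    · exact Or.inl h1
    · by_cases hi : i = h
      · exact Or.inl (by rw [← h3, hi, h0])
      · exact Or.inr ⟨i, by omega, h2, h3⟩

theorem first_mem_update (hS : Search N M v tl hd δ ρ ι first vis queue par h cnt hit) {a f : ℕ}
    (ha : a < M) (hf : Ptr δ (resTgt tl hd ρ) a (resTgt tl hd ρ a) f) (y : ℕ) (hy : y < N) (b : ℕ)
    (hb : Function.update first (resTgt tl hd ρ a) f y = b + 1) :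
    b < M ∧ δ b = 0 ∧ resTgt tl hd ρ b = y := by
  by_cases hya : y = resTgt tl hd ρ a
  · rw [hya, Function.update_self] at hb
    obtain ⟨h1, h2⟩ := hf.mem b hb
    have := hf.le
    exact ⟨by omega, h1, hya ▸ h2⟩
  · rw [Function.update_of_ne hya] at hb
    exact hS.first_mem y hy b hb

/-- By `Ptr.last` no live arc with the same end lies between `f` and `a`, so moving the pointer
uncovers only `a`. -/
theorem done_update (hS : Search N M v tl hd δ ρ ι first vis queue par h cnt hit) {a f : ℕ}
    (hfa : first (resTgt tl hd ρ a) = a + 1)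
    (hf : Ptr δ (resTgt tl hd ρ) a (resTgt tl hd ρ a) f) {c : ℕ} (hc : c < M) (h0 : δ c = 0)
    (hfc : Function.update first (resTgt tl hd ρ a) f (resTgt tl hd ρ c) ≤ c) :
    c = a ∨ vis (resSrc tl hd ρ c) ≠ 0 := by
  by_cases hca : resTgt tl hd ρ c = resTgt tl hd ρ a
  · rw [hca, Function.update_self] at hfc
    rcases lt_trichotomy c a with h1 | h1 | h1
    · exact absurd hca (hf.last c hfc h1 h0)
    · exact Or.inl h1
    · exact Or.inr (hS.done c hc h0 (by rw [hca]; omega))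
  · rw [Function.update_of_ne hca] at hfc
    exact Or.inr (hS.done c hc h0 hfc)

theorem pop (hS : Search N M v tl hd δ ρ ι first vis queue par h cnt hit) (hlt : h < cnt) {a f : ℕ}
    (ha : a < M) (hq : queue h = resTgt tl hd ρ a) (hfa : first (resTgt tl hd ρ a) = a + 1)
    (hf : Ptr δ (resTgt tl hd ρ) a (resTgt tl hd ρ a) f) (hvis : vis (resSrc tl hd ρ a) ≠ 0) :
    Search N M v tl hd δ ρ ι (Function.update first (resTgt tl hd ρ a) f) vis queue par
      h cnt hit where
  __ := hS
  pending x hx hv := by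
    by_cases hxa : x = resTgt tl hd ρ a
    · exact Or.inr ⟨h, le_rfl, hlt, hq.trans hxa.symm⟩
    · rw [Function.update_of_ne hxa]
      exact hS.pending x hx hv
  first_mem := hS.first_mem_update ha hf
  done c hc h0 hfc := by
    rcases hS.done_update hfa hf hc h0 hfc with h1 | h1
    · rwa [h1]
    · exact h1

theorem visit (hS : Search N M v tl hd δ ρ ι first vis queue par h cnt hit) (hlt : h < cnt)
    {a f hit' : ℕ} (ha : a < M) (haN : resSrc tl hd ρ a < N) (h0 : δ a = 0)
    (hq : queue h = resTgt tl hd ρ a) (hfa : first (resTgt tl hd ρ a) = a + 1)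
    (hf : Ptr δ (resTgt tl hd ρ) a (resTgt tl hd ρ a) f) (hvis : vis (resSrc tl hd ρ a) = 0)
    (hhit : hit' = if ι (resSrc tl hd ρ a) = 1 then resSrc tl hd ρ a + 1 else hit) :
    Search N M v tl hd δ ρ ι (Function.update first (resTgt tl hd ρ a) f)
      (Function.update vis (resSrc tl hd ρ a) 1) (Function.update queue cnt (resSrc tl hd ρ a))
      (Function.update par (resSrc tl hd ρ a) a) h (cnt + 1) hit' := by
  set x := resSrc tl hd ρ a with hx
  have hmono : ∀ z, vis z ≠ 0 → Function.update vis x 1 z ≠ 0 := fun z hz => by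
    by_cases hzx : z = x
    · simp [hzx]
    · rwa [Function.update_of_ne hzx]
  have hold : ∀ z, z ≠ x → Function.update vis x 1 z ≠ 0 → vis z ≠ 0 := fun z hzx hz => by
    rwa [Function.update_of_ne hzx] at hz
  constructor
  · exact hmono v hS.vis_v
  · intro z hz
    by_cases hzx : z = x
    · simp [hzx]
    · rw [Function.update_of_ne hzx]
      exact hS.vis_lt z hz
  · exact hlt.le.trans (Nat.le_succ _)
  · have : (Finset.range N).filter (fun z => Function.update vis x 1 z ≠ 0) =
        insert x ((Finset.range N).filter fun z => vis z ≠ 0) := by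
      ext z
      by_cases hzx : z = x
      · simp [hzx, haN]
      · simp [hzx]
    rw [this, Finset.card_insert_of_notMem (by simp [hvis]), ← hS.cnt_eq]
  · intro i hi
    by_cases hic : i = cnt
    · simp [hic, haN]
    · rw [Function.update_of_ne hic]
      obtain ⟨h1, h2⟩ := hS.queue_mem i (by omega)
      exact ⟨h1, hmono _ h2⟩
  · intro z hz hv
    by_cases hzx : z = x
    · exact Or.inr ⟨cnt, hlt.le, by omega, by simp [hzx]⟩
    by_cases hza : z = resTgt tl hd ρ a
    · exact Or.inr ⟨h, le_rfl, by omega, by rw [Function.update_of_ne hlt.ne, hq, hza]⟩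
    · rw [Function.update_of_ne hza]
      rcases hS.pending z hz (hold z hzx hv) with h1 | ⟨i, h1, h2, h3⟩
      · exact Or.inl h1
      · exact Or.inr ⟨i, h1, by omega, by rw [Function.update_of_ne h2.ne, h3]⟩
  · exact hS.first_mem_update ha hf
  · intro c hc hc0 hfc
    rcases hS.done_update hfa hf hc hc0 hfc with h1 | h1
    · simp [h1, ← hx]
    · exact hmono _ h1
  · obtain ⟨d, hd'⟩ := hS.tree
    have hyv : vis (resTgt tl hd ρ a) ≠ 0 := hq ▸ (hS.queue_mem h hlt).2
    have hyN : resTgt tl hd ρ a < N := hq ▸ (hS.queue_mem h hlt).1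
    have hyx : resTgt tl hd ρ a ≠ x := fun h1 => hyv (h1 ▸ hvis)
    -- The rank of a node is its time of discovery, which exceeds all ranks given before.
    refine ⟨Function.update d x cnt, fun z hz hv => ?_⟩
    by_cases hzx : z = x
    · subst hzx
      simp only [Function.update_self]
      refine ⟨by omega, Or.inr ⟨ha, h0, rfl, hyN, hmono _ hyv, ?_⟩⟩
      rw [Function.update_of_ne hyx]
      exact (hd' _ hyN hyv).1
    · obtain ⟨h1, h2⟩ := hd' z hz (hold z hzx hv)
      simp only [Function.update_of_ne hzx]
      refine ⟨by omega, h2.imp_right fun ⟨h3, h4, h5, h6, h7, h8⟩ =>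
        ⟨h3, h4, h5, h6, hmono _ h7, ?_⟩⟩
      rwa [Function.update_of_ne]
      exact fun h9 => h7 (h9 ▸ hvis)
  · intro hz z hzN hv
    split_ifs at hhit with h1
    · omega
    · by_cases hzx : z = x
      · rwa [hzx]
      · exact hS.hit_zero (hhit ▸ hz) z hzN (hold z hzx hv)
  · intro z hz
    split_ifs at hhit with h1
    · obtain rfl : z = x := by omega
      simp [haN, h1]
    · obtain ⟨h2, h3, h4⟩ := hS.hit_succ z (hhit ▸ hz)
      exact ⟨h2, hmono _ h3, h4⟩

/-- Once the queue is exhausted every visited node has an empty list left, so all its incoming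
residual arcs have been followed. -/
theorem searched (hS : Search N M v tl hd δ ρ ι first vis queue par h cnt hit) (hh : ¬ h < cnt)
    (hhd : ∀ a < M, resTgt tl hd ρ a < N) : Searched N M v tl hd δ ρ ι vis par hit where
  vis_v := hS.vis_v
  vis_lt := hS.vis_lt
  closed c hc h0 hv := by
    refine hS.done c hc h0 ?_
    rcases hS.pending _ (hhd c hc) hv with h1 | ⟨i, h1, h2, -⟩ <;> omega
  tree := by
    obtain ⟨d, h1⟩ := hS.tree
    refine ⟨d, fun x hx hv => ?_⟩
    obtain ⟨h2, h3⟩ := h1 x hx hv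
    exact ⟨h2.trans_le hS.cnt_le, h3⟩
  hit_zero := hS.hit_zero
  hit_succ := hS.hit_succ

end Search

end

/-- Search backwards from the node in register `14`. -/
def explore : Prog :=
  (.instr (.const 17 0) ;; .instr (.const 19 0) ;; .instr (.const 20 1) ;;
    .instr (.store 12 7 14) ;; .instr (.store 11 14 8)) ;;
  .loop (.lt 19 20) (
    .instr (.load 23 12 19) ;; .instr (.load 21 9 23) ;;
    .ite (.eq 21 7) (.instr (.add 19 19 8)) (
      .instr (.sub 21 21 8) ;; .instr (.load 24 10 21) ;; .instr (.store 9 23 24) ;;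
      .instr (.load 25 7 21) ;;
      .ite (.eq 25 7) (.instr (.load 22 4 21)) (.instr (.load 22 5 21)) ;;
      .instr (.load 24 11 22) ;;
      .ite (.eq 24 7) (
        .instr (.store 11 22 8) ;; .instr (.store 13 22 21) ;; .instr (.store 12 20 22) ;;
        .instr (.add 20 20 8) ;; .instr (.load 24 8 22) ;;
        .ite (.eq 24 8) (.instr (.add 17 22 8)) .skip) .skip))

theorem runs_explore {W N M s p v : ℕ} {tl hd : ℕ → ℕ} {σ : State}
    (hE : Env N M s p tl hd σ) (hW : N + M + p + 2 < W)
    (htl : ∀ a < M, tl a < N) (hhd : ∀ a < M, hd a < N)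
    (hρ : ∀ a < M, σ.arr 7 a ≤ 1) (hv : σ.reg 14 = v) (hvN : v < N) (hι : σ.arr 8 v ≠ 1)
    (hι2 : ∀ x < N, σ.arr 8 x ≤ 1)
    (hfirst : ∀ y < N, Ptr (σ.arr 6) (resTgt tl hd (σ.arr 7)) M y (σ.arr 9 y))
    (hnxt : ∀ a < M, σ.arr 6 a = 0 → Ptr (σ.arr 6) (resTgt tl hd (σ.arr 7)) a
      (resTgt tl hd (σ.arr 7) a) (σ.arr 10 a)) (hvis : ∀ y < N, σ.arr 11 y = 0) :
    Runs W explore σ (25 * (N + M) + 6) fun τ =>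
      Searched N M v tl hd (σ.arr 6) (σ.arr 7) (σ.arr 8) (τ.arr 11) (τ.arr 13) (τ.reg 17) := by
  have hs := fun a ha => resSrc_lt (ρ := σ.arr 7) htl hhd (a := a) ha
  have ht := fun a ha => resTgt_lt (ρ := σ.arr 7) htl hhd (a := a) ha
  -- The budget is `N` minus the queue position plus the number of unread arcs, at most `N + M` at
  -- the start. Each iteration advances the queue or consumes an arc.
  refine (Runs.seq (T₁ := 5) (T₂ := (20 + 1) * (N + M) + 1) (Q := fun τ =>
      Searched N M v tl hd (σ.arr 6) (σ.arr 7) (σ.arr 8) (τ.arr 11) (τ.arr 13) (τ.reg 17))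
    (.of_wp (Q := fun τ => Search N M v tl hd (σ.arr 6) (σ.arr 7) (σ.arr 8) (τ.arr 9) (τ.arr 11)
      (τ.arr 12) (τ.arr 13) (τ.reg 19) (τ.reg 20) (τ.reg 17)) ?_ (by decide))
    fun τ hF hτ => (Runs.while (I := fun f υ => Search N M v tl hd (σ.arr 6) (σ.arr 7) (σ.arr 8)
      (υ.arr 9) (υ.arr 11) (υ.arr 12) (υ.arr 13) (υ.reg 19) (υ.reg 20) (υ.reg 17) ∧
      (N - υ.reg 19) + remaining M tl hd (σ.arr 6) (σ.arr 7) (υ.arr 9) ≤ f)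
      ⟨hτ, Nat.add_le_add (Nat.sub_le _ _) (remaining_le _)⟩ ?_).mono le_rfl
      fun υ _ hυ => ?_).mono (by omega) fun _ _ => id
  · simp [hE.r7, hE.r8, hv]
    exact ⟨by omega, by omega, by omega, by omega, .init hvN hι hfirst ht hvis⟩
  · rintro f υ hF' ⟨hI, hf⟩ hlt
    have hlt : υ.reg 19 < υ.reg 20 := hlt
    have hE' : Env N M s p tl hd υ :=
      (hE.of_frame hF (by decide) (by decide)).of_frame hF' (by decide) (by decide)
    have e6 : υ.arr 6 = σ.arr 6 := by rw [hF'.arr 6 (by decide), hF.arr 6 (by decide)]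
    have e7 : υ.arr 7 = σ.arr 7 := by rw [hF'.arr 7 (by decide), hF.arr 7 (by decide)]
    have e8 : υ.arr 8 = σ.arr 8 := by rw [hF'.arr 8 (by decide), hF.arr 8 (by decide)]
    have e10 : υ.arr 10 = σ.arr 10 := by rw [hF'.arr 10 (by decide), hF.arr 10 (by decide)]
    have hcnt := hI.cnt_le
    obtain ⟨hyN, hyv⟩ := hI.queue_mem _ hlt
    refine .of_wp ?_ (by decide)
    rcases hfa : υ.arr 9 (υ.arr 12 (υ.reg 19)) with _ | a
    · simp [hE'.r7, hE'.r8, hfa]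
      exact ⟨by omega, by omega, by omega, _, by omega, hI.next hlt hfa, le_rfl⟩
    · obtain ⟨ha, ha0, hay⟩ := hI.first_mem _ hyN a hfa
      have hp := hnxt a ha ha0
      have hple := hp.le
      have hrem := remaining_lt (tl := tl) (hd := hd) (ρ := σ.arr 7) (first := υ.arr 9) ha ha0
        (by rw [hay, hfa]) hple
      have hsN := hs a ha
      have hρa := hρ a ha
      have key : ∀ x, x = resSrc tl hd (σ.arr 7) a → x < W ∧ υ.arr 11 x < W ∧
          (υ.arr 11 x = 0 → 1 < W ∧ a < W ∧ x < W ∧ υ.reg 20 + 1 < W ∧ σ.arr 8 x < W ∧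
            (σ.arr 8 x = 1 → x + 1 < W ∧ ∃ f' < f,
              Search N M v tl hd (σ.arr 6) (σ.arr 7) (σ.arr 8)
                (Function.update (υ.arr 9) (υ.arr 12 (υ.reg 19)) (σ.arr 10 a))
                (Function.update (υ.arr 11) x 1) (Function.update (υ.arr 12) (υ.reg 20) x)
                (Function.update (υ.arr 13) x a) (υ.reg 19) (υ.reg 20 + 1) (x + 1) ∧
              N - υ.reg 19 + remaining M tl hd (σ.arr 6) (σ.arr 7)
                (Function.update (υ.arr 9) (υ.arr 12 (υ.reg 19)) (σ.arr 10 a)) ≤ f') ∧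
            (¬ σ.arr 8 x = 1 → ∃ f' < f,
              Search N M v tl hd (σ.arr 6) (σ.arr 7) (σ.arr 8)
                (Function.update (υ.arr 9) (υ.arr 12 (υ.reg 19)) (σ.arr 10 a))
                (Function.update (υ.arr 11) x 1) (Function.update (υ.arr 12) (υ.reg 20) x)
                (Function.update (υ.arr 13) x a) (υ.reg 19) (υ.reg 20 + 1) (υ.reg 17) ∧
              N - υ.reg 19 + remaining M tl hd (σ.arr 6) (σ.arr 7)
                (Function.update (υ.arr 9) (υ.arr 12 (υ.reg 19)) (σ.arr 10 a)) ≤ f')) ∧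
          (¬ υ.arr 11 x = 0 → ∃ f' < f,
              Search N M v tl hd (σ.arr 6) (σ.arr 7) (σ.arr 8)
                (Function.update (υ.arr 9) (υ.arr 12 (υ.reg 19)) (σ.arr 10 a))
                (υ.arr 11) (υ.arr 12) (υ.arr 13) (υ.reg 19) (υ.reg 20) (υ.reg 17) ∧
              N - υ.reg 19 + remaining M tl hd (σ.arr 6) (σ.arr 7)
                (Function.update (υ.arr 9) (υ.arr 12 (υ.reg 19)) (σ.arr 10 a)) ≤ f') := by
        rintro x rfl
        rw [← hay]
        have hfa' : υ.arr 9 (resTgt tl hd (σ.arr 7) a) = a + 1 := by rw [hay, hfa]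
        have b1 := hI.vis_lt _ hsN
        have b2 := hι2 _ hsN
        refine ⟨by omega, by omega, fun h0 => ⟨by omega, by omega, by omega, by omega, by omega,
          fun h1 => ⟨by omega, _, by omega, hI.visit hlt ha hsN ha0 hay.symm hfa' hp h0 ?_, le_rfl⟩,
          fun h1 => ⟨_, by omega, hI.visit hlt ha hsN ha0 hay.symm hfa' hp h0 ?_, le_rfl⟩⟩,
          fun h0 => ⟨_, by omega, hI.pop hlt ha hay.symm hfa' hp h0, le_rfl⟩⟩
        · rw [if_pos h1]
        · rw [if_neg h1]
      simp [hE'.r7, hE'.r8, hfa, e7, e8, e10, hE'.tl a ha, hE'.hd a ha, -Order.lt_add_one_iff]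
      exact ⟨by omega, by omega, by omega, by omega, by omega,
        fun h0 => key (tl a) (by simp [resSrc, h0]), fun h0 => key (hd a) (by simp [resSrc, h0])⟩
  · obtain ⟨hlt, f, hI, -⟩ := hυ
    exact hI.searched hlt ht

end RAM

/-! ### Search, augmentation and passage to the next layer -/

namespace RAM

open ArcGraph

/-- Find the nodes from which the node in register `14` is reachable in the residual graph. -/
def search : Prog := clear 9 10 ;; clear 11 10 ;; link ;; explore

theorem runs_search {W N M s p v : ℕ} {tl hd : ℕ → ℕ} {σ : State}
    (hE : Env N M s p tl hd σ) (hW : N + M + p + 2 < W)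
    (htl : ∀ a < M, tl a < N) (hhd : ∀ a < M, hd a < N)
    (hδ : ∀ a < M, σ.arr 6 a ≤ 1) (hρ : ∀ a < M, σ.arr 7 a ≤ 1) (hι2 : ∀ x < N, σ.arr 8 x ≤ 1)
    (hv : σ.reg 14 = v) (hvN : v < N) (hι : σ.arr 8 v ≠ 1) :
    Runs W search σ (40 * (N + M) + 12) fun τ =>
      Searched N M v tl hd (σ.arr 6) (σ.arr 7) (σ.arr 8) (τ.arr 11) (τ.arr 13) (τ.reg 17) := by
  refine ((runs_clear (by decide) hE.r7 hE.r8 hE.r10 (by omega)).seq fun τ₁ hF₁ h₁ => ?_).mono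
    (T₁ := (3 * N + 2) + ((3 * N + 2) + ((15 * M + 2) + (25 * (N + M) + 6)))) (by omega)
    fun _ _ => id
  have hE₁ := hE.of_frame hF₁ (by decide) (by decide)
  refine (runs_clear (by decide) hE₁.r7 hE₁.r8 hE₁.r10 (by omega)).seq fun τ₂ hF₂ h₂ => ?_
  have hE₂ := hE₁.of_frame hF₂ (by decide) (by decide)
  have e6 : τ₂.arr 6 = σ.arr 6 := by rw [hF₂.arr 6 (by decide), hF₁.arr 6 (by decide)]
  have e7 : τ₂.arr 7 = σ.arr 7 := by rw [hF₂.arr 7 (by decide), hF₁.arr 7 (by decide)]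
  refine (runs_link hE₂ hW htl hhd (by rwa [e6]) (by rwa [e7])
    (by rwa [hF₂.arr 9 (by decide)])).seq fun τ₃ hF₃ h₃ => ?_
  have hE₃ := hE₂.of_frame hF₃ (by decide) (by decide)
  have e6' : τ₃.arr 6 = σ.arr 6 := by rw [hF₃.arr 6 (by decide), e6]
  have e7' : τ₃.arr 7 = σ.arr 7 := by rw [hF₃.arr 7 (by decide), e7]
  have e8 : τ₃.arr 8 = σ.arr 8 := by
    rw [hF₃.arr 8 (by decide), hF₂.arr 8 (by decide), hF₁.arr 8 (by decide)]
  have e14 : τ₃.reg 14 = v := by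
    rw [hF₃.reg 14 (by decide), hF₂.reg 14 (by decide), hF₁.reg 14 (by decide), hv]
  rw [e6, e7] at h₃
  have := runs_explore hE₃ hW htl hhd (by rwa [e7']) e14 hvN (by rwa [e8]) (by rwa [e8])
    (by rw [e6', e7']; exact h₃.1) (by rw [e6', e7']; exact h₃.2)
    (by rwa [hF₃.arr 11 (by decide)])
  rwa [e6', e7', e8] at this

/-- The arcs with mark `1`. -/
def marked (ρ : ℕ → ℕ) (M : ℕ) : Finset ℕ := (Finset.range M).filter fun a => ρ a = 1

/-- The arcs with mark `0`. -/
def unmarked (δ : ℕ → ℕ) (M : ℕ) : Finset ℕ := (Finset.range M).filter fun a => δ a = 0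

theorem mem_marked {ρ : ℕ → ℕ} {M a : ℕ} : a ∈ marked ρ M ↔ a < M ∧ ρ a = 1 := by simp [marked]

theorem mem_unmarked {δ : ℕ → ℕ} {M a : ℕ} : a ∈ unmarked δ M ↔ a < M ∧ δ a = 0 := by
  simp [unmarked]

/-- The nodes with mark `1`. -/
def markedSet (ι : ℕ → ℕ) (N : ℕ) : Set ℕ := {x | x < N ∧ ι x = 1}

-- Toggling the mark of an arc acts on net values as one unit sent along its residual orientation,
-- whichever that is.
open scoped Classical in
theorem net_toggle (tl hd ρ : ℕ → ℕ) {M a : ℕ} (ha : a < M) (hρ : ρ a ≤ 1) (X : Set ℕ) :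
    net tl hd (marked (Function.update ρ a (1 - ρ a)) M) X = net tl hd (marked ρ M) X +
      ((if resSrc tl hd ρ a ∈ X then 1 else 0) - (if resTgt tl hd ρ a ∈ X then 1 else 0)) := by
  have h : ρ a = 0 ∨ ρ a = 1 := by omega
  rcases h with h | h
  · have h1 : marked (Function.update ρ a (1 - ρ a)) M = insert a (marked ρ M) := by
      ext b
      by_cases hb : b = a
      · simp [mem_marked, hb, h, ha]
      · simp [mem_marked, hb]
    rw [h1, net_insert (by simp [mem_marked, h])]
    simp [resSrc, resTgt, h]
  · have h1 : marked (Function.update ρ a (1 - ρ a)) M = (marked ρ M).erase a := by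
      ext b
      by_cases hb : b = a
      · simp [mem_marked, hb, h]
      · simp [mem_marked, hb]
    rw [h1, net_erase (by simp [mem_marked, h, ha])]
    simp only [resSrc, resTgt, h, one_ne_zero, if_false]
    ring

/-- Reverse the arcs of the path that a search has found. -/
def augment : Prog :=
  (.instr (.sub 22 17 8) ;; .instr (.sub 24 22 14) ;; .instr (.sub 25 14 22) ;;
    .instr (.add 24 24 25)) ;;
  .loop (.lt 7 24) (
    .instr (.load 21 13 22) ;; .instr (.load 25 7 21) ;;
    .ite (.eq 25 7) (.instr (.load 22 5 21)) (.instr (.load 22 4 21)) ;;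
    .instr (.sub 25 8 25) ;; .instr (.store 7 21 25) ;;
    .instr (.sub 24 22 14) ;; .instr (.sub 25 14 22) ;; .instr (.add 24 24 25))

/-- The walk follows parent arcs from the recorded node to `v`. Ranks strictly decrease, so it has
at most `N` steps, and every arc ahead still has its original mark. -/
theorem runs_augment {W N M s p v x₀ : ℕ} {tl hd ι : ℕ → ℕ} {σ : State}
    (hE : Env N M s p tl hd σ) (hW : N + M + p + 2 < W)
    (hρ : ∀ a < M, σ.arr 7 a ≤ 1) (hρδ : ∀ a < M, σ.arr 7 a = 1 → σ.arr 6 a = 0)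
    (hv : σ.reg 14 = v) (hvN : v < N) (h17 : σ.reg 17 = x₀ + 1)
    (hS : Searched N M v tl hd (σ.arr 6) (σ.arr 7) ι (σ.arr 11) (σ.arr 13) (x₀ + 1)) :
    Runs W augment σ (10 * N + 5) fun τ =>
      (∀ a < M, τ.arr 7 a ≤ 1) ∧ (∀ a < M, τ.arr 7 a = 1 → σ.arr 6 a = 0) ∧
      ∀ X : Set ℕ, x₀ ∈ X → v ∉ X →
        net tl hd (marked (τ.arr 7) M) X = net tl hd (marked (σ.arr 7) M) X + 1 := by
  classical
  obtain ⟨hx₀N, hx₀v, -⟩ := hS.hit_succ x₀ rfl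
  obtain ⟨d, hd'⟩ := hS.tree
  -- Register `24` holds the distance `|x - v|` of the current node number from `v`, because the
  -- loop needs a test for `x ≠ v` and has only `lt` and `eq`.
  refine (Runs.seq (T₁ := 4) (T₂ := (9 + 1) * N + 1)
    (.of_wp (Q := fun τ => τ.reg 22 = x₀ ∧ τ.reg 24 = (x₀ - v) + (v - x₀)) ?_ (by decide))
    fun τ hF hτ => (Runs.while (T := 9) (f₀ := N) (I := fun f υ => υ.reg 22 < N ∧
      σ.arr 11 (υ.reg 22) ≠ 0 ∧ υ.reg 24 = (υ.reg 22 - v) + (v - υ.reg 22) ∧ d (υ.reg 22) ≤ f ∧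
      (∀ a < M, υ.arr 7 a ≤ 1) ∧ (∀ a < M, υ.arr 7 a = 1 → σ.arr 6 a = 0) ∧
      (∀ X : Set ℕ, net tl hd (marked (υ.arr 7) M) X = net tl hd (marked (σ.arr 7) M) X +
        ((if x₀ ∈ X then 1 else 0) - (if υ.reg 22 ∈ X then 1 else 0))) ∧
      ∀ z < N, σ.arr 11 z ≠ 0 → z ≠ v → d z ≤ d (υ.reg 22) →
        υ.arr 7 (σ.arr 13 z) = σ.arr 7 (σ.arr 13 z)) ?_ ?_).mono le_rfl
      fun υ hF' hυ => ?_).mono (by omega) fun _ _ => id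
  · simp [h17, hE.r8, hv]
    omega
  · simp only [hτ.1, hτ.2, hF.arr 7 (by decide)]
    exact ⟨hx₀N, hx₀v, trivial, (hd' x₀ hx₀N hx₀v).1.le, hρ, hρδ, by simp,
      fun _ _ _ _ _ => trivial⟩
  · rintro f υ hF' ⟨hx, hxv, h24, hf, h1, h2, h3, h4⟩ hlt
    have hE' : Env N M s p tl hd υ :=
      (hE.of_frame hF (by decide) (by decide)).of_frame hF' (by decide) (by decide)
    have e13 : υ.arr 13 = σ.arr 13 := by rw [hF'.arr 13 (by decide), hF.arr 13 (by decide)]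
    have e14 : υ.reg 14 = v := by rw [hF'.reg 14 (by decide), hF.reg 14 (by decide), hv]
    have hlt : υ.reg 7 < υ.reg 24 := hlt
    rw [hE'.r7, h24] at hlt
    obtain ⟨-, rfl | ⟨ha, ha0, hsrc, htN, htv, htd⟩⟩ := hd' _ hx hxv
    · omega
    have hane : υ.reg 22 ≠ v := by omega
    set a := σ.arr 13 (υ.reg 22) with hadef
    have hρa : υ.arr 7 a = σ.arr 7 a := h4 _ hx hxv hane le_rfl
    have hsrc' : resSrc tl hd (υ.arr 7) a = υ.reg 22 := by rw [resSrc, hρa, ← resSrc, hsrc]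
    have key : ∀ y, y = resTgt tl hd (σ.arr 7) a → y < W ∧ 1 - σ.arr 7 a < W ∧ y - v < W ∧
        v - y < W ∧ y - v + (v - y) < W ∧ ∃ f' < f, y < N ∧ σ.arr 11 y ≠ 0 ∧ d y ≤ f' ∧
        (∀ b < M, Function.update (υ.arr 7) a (1 - σ.arr 7 a) b ≤ 1) ∧
        (∀ b < M, Function.update (υ.arr 7) a (1 - σ.arr 7 a) b = 1 → σ.arr 6 b = 0) ∧
        (∀ X : Set ℕ, net tl hd (marked (Function.update (υ.arr 7) a (1 - σ.arr 7 a)) M) X =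
          net tl hd (marked (σ.arr 7) M) X +
          ((if x₀ ∈ X then 1 else 0) - (if y ∈ X then 1 else 0))) ∧
        ∀ z < N, σ.arr 11 z ≠ 0 → z ≠ v → d z ≤ d y →
          Function.update (υ.arr 7) a (1 - σ.arr 7 a) (σ.arr 13 z) = σ.arr 7 (σ.arr 13 z) := by
      rintro y rfl
      refine ⟨by omega, by omega, by omega, by omega, by omega, _, htd.trans_le hf, htN, htv,
        le_rfl,
        fun b hb => ?_, fun b hb h0 => ?_, fun X => ?_, fun z hz hzv hne hdz => ?_⟩
      · by_cases hba : b = a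
        · simp [hba]
        · rw [Function.update_of_ne hba]
          exact h1 b hb
      · by_cases hba : b = a
        · rw [hba, ha0]
        · rw [Function.update_of_ne hba] at h0
          exact h2 b hb h0
      · rw [← hρa, net_toggle tl hd _ ha (h1 a ha), h3, hsrc']
        rw [show resTgt tl hd (υ.arr 7) a = resTgt tl hd (σ.arr 7) a by rw [resTgt, hρa, resTgt]]
        ring
      · rw [Function.update_of_ne]
        · exact h4 z hz hzv hne (hdz.trans htd.le)
        -- Different nodes have different parent arcs, since the residual start of the parent arc is
        -- the node itself.
        · intro hza
          obtain ⟨-, rfl | ⟨-, -, h5, -⟩⟩ := hd' z hz hzv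
          · exact hne rfl
          · rw [hza, hsrc] at h5
            rw [h5] at htd
            omega
    refine .of_wp ?_ (by decide)
    simp only [ne_eq] at key
    simp [e13, e14, hE'.r7, hE'.r8, ← hadef, hE'.tl a ha, hE'.hd a ha, hρa]
    have := hρ a ha
    exact ⟨by omega, by omega, fun h0 => key (hd a) (by simp [resTgt, h0]),
      fun h0 => key (tl a) (by simp [resTgt, h0])⟩
  · obtain ⟨hlt, f, hx, hxv, h24, hf, h1, h2, h3, h4⟩ := hυ
    refine ⟨h1, h2, fun X hX hvX => ?_⟩
    have e7 : υ.reg 7 = 0 := by rw [hF'.reg 7 (by decide), hF.reg 7 (by decide), hE.r7]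
    have hlt : ¬ υ.reg 7 < υ.reg 24 := hlt
    have : υ.reg 22 = v := by omega
    rw [h3, this, if_pos hX, if_neg hvX]
    ring

/-- Add to the marked nodes all unvisited nodes and the heads of their arcs, except the node in
register `14`. -/
def expand : Prog :=
  .instr (.const 18 0) ;;
  .loop (.lt 18 10) (
    .instr (.load 24 11 18) ;; .ite (.eq 24 7) (.instr (.store 8 18 8)) .skip ;;
    .instr (.add 18 18 8)) ;;
  .instr (.const 18 0) ;;
  .loop (.lt 18 12) (
    .instr (.load 24 6 18) ;;
    .ite (.eq 24 7) (
      .instr (.load 21 4 18) ;; .instr (.load 25 11 21) ;;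
      .ite (.eq 25 7) (.instr (.load 23 5 18) ;; .instr (.store 8 23 8)) .skip) .skip ;;
    .instr (.add 18 18 8)) ;;
  .instr (.store 8 14 7)

/-- Old marks are never cleared. This is harmless: `expand` runs only when no marked node was
visited, so the old layer lies in the unvisited set. -/
theorem runs_expand {W N M s p v : ℕ} {tl hd : ℕ → ℕ} {σ : State}
    (hE : Env N M s p tl hd σ) (hW : N + M + p + 2 < W)
    (htl : ∀ a < M, tl a < N) (hhd : ∀ a < M, hd a < N)
    (hδ : ∀ a < M, σ.arr 6 a ≤ 1) (hι2 : ∀ x < N, σ.arr 8 x ≤ 1)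
    (hvis : ∀ x < N, σ.arr 11 x ≤ 1) (hv : σ.reg 14 = v) :
    Runs W expand σ (10 * (N + M) + 5) fun τ => (∀ x < N, τ.arr 8 x ≤ 1) ∧
      ∀ x < N, τ.arr 8 x = 1 ↔ x ≠ v ∧ (σ.arr 8 x = 1 ∨ σ.arr 11 x = 0 ∨
        ∃ a < M, σ.arr 6 a = 0 ∧ σ.arr 11 (tl a) = 0 ∧ hd a = x) := by
  have hupd : ∀ (f : ℕ → ℕ) (b c : ℕ), b ≤ 1 → (∀ x < N, f x ≤ 1) →
      ∀ x < N, Function.update f c b x ≤ 1 := fun f b c hb hf x hx => by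
    by_cases h : x = c
    · simpa [h]
    · rw [Function.update_of_ne h]
      exact hf x hx
  refine Runs.mono (T₁ := 1 + (((5 + 1) * N + 1) + (1 + (((9 + 1) * M + 1) + 1))))
    (Runs.seq (.of_wp (Q := fun τ => τ.reg 18 = 0) (by simp; omega) le_rfl)
    fun τ₁ hF₁ h₁ => ?_) (by omega) fun _ _ => id
  have hE₁ := hE.of_frame hF₁ (by decide) (by decide)
  refine Runs.seq (Runs.for (I := fun j τ => (∀ x < N, τ.arr 8 x ≤ 1) ∧
    ∀ x < N, τ.arr 8 x = 1 ↔ (σ.arr 8 x = 1 ∨ (x < j ∧ σ.arr 11 x = 0)))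
    (by decide) h₁ hE₁.r10 (by rw [hF₁.arr 8 (by decide)]; exact ⟨hι2, by simp⟩)
    fun j υ hj hF' hυ hI => .of_wp ?_ (by decide)) fun τ₂ hF₂ h₂ => ?_
  · have hE' := hE₁.of_frame hF' (by decide) (by decide)
    have e11 : υ.arr 11 = σ.arr 11 := by rw [hF'.arr 11 (by decide), hF₁.arr 11 (by decide)]
    have b1 := hvis j hj
    simp [hE'.r7, hE'.r8, hυ, e11, -Order.lt_add_one_iff]
    refine ⟨by omega, fun h0 => ⟨by omega, by omega, hupd _ _ _ (by omega) hI.1, fun x hx => ?_⟩,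
      fun h0 => ⟨by omega, hI.1, fun x hx => ?_⟩⟩
    · by_cases hxj : x = j
      · simp [hxj, h0]
      · rw [Function.update_of_ne hxj, hI.2 x hx]
        have : x < j + 1 ↔ x < j := by omega
        rw [this]
    · rw [hI.2 x hx]
      by_cases hxj : x = j
      · simp [hxj, h0]
      · have : x < j + 1 ↔ x < j := by omega
        rw [this]
  have hE₂ := hE₁.of_frame hF₂ (by decide) (by decide)
  refine Runs.seq (.of_wp (Q := fun τ => τ.reg 18 = 0) (by simp; omega) le_rfl)
    fun τ₃ hF₃ h₃ => ?_
  have hE₃ := hE₂.of_frame hF₃ (by decide) (by decide)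
  refine Runs.seq (Runs.for (I := fun j τ => (∀ x < N, τ.arr 8 x ≤ 1) ∧
    ∀ x < N, τ.arr 8 x = 1 ↔ (σ.arr 8 x = 1 ∨ σ.arr 11 x = 0 ∨
      ∃ a < j, σ.arr 6 a = 0 ∧ σ.arr 11 (tl a) = 0 ∧ hd a = x))
    (by decide) h₃ hE₃.r12 ?_ fun j υ hj hF' hυ hI => .of_wp ?_ (by decide)) fun τ₄ hF₄ h₄ => ?_
  · rw [hF₃.arr 8 (by decide)]
    refine ⟨h₂.1, fun x hx => ?_⟩
    rw [h₂.2 x hx]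
    simp [hx]
  · have hE' := hE₃.of_frame hF' (by decide) (by decide)
    have e11 : υ.arr 11 = σ.arr 11 := by
      rw [hF'.arr 11 (by decide), hF₃.arr 11 (by decide), hF₂.arr 11 (by decide),
        hF₁.arr 11 (by decide)]
    have e6 : υ.arr 6 = σ.arr 6 := by
      rw [hF'.arr 6 (by decide), hF₃.arr 6 (by decide), hF₂.arr 6 (by decide),
        hF₁.arr 6 (by decide)]
    have b1 := hvis _ (htl j hj)
    have b2 := hδ j hj
    have b3 := htl j hj
    have b4 := hhd j hj
    have hskip : ¬ (σ.arr 6 j = 0 ∧ σ.arr 11 (tl j) = 0) → ∀ x < N, υ.arr 8 x = 1 ↔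
        (σ.arr 8 x = 1 ∨ σ.arr 11 x = 0 ∨
          ∃ a < j + 1, σ.arr 6 a = 0 ∧ σ.arr 11 (tl a) = 0 ∧ hd a = x) := by
      intro h0 x hx
      rw [hI.2 x hx]
      refine or_congr_right (or_congr_right ⟨fun ⟨a, h1, h2⟩ => ⟨a, by omega, h2⟩,
        fun ⟨a, h1, h2, h3, h4⟩ => ⟨a, ?_, h2, h3, h4⟩⟩)
      rcases Nat.lt_succ_iff_lt_or_eq.1 h1 with h5 | rfl
      · exact h5
      · exact absurd ⟨h2, h3⟩ h0
    simp [hE'.r7, hE'.r8, hυ, e11, e6, hE'.tl j hj, hE'.hd j hj, -Order.lt_add_one_iff]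
    refine ⟨by omega, fun h0 => ⟨by omega, by omega, fun h1 => ⟨by omega, by omega, by omega,
      hupd _ _ _ (by omega) hI.1, fun x hx => ?_⟩, fun h1 => ⟨by omega, hI.1, hskip (by tauto)⟩⟩,
      fun h0 => ⟨by omega, hI.1, hskip (by tauto)⟩⟩
    by_cases hxj : x = hd j
    · rw [hxj, Function.update_self]
      exact ⟨fun _ => Or.inr (Or.inr ⟨j, by omega, h0, h1, rfl⟩), fun _ => rfl⟩
    · rw [Function.update_of_ne hxj, hI.2 x hx]
      refine or_congr_right (or_congr_right ⟨fun ⟨a, h1, h2⟩ => ⟨a, by omega, h2⟩,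
        fun ⟨a, h1, h2, h3, h4⟩ => ⟨a, ?_, h2, h3, h4⟩⟩)
      rcases Nat.lt_succ_iff_lt_or_eq.1 h1 with h5 | rfl
      · exact h5
      · exact absurd h4.symm hxj
  · have hE₄ := hE₃.of_frame hF₄ (by decide) (by decide)
    have e14 : τ₄.reg 14 = v := by
      rw [hF₄.reg 14 (by decide), hF₃.reg 14 (by decide), hF₂.reg 14 (by decide),
        hF₁.reg 14 (by decide), hv]
    refine .of_wp ?_ le_rfl
    simp [hE₄.r7, e14]
    refine ⟨by omega, hupd _ _ _ (by omega) h₄.1, fun x hx => ?_⟩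
    by_cases hxv : x = v
    · simp [hxv]
    · rw [Function.update_of_ne hxv, h₄.2 x hx]
      simp [hxv]

end RAM

/-! ### The maximum flow from the last layer to one node -/

namespace RAM

open ArcGraph

section

variable {N M v s : ℕ} {tl hd δ ρ ι vis par : ℕ → ℕ} {hit : ℕ}

/-- Following parent arcs leads to `v`, because ranks decrease. -/
theorem Searched.reflTransGen (hS : Searched N M v tl hd δ ρ ι vis par hit)
    (hρ : ∀ a < M, ρ a ≤ 1) {x : ℕ} (hx : x < N) (hv : vis x ≠ 0) :
    Relation.ReflTransGen (Res tl hd (unmarked δ M) (marked ρ M)) x v := by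
  obtain ⟨d, hd'⟩ := hS.tree
  induction h : d x using Nat.strong_induction_on generalizing x with
  | _ n ih =>
    subst h
    obtain ⟨-, rfl | ⟨h1, h2, h3, h4, h5, h6⟩⟩ := hd' x hx hv
    · exact .refl
    · refine .head ⟨par x, mem_unmarked.2 ⟨h1, h2⟩, ?_⟩ (ih _ h6 h4 h5 rfl)
      have := hρ _ h1
      rcases (show ρ (par x) = 0 ∨ ρ (par x) = 1 by omega) with h7 | h7
      · refine Or.inl ⟨by simp [mem_marked, h7], ?_, ?_⟩
        · simpa [resSrc, h7] using h3
        · simp [resTgt, h7]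
      · refine Or.inr ⟨by simp [mem_marked, h7, h1], ?_, ?_⟩
        · simpa [resSrc, h7] using h3
        · simp [resTgt, h7]

theorem Searched.unvisited_closed (hS : Searched N M v tl hd δ ρ ι vis par hit)
    (htl : ∀ a < M, tl a < N) (hhd : ∀ a < M, hd a < N)
    (hρ : ∀ a < M, ρ a ≤ 1) (x y : ℕ) (hx : x ∈ {x | x < N ∧ vis x = 0})
    (hxy : Res tl hd (unmarked δ M) (marked ρ M) x y) : y ∈ {x | x < N ∧ vis x = 0} := by
  obtain ⟨a, ha, h⟩ := hxy
  obtain ⟨haM, ha0⟩ := mem_unmarked.1 ha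
  have := hρ a haM
  have hc := hS.closed a haM ha0
  rcases h with ⟨h1, rfl, rfl⟩ | ⟨h1, rfl, rfl⟩
  · have h2 : ρ a = 0 := by
      simp only [mem_marked, not_and] at h1
      have := h1 haM
      omega
    simp only [resTgt, resSrc, h2, if_true] at hc
    exact ⟨hhd a haM, not_not.1 fun h3 => hc h3 hx.2⟩
  · have h2 : ρ a = 1 := (mem_marked.1 h1).2
    simp only [resTgt, resSrc, h2, one_ne_zero, if_false] at hc
    exact ⟨htl a haM, not_not.1 fun h3 => hc h3 hx.2⟩

end

/-- `R` is a maximum flow to `v` from the `k`-th layer. -/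
def Saturated (tl hd : ℕ → ℕ) (A R : Finset ℕ) (s v k : ℕ) : Prop :=
  ∃ (S T : Set ℕ) (q : ℕ), Layer tl hd A s v k S ∧ IsFlow tl hd A R S v q ∧ S ⊆ T ∧ v ∉ T ∧
    ∀ x y, x ∈ T → Res tl hd A R x y → y ∈ T

/-- One round of the flow computation: augment the flow, or pass to the next layer. -/
def round : Prog :=
  search ;; .ite (.eq 17 7)
    (.instr (.add 16 16 8) ;; .ite (.lt 16 6) expand (.instr (.const 15 0))) augment

/-- The state of the flow computation, with at most `f` rounds to go. -/
def FlowInv (N M s p v : ℕ) (tl hd δ : ℕ → ℕ) (f : ℕ) (σ : State) : Prop :=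
  (∀ x < N, σ.arr 8 x ≤ 1) ∧ (∀ a < M, σ.arr 7 a ≤ 1) ∧ (∀ a < M, σ.arr 7 a = 1 → δ a = 0) ∧
  ((σ.reg 15 = 1 ∧ σ.reg 16 < p ∧ ∃ q,
      IsFlow tl hd (unmarked δ M) (marked (σ.arr 7) M) (markedSet (σ.arr 8) N) v q ∧
      Layer tl hd (unmarked δ M) s v (σ.reg 16) (markedSet (σ.arr 8) N) ∧
      (2 ^ (p - 1) - q) + (p - σ.reg 16) ≤ f) ∨
    (σ.reg 15 = 0 ∧ Saturated tl hd (unmarked δ M) (marked (σ.arr 7) M) s v (p - 1)))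

/-- A visited marked node gives an augmenting path. Otherwise the unvisited set is a minimum cut,
tight for the current flow, and farthest because each visited node has a residual path to `v`; its
layer is the next one, or the computation stops. -/
theorem runs_round {W N M s p v f : ℕ} {tl hd : ℕ → ℕ} {σ : State}
    (hE : Env N M s p tl hd σ) (hW : N + M + p + 2 < W)
    (htl : ∀ a < M, tl a < N) (hhd : ∀ a < M, hd a < N) (hδ : ∀ a < M, σ.arr 6 a ≤ 1)
    (hv : σ.reg 14 = v) (hvN : v < N) (hsv : s ≠ v)
    (hs : ((unmarked (σ.arr 6) M).filter fun a => tl a = s).card ≤ 1)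
    (hA : ∀ x, ((unmarked (σ.arr 6) M).filter fun a => tl a = x).card ≤ 2)
    (hI : FlowInv N M s p v tl hd (σ.arr 6) f σ) (hgo : σ.reg 15 ≠ 0) :
    Runs W round σ (50 * (N + M) + 20) fun τ =>
      ∃ f' < f, FlowInv N M s p v tl hd (σ.arr 6) f' τ := by
  obtain ⟨hι, hρ, hρδ, h | h⟩ := hI
  swap
  · exact absurd h.1 hgo
  obtain ⟨hgo1, hip, q, hq, hL, hf⟩ := h
  set A := unmarked (σ.arr 6) M
  have hvS := hL.notMem hsv
  have hιv : σ.arr 8 v ≠ 1 := fun h1 => hvS ⟨hvN, h1⟩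
  -- The layer itself is a cut with at most `2 ^ i` arcs, and `i ≤ p - 1`. So the truncated
  -- difference `2 ^ (p - 1) - q` really drops when the flow grows.
  have hbound : ∀ {R : Finset ℕ} {q : ℕ}, IsFlow tl hd A R (markedSet (σ.arr 8) N) v q →
      q ≤ 2 ^ (p - 1) := fun hR =>
    ((hR.le_card_out le_rfl hvS).trans
      (hL.card_out_le (by convert hs) fun x => by convert hA x)).trans
      (Nat.pow_le_pow_right (by norm_num) (by omega))
  refine Runs.mono (T₁ := (40 * (N + M) + 12) + ((10 * (N + M) + 7) + 1))
    (Runs.seq (runs_search hE hW htl hhd hδ hρ hι hv hvN hιv) fun τ hF hS =>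
    Runs.ite (fun hb => ?_) fun hb => ?_) (by omega) fun _ _ => id
  all_goals
    have hE' := hE.of_frame hF (by decide) (by decide)
    have e6 : τ.arr 6 = σ.arr 6 := hF.arr 6 (by decide)
    have e7 : τ.arr 7 = σ.arr 7 := hF.arr 7 (by decide)
    have e8 : τ.arr 8 = σ.arr 8 := hF.arr 8 (by decide)
    have e14 : τ.reg 14 = v := (hF.reg 14 (by decide)).trans hv
    have e15 : τ.reg 15 = σ.reg 15 := hF.reg 15 (by decide)
    have e16 : τ.reg 16 = σ.reg 16 := hF.reg 16 (by decide)
    have hb : _ := hb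
    simp only [Test.Holds, hE'.r7] at hb
  · rw [hb] at hS
    set T : Set ℕ := {x | x < N ∧ τ.arr 11 x = 0} with hT
    have hST : markedSet (σ.arr 8) N ⊆ T := fun x hx =>
      ⟨hx.1, not_not.1 fun h1 => hS.hit_zero rfl x hx.1 h1 hx.2⟩
    have hvT : v ∉ T := fun h1 => hS.vis_v h1.2
    have hcl := hS.unvisited_closed htl hhd hρ
    refine Runs.mono (T₁ := 1 + ((10 * (N + M) + 5) + 1)) (Runs.seq
      (.of_wp (Q := fun υ => υ.reg 16 = σ.reg 16 + 1) ?_ le_rfl) fun υ hF' hυ =>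
      Runs.ite (fun hlt => ?_) fun hlt => ?_) (by omega) fun _ _ => id
    · simp [e16, hE'.r8]
      omega
    all_goals
      have hE'' := hE'.of_frame hF' (by decide) (by decide)
      simp only [Test.Holds, hυ, hE''.r6] at hlt
      have e6' : υ.arr 6 = σ.arr 6 := (hF'.arr 6 (by decide)).trans e6
      have e7' : υ.arr 7 = σ.arr 7 := (hF'.arr 7 (by decide)).trans e7
      have e8' : υ.arr 8 = σ.arr 8 := (hF'.arr 8 (by decide)).trans e8
      have e11 : υ.arr 11 = τ.arr 11 := hF'.arr 11 (by decide)
      have e14' : υ.reg 14 = v := (hF'.reg 14 (by decide)).trans e14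
      have e15' : υ.reg 15 = σ.reg 15 := (hF'.reg 15 (by decide)).trans e15
    · have hgo1 : σ.reg 15 = 1 := by assumption
      refine (runs_expand hE'' hW htl hhd (by rwa [e6']) (by rwa [e8'])
        (by rw [e11]; exact hS.vis_lt) e14').mono le_rfl fun ω hF'' hω => ?_
      rw [e6', e8', e11] at hω
      have hset : markedSet (ω.arr 8) N =
          {x | x ≠ v ∧ (x ∈ T ∨ ∃ a ∈ A, tl a ∈ T ∧ hd a = x)} := by
        ext x
        simp only [markedSet, Set.mem_ofPred_eq]
        constructor
        · rintro ⟨hx, h1⟩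
          obtain ⟨h2, h3 | h3 | ⟨a, ha, ha0, h3, h4⟩⟩ := (hω.2 x hx).1 h1
          · exact ⟨h2, Or.inl (hST ⟨hx, h3⟩)⟩
          · exact ⟨h2, Or.inl ⟨hx, h3⟩⟩
          · exact ⟨h2, Or.inr ⟨a, mem_unmarked.2 ⟨ha, ha0⟩, ⟨htl a ha, h3⟩, h4⟩⟩
        · rintro ⟨h2, h3 | ⟨a, ha, h3, rfl⟩⟩
          · exact ⟨h3.1, (hω.2 x h3.1).2 ⟨h2, Or.inr (Or.inl h3.2)⟩⟩
          · obtain ⟨ha, ha0⟩ := mem_unmarked.1 ha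
            exact ⟨hhd a ha, (hω.2 _ (hhd a ha)).2
              ⟨h2, Or.inr (Or.inr ⟨a, ha, ha0, h3.2, rfl⟩)⟩⟩
      have hoT := hq.card_out_eq_of_closed hST hvT hcl
      have hL' : Layer tl hd A s v (σ.reg 16 + 1) (markedSet (ω.arr 8) N) := by
        rw [hset]
        refine .succ hL hST hvT ?_ fun X hTX hvX ⟨a, ha, haX, haT⟩ => ?_
        · rw [hoT]
          exact hq.le_card_out le_rfl hvS
        · rw [hoT]
          -- The extra node is the head of an arc, hence a node of the graph and not an arbitrary
          -- number; being outside `T`, it was visited.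
          have haN := hhd a (mem_unmarked.1 ha).1
          exact hq.lt_card_out_of_reach (hST.trans hTX) hvX haX
            (hS.reflTransGen hρ haN fun h1 => haT ⟨haN, h1⟩)
      refine ⟨f - 1, by omega, hω.1, ?_, ?_, Or.inl ⟨?_, ?_, q, ?_, ?_, ?_⟩⟩
      · rwa [hF''.arr 7 (by decide), e7']
      · rwa [hF''.arr 7 (by decide), e7']
      · rw [hF''.reg 15 (by decide), e15', hgo1]
      · rw [hF''.reg 16 (by decide), hυ]
        exact hlt
      · rw [hF''.arr 7 (by decide), e7']
        -- The flow is kept: every cut around the larger source is also a cut around the old one.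
        refine hq.mono_source fun x hx => ?_
        rw [hset]
        exact ⟨fun h1 => hvS (h1 ▸ hx), Or.inl (hST hx)⟩
      · rwa [hF''.reg 16 (by decide), hυ]
      · rw [hF''.reg 16 (by decide), hυ]
        omega
    · refine .of_wp ?_ (by simp [Prog.cost])
      simp [FlowInv, e7', e8']
      -- The counter was below `p` and is no longer so after the increment; the flow is maximum for
      -- layer `p - 1`.
      have hip' : σ.reg 16 = p - 1 := by omega
      exact ⟨by omega, ⟨0, by omega⟩, hι, hρ, hρδ, _, T, q, hip' ▸ hL, hq, hST, hvT, hcl⟩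
  · obtain ⟨x₀, hx₀⟩ := Nat.exists_eq_succ_of_ne_zero hb
    rw [hx₀] at hS
    refine (runs_augment hE' hW (by rwa [e7]) (by rwa [e7, e6]) e14 hvN hx₀
      (by rw [e6, e7]; exact hS)).mono (by omega) fun ω hF' hω => ?_
    rw [e6, e7] at hω
    obtain ⟨h1, h2, h3⟩ := hω
    obtain ⟨hx₀N, -, hx₀ι⟩ := hS.hit_succ x₀ rfl
    have hq' : IsFlow tl hd A (marked (ω.arr 7) M) (markedSet (σ.arr 8) N) v (q + 1) := by
      refine ⟨fun a ha => ?_, fun X hX hvX => ?_⟩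
      · obtain ⟨ha, ha1⟩ := mem_marked.1 ha
        exact mem_unmarked.2 ⟨ha, h2 a ha ha1⟩
      · rw [h3 X (hX ⟨hx₀N, hx₀ι⟩) hvX, hq.net_eq X hX hvX]
        push_cast
        ring
    have := hbound hq'
    have e8' : ω.arr 8 = σ.arr 8 := (hF'.arr 8 (by decide)).trans e8
    have e15' : ω.reg 15 = σ.reg 15 := (hF'.reg 15 (by decide)).trans e15
    have e16' : ω.reg 16 = σ.reg 16 := (hF'.reg 16 (by decide)).trans e16
    refine ⟨f - 1, by omega, by rwa [e8'], h1, h2, Or.inl ⟨by rw [e15', hgo1], by rwa [e16'],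
      q + 1, by rwa [e8'], by rwa [e8', e16'], ?_⟩⟩
    rw [e16']
    omega

/-- Compute a maximum flow to the node in register `14` from the last layer. -/
def flow : Prog := .loop (.lt 7 15) round

/-- Started from the zero flow and the layer `{s}`, the flow value can grow `2 ^ (p - 1)` times and
the layer counter `p` times. -/
theorem runs_flow {W N M s p v : ℕ} {tl hd : ℕ → ℕ} {σ : State}
    (hE : Env N M s p tl hd σ) (hW : N + M + p + 2 < W)
    (htl : ∀ a < M, tl a < N) (hhd : ∀ a < M, hd a < N) (hδ : ∀ a < M, σ.arr 6 a ≤ 1)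
    (hv : σ.reg 14 = v) (hvN : v < N) (hsN : s < N) (hsv : s ≠ v) (hp : 0 < p)
    (hs : ((unmarked (σ.arr 6) M).filter fun a => tl a = s).card ≤ 1)
    (hA : ∀ x, ((unmarked (σ.arr 6) M).filter fun a => tl a = x).card ≤ 2)
    (hι : ∀ x < N, σ.arr 8 x = if x = s then 1 else 0) (hρ : ∀ a < M, σ.arr 7 a = 0)
    (h15 : σ.reg 15 = 1) (h16 : σ.reg 16 = 0) :
    Runs W flow σ ((50 * (N + M) + 21) * (2 ^ (p - 1) + p) + 1) fun τ =>
      (∀ a < M, τ.arr 7 a ≤ 1) ∧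
      Saturated tl hd (unmarked (σ.arr 6) M) (marked (τ.arr 7) M) s v (p - 1) := by
  have hset : markedSet (σ.arr 8) N = {s} := by
    ext x
    simp only [markedSet, Set.mem_ofPred_eq, Set.mem_singleton_iff]
    constructor
    · rintro ⟨hx, h1⟩
      rw [hι x hx] at h1
      by_contra h2
      simp [h2] at h1
    · rintro rfl
      exact ⟨hsN, by simp [hι x hsN]⟩
  refine (Runs.while (I := FlowInv N M s p v tl hd (σ.arr 6)) (T := 50 * (N + M) + 20) ?_
    fun f τ hF hI hb => ?_).mono le_rfl fun τ hF hτ => ?_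
  · refine ⟨fun x hx => ?_, fun a ha => by simp [hρ a ha], fun a ha h1 => by simp [hρ a ha] at h1,
      Or.inl ⟨h15, by omega, 0, ?_, ?_, by simp [h16]⟩⟩
    · rw [hι x hx]
      split_ifs <;> omega
    · have : marked (σ.arr 7) M = ∅ := Finset.filter_eq_empty_iff.2 fun a ha => by
        simp [hρ a (Finset.mem_range.1 ha)]
      rw [this]
      exact ⟨Finset.empty_subset _, by simp [net]⟩
    · rw [h16, hset]
      exact .zero
  · have hE' := hE.of_frame hF (by decide) (by decide)
    have e6 : τ.arr 6 = σ.arr 6 := hF.arr 6 (by decide)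
    have hb : τ.reg 7 < τ.reg 15 := hb
    have := runs_round (f := f) hE' hW htl hhd (by rwa [e6])
      ((hF.reg 14 (by decide)).trans hv) hvN hsv (by rwa [e6]) (by rwa [e6]) (by rwa [e6])
      (by omega)
    rwa [e6] at this
  · have hE' := hE.of_frame hF (by decide) (by decide)
    obtain ⟨hb, f, -, h1, h2, h3 | h3⟩ := hτ
    · have hb : ¬ τ.reg 7 < τ.reg 15 := hb
      rw [hE'.r7, h3.1] at hb
      omega
    · exact ⟨h1, h3.2⟩

/-- Delete the arcs into the node in register `14` that carry no flow. -/
def delete : Prog :=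
  .instr (.const 18 0) ;;
  .loop (.lt 18 1) (
    .instr (.load 24 5 18) ;;
    .ite (.eq 24 14) (
      .instr (.load 25 7 18) ;; .ite (.eq 25 7) (.instr (.store 6 18 8)) .skip) .skip ;;
    .instr (.add 18 18 8))

theorem runs_delete {W N M s p v m : ℕ} {tl hd : ℕ → ℕ} {σ : State}
    (hE : Env N M s p tl hd σ) (hW : N + M + p + 2 < W) (hhd : ∀ a < M, hd a < N)
    (hδ : ∀ a < M, σ.arr 6 a ≤ 1) (hρ : ∀ a < M, σ.arr 7 a ≤ 1)
    (hv : σ.reg 14 = v) (hm : σ.reg 1 = m) (hmM : m ≤ M) :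
    Runs W delete σ (10 * M + 2) fun τ => (∀ a < M, τ.arr 6 a ≤ 1) ∧
      ∀ a < M, τ.arr 6 a = 0 ↔ σ.arr 6 a = 0 ∧ ¬ (a < m ∧ hd a = v ∧ σ.arr 7 a = 0) := by
  refine (Runs.seq (T₁ := 1) (T₂ := (7 + 1) * m + 1)
    (.of_wp (Q := fun τ => τ.reg 18 = 0) (by simp; omega) le_rfl)
    fun τ hF hτ => Runs.for (I := fun j τ => (∀ a < M, τ.arr 6 a ≤ 1) ∧
      ∀ a < M, τ.arr 6 a = 0 ↔ σ.arr 6 a = 0 ∧ ¬ (a < j ∧ hd a = v ∧ σ.arr 7 a = 0))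
      (by decide) hτ ((hF.reg 1 (by decide)).trans hm) ?_
      fun j υ hj hF' hυ hI => .of_wp ?_ (by decide)).mono (by omega) fun _ _ => id
  · rw [hF.arr 6 (by decide)]
    exact ⟨hδ, by simp⟩
  · have hE' := (hE.of_frame hF (by decide) (by decide)).of_frame hF' (by decide) (by decide)
    have e7 : υ.arr 7 = σ.arr 7 := by rw [hF'.arr 7 (by decide), hF.arr 7 (by decide)]
    have e14 : υ.reg 14 = v := by rw [hF'.reg 14 (by decide), hF.reg 14 (by decide), hv]
    have hjM : j < M := by omega
    have b1 := hhd j hjM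
    have b2 := hρ j hjM
    have hskip : ¬ (hd j = v ∧ σ.arr 7 j = 0) → ∀ a < M, υ.arr 6 a = 0 ↔
        σ.arr 6 a = 0 ∧ ¬ (a < j + 1 ∧ hd a = v ∧ σ.arr 7 a = 0) := by
      intro h0 a ha
      rw [hI.2 a ha]
      by_cases haj : a = j
      · subst haj
        simp [h0]
      · have : a < j + 1 ↔ a < j := by omega
        rw [this]
    simp [hυ, hE'.r7, hE'.r8, e7, e14, hE'.hd j hjM, -Order.lt_add_one_iff, -not_and]
    refine ⟨by omega, fun h0 => ⟨by omega, fun h1 => ⟨by omega, by omega, fun a ha => ?_,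
      fun a ha => ?_⟩, fun h1 => ⟨by omega, hI.1, hskip (by tauto)⟩⟩,
      fun h0 => ⟨by omega, hI.1, hskip (by tauto)⟩⟩
    · by_cases haj : a = j
      · simp [haj]
      · rw [Function.update_of_ne haj]
        exact hI.1 a ha
    · by_cases haj : a = j
      · simp [haj, h0, h1]
      · rw [Function.update_of_ne haj, hI.2 a ha]
        have : a < j + 1 ↔ a < j := by omega
        rw [this]

end RAM

/-! ### Thinning out one vertex, writing the auxiliary graph, listing the result -/

namespace RAM

open ArcGraph FTRS

/-- Hypotheses on a graph with `N` nodes and `M` arcs, the first `m` of which are to be thinned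
out. -/
structure IsNetwork (N M m s : ℕ) (tl hd : ℕ → ℕ) : Prop where
  tl_lt : ∀ a < M, tl a < N
  hd_lt : ∀ a < M, hd a < N
  s_lt : s < N
  m_le : m ≤ M
  out_s : ((Finset.range M).filter fun a => tl a = s).card ≤ 1
  out : ∀ x, ((Finset.range M).filter fun a => tl a = x).card ≤ 2
  into : ∀ a < M, ∀ e < m, hd a = hd e → a < m
  loopless : ∀ a < m, ∀ e < m, tl a ≠ hd e

/-- Thin out the arcs into the head of the arc in register `13`. -/
def process : Prog :=
  .instr (.load 14 1 13) ;; clear 7 12 ;; clear 8 10 ;;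
  (.instr (.store 8 2 8) ;; .instr (.const 15 1) ;; .instr (.const 16 0)) ;;
  .ite (.eq 14 2) .skip flow ;; delete ;; .instr (.add 13 13 8)

theorem runs_process {W N M m s p e : ℕ} {tl hd : ℕ → ℕ} {σ : State}
    (hE : Env N M s p tl hd σ) (hW : N + M + p + 2 < W) (hN : IsNetwork N M m s tl hd)
    (hp : 0 < p) (hm : σ.reg 1 = m) (he : e < m) (h13 : σ.reg 13 = e) (h1 : σ.arr 1 e = hd e)
    (hδ : ∀ a < M, σ.arr 6 a ≤ 1) :
    Runs W process σ ((50 * (N + M) + 21) * (2 ^ (p - 1) + p) + 13 * (N + M) + 13) fun τ =>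
      τ.reg 13 = e + 1 ∧ (∀ a < M, τ.arr 6 a ≤ 1) ∧ unmarked (τ.arr 6) M ⊆ unmarked (σ.arr 6) M ∧
      Preserves tl hd (unmarked (σ.arr 6) M) (unmarked (τ.arr 6) M) s (p - 1) ∧
      ((unmarked (τ.arr 6) M).filter fun a => hd a = hd e).card ≤ 2 ^ (p - 1) + 2 := by
  have heM : e < M := he.trans_le hN.m_le
  have hvN := hN.hd_lt e heM
  have hsub : unmarked (σ.arr 6) M ⊆ Finset.range M := Finset.filter_subset _ _
  have hcard : ∀ x, ((unmarked (σ.arr 6) M).filter fun a => tl a = x).card ≤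
      ((Finset.range M).filter fun a => tl a = x).card := fun x =>
    Finset.card_le_card (Finset.filter_subset_filter _ hsub)
  have hs₁ : ((unmarked (σ.arr 6) M).filter fun a => tl a = s).card ≤ 1 :=
    (hcard s).trans hN.out_s
  have hs₂ : ∀ x, ((unmarked (σ.arr 6) M).filter fun a => tl a = x).card ≤ 2 :=
    fun x => (hcard x).trans (hN.out x)
  refine Runs.mono (T₁ := 1 + ((3 * M + 2) + ((3 * N + 2) + (3 +
    (((50 * (N + M) + 21) * (2 ^ (p - 1) + p) + 1 + 1) + ((10 * M + 2) + 1))))))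
    (Runs.seq (.of_wp (Q := fun τ => τ.reg 14 = hd e) (by simp [h13, h1]; omega) le_rfl)
    fun τ₁ hF₁ h14 => ?_) (by omega) fun _ _ => id
  have hE₁ := hE.of_frame hF₁ (by decide) (by decide)
  refine (runs_clear (by decide) hE₁.r7 hE₁.r8 hE₁.r12 (by omega)).seq fun τ₂ hF₂ hρ₂ => ?_
  have hE₂ := hE₁.of_frame hF₂ (by decide) (by decide)
  refine (runs_clear (by decide) hE₂.r7 hE₂.r8 hE₂.r10 (by omega)).seq fun τ₃ hF₃ hι₃ => ?_
  have hE₃ := hE₂.of_frame hF₃ (by decide) (by decide)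
  refine Runs.seq (.of_wp (Q := fun τ => τ.arr 8 = Function.update (τ₃.arr 8) s 1 ∧
    τ.reg 15 = 1 ∧ τ.reg 16 = 0) (by simp [hE₃.r8, hE₃.r2]; omega) le_rfl) fun τ₄ hF₄ h₄ => ?_
  have hE₄ := hE₃.of_frame hF₄ (by decide) (by decide)
  have e6 : τ₄.arr 6 = σ.arr 6 := by
    rw [hF₄.arr 6 (by decide), hF₃.arr 6 (by decide), hF₂.arr 6 (by decide),
      hF₁.arr 6 (by decide)]
  have e7 : ∀ a < M, τ₄.arr 7 a = 0 := by
    rwa [hF₄.arr 7 (by decide), hF₃.arr 7 (by decide)]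
  have e14 : τ₄.reg 14 = hd e := by
    rw [hF₄.reg 14 (by decide), hF₃.reg 14 (by decide), hF₂.reg 14 (by decide), h14]
  have e8 : ∀ x < N, τ₄.arr 8 x = if x = s then 1 else 0 := fun x hx => by
    rw [h₄.1, Function.update_apply]
    split_ifs
    · rfl
    · exact hι₃ x hx
  refine Runs.seq (Q₁ := fun τ => (∀ a < M, τ.arr 7 a ≤ 1) ∧ ((hd e = s ∧ ∀ a < M, τ.arr 7 a = 0) ∨
    (s ≠ hd e ∧ Saturated tl hd (unmarked (σ.arr 6) M) (marked (τ.arr 7) M) s (hd e) (p - 1))))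
    (Runs.ite (fun hb => ?_) fun hb => ?_) fun τ₅ hF₅ h₅ => ?_
  · simp only [Test.Holds, e14, hE₄.r2] at hb
    exact .of_wp ⟨fun a ha => by simp [e7 a ha], Or.inl ⟨hb, e7⟩⟩ (by simp [Prog.cost])
  · simp only [Test.Holds, e14, hE₄.r2] at hb
    have := runs_flow hE₄ hW hN.tl_lt hN.hd_lt (by rwa [e6]) e14 hvN hN.s_lt (Ne.symm hb) hp
      (by rw [e6]; exact hs₁) (by rw [e6]; exact hs₂) e8 e7 h₄.2.1 h₄.2.2
    rw [e6] at this
    exact this.mono le_rfl fun τ _ hτ => ⟨hτ.1, Or.inr ⟨Ne.symm hb, hτ.2⟩⟩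
  have hE₅ := hE₄.of_frame hF₅ (by decide) (by decide)
  have e6' : τ₅.arr 6 = σ.arr 6 := (hF₅.arr 6 (by decide)).trans e6
  have em : τ₅.reg 1 = m := by
    rw [hF₅.reg 1 (by decide), hF₄.reg 1 (by decide), hF₃.reg 1 (by decide),
      hF₂.reg 1 (by decide), hF₁.reg 1 (by decide), hm]
  refine Runs.seq (runs_delete hE₅ hW hN.hd_lt (by rwa [e6']) h₅.1
    ((hF₅.reg 14 (by decide)).trans e14) em hN.m_le) fun τ₆ hF₆ h₆ => .of_wp ?_ le_rfl
  have hE₆ := hE₅.of_frame hF₆ (by decide) (by decide)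
  have e13 : τ₆.reg 13 = e := by
    rw [hF₆.reg 13 (by decide), hF₅.reg 13 (by decide), hF₄.reg 13 (by decide),
      hF₃.reg 13 (by decide), hF₂.reg 13 (by decide), hF₁.reg 13 (by decide), h13]
  rw [e6'] at h₆
  have hmem : ∀ a, a ∈ unmarked (τ₆.arr 6) M ↔ a ∈ unmarked (σ.arr 6) M ∧
      ¬ (hd a = hd e ∧ τ₅.arr 7 a = 0) := fun a => by
    rw [mem_unmarked, mem_unmarked]
    constructor
    · rintro ⟨ha, h7⟩
      obtain ⟨h8, h9⟩ := (h₆.2 a ha).1 h7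
      -- Deletion scans only the first `m` arcs; by `IsNetwork.into` no arc into this node is
      -- missed.
      exact ⟨⟨ha, h8⟩, fun h10 => h9 ⟨hN.into a ha e he h10.1, h10⟩⟩
    · rintro ⟨⟨ha, h8⟩, h9⟩
      exact ⟨ha, (h₆.2 a ha).2 ⟨h8, fun h10 => h9 h10.2⟩⟩
  have hsub' : unmarked (τ₆.arr 6) M ⊆ unmarked (σ.arr 6) M := fun a ha => ((hmem a).1 ha).1
  have hnot : ∀ a, a ∈ unmarked (σ.arr 6) M → a ∉ unmarked (τ₆.arr 6) M →
      hd a = hd e ∧ a ∉ marked (τ₅.arr 7) M := fun a ha ha' => by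
    rw [hmem] at ha'
    have h7 : hd a = hd e ∧ τ₅.arr 7 a = 0 := by tauto
    exact ⟨h7.1, by simp [mem_marked, h7.2]⟩
  have main : Preserves tl hd (unmarked (σ.arr 6) M) (unmarked (τ₆.arr 6) M) s (p - 1) ∧
      ((unmarked (τ₆.arr 6) M).filter fun a => hd a = hd e).card ≤ 2 ^ (p - 1) + 2 := by
    obtain ⟨h7, ⟨h8, h9⟩ | ⟨hsv, S, T, q, hL, hq, hST, hvT, hT⟩⟩ := h₅
    -- For the source no flow is computed, all marks are `0`, and every arc into it is deleted.
    · refine ⟨preserves_source fun a ha ha' => h8 ▸ (hnot a ha ha').1, ?_⟩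
      rw [Finset.filter_eq_empty_iff.2]
      · simp
      · intro a ha h10
        exact ((hmem a).1 ha).2 ⟨h10, h9 a (mem_unmarked.1 (hsub' ha)).1⟩
    · refine ⟨preserves_of_layer hsv hL hq hST hvT hT hsub' hnot, ?_⟩
      have hvS := hL.notMem hsv
      have hq1 : q ≤ 2 ^ (p - 1) := (hq.le_card_out le_rfl hvS).trans
        (hL.card_out_le (by convert hs₁) fun x => by convert hs₂ x)
      have h10 : ((marked (τ₅.arr 7) M).filter fun a => hd a = hd e).card ≤
          q + ((unmarked (σ.arr 6) M).filter fun a => tl a = hd e).card := by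
        convert hq.card_into_le hvS fun a ha hae hae' =>
          hN.loopless a (hN.into a (mem_unmarked.1 ha).1 e he hae) e he hae'
      have h12 : ((unmarked (τ₆.arr 6) M).filter fun a => hd a = hd e).card ≤
          ((marked (τ₅.arr 7) M).filter fun a => hd a = hd e).card := by
        refine Finset.card_le_card fun a ha => ?_
        obtain ⟨ha, hae⟩ := Finset.mem_filter.1 ha
        have haM := (mem_unmarked.1 (hsub' ha)).1
        have h13 := ((hmem a).1 ha).2
        have h14 := h7 a haM
        refine Finset.mem_filter.2 ⟨mem_marked.2 ⟨haM, ?_⟩, hae⟩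
        by_contra h15
        exact h13 ⟨hae, by omega⟩
      -- The summand `2` bounds the out-degree of the node, that is, the flow that passes through
      -- it.
      exact (h12.trans h10).trans (Nat.add_le_add hq1 (hs₂ _))
  simp only [Prog.wp, Instr.value, Instr.apply, State.setReg, e13, hE₆.r8, Function.update_self]
  exact ⟨by omega, trivial, h₆.1, hsub', main⟩

/-- Write down the auxiliary graph. -/
def setup : Prog :=
  (.instr (.const 8 1) ;; .instr (.add 9 0 8) ;; .instr (.add 10 9 1) ;; .instr (.add 11 1 1) ;;
    .instr (.add 12 11 0) ;; .instr (.const 18 0)) ;;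
  .loop (.lt 18 1) (
    .instr (.add 21 9 18) ;; .instr (.store 4 18 21) ;;
    .instr (.load 22 1 18) ;; .instr (.store 5 18 22) ;;
    .instr (.add 23 1 18) ;; .instr (.store 4 23 21) ;;
    .instr (.load 24 0 18) ;; .instr (.load 25 14 24) ;; .instr (.add 25 0 25) ;;
    .instr (.store 5 23 25) ;; .instr (.add 18 18 8) ;; .instr (.store 14 24 18)) ;;
  .instr (.const 18 0) ;;
  .loop (.lt 18 0) (
    .instr (.add 21 11 18) ;; .instr (.store 4 21 18) ;;
    .instr (.load 22 14 18) ;; .instr (.add 22 0 22) ;; .instr (.store 5 21 22) ;;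
    .instr (.add 18 18 8))

/-- Array `14` holds `lastBefore` for the edges read so far; it is read for the linking arc of edge
`j` before `j` itself is entered. Its final contents give the start of each list. -/
theorem runs_setup {W n m s p : ℕ} {tail head : ℕ → ℕ} {σ : State}
    (hW : 2 * n + 3 * m + p + 3 < W) (h0 : σ.reg 0 = n) (h1 : σ.reg 1 = m) (h2 : σ.reg 2 = s)
    (h6 : σ.reg 6 = p) (h7 : σ.reg 7 = 0) (htail : σ.arr 0 = tail) (hhead : σ.arr 1 = head)
    (ht : ∀ e < m, tail e < n) (hh : ∀ e < m, head e < n) (h14 : ∀ x, σ.arr 14 x = 0) :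
    Runs W setup σ (13 * m + 7 * n + 9)
      (Env (n + 1 + m) (2 * m + n) s p (auxTl n m) (auxHd n m tail head)) := by
  refine Runs.mono (T₁ := 6 + (((12 + 1) * m + 1) + (1 + ((6 + 1) * n + 1))))
    (Runs.seq (.of_wp (Q := fun τ => τ.reg 8 = 1 ∧ τ.reg 9 = n + 1 ∧ τ.reg 10 = n + 1 + m ∧
      τ.reg 11 = 2 * m ∧ τ.reg 12 = 2 * m + n ∧ τ.reg 18 = 0) (by simp [h0, h1]; omega) le_rfl)
    fun τ₁ hF₁ h₁ => ?_) (by omega) fun _ _ => id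
  refine Runs.seq (Runs.for (c := 18) (K := m) (I := fun j τ =>
    (∀ a < j, τ.arr 4 a = n + 1 + a) ∧ (∀ a < j, τ.arr 5 a = head a) ∧
    (∀ a < j, τ.arr 4 (m + a) = n + 1 + a) ∧
    (∀ a < j, τ.arr 5 (m + a) = n + lastBefore tail a (tail a)) ∧
    ∀ x < n, τ.arr 14 x = lastBefore tail j x) (by decide) h₁.2.2.2.2.2
    ((hF₁.reg 1 (by decide)).trans h1) ?_ fun j υ hj hF' hυ hI => .of_wp ?_ (by decide))
    fun τ₂ hF₂ h₂ => ?_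
  · rw [hF₁.arr 14 (by decide)]
    exact ⟨by simp, by simp, by simp, by simp, fun x _ => h14 x⟩
  · have e0 : υ.reg 0 = n := by rw [hF'.reg 0 (by decide), hF₁.reg 0 (by decide), h0]
    have e1 : υ.reg 1 = m := by rw [hF'.reg 1 (by decide), hF₁.reg 1 (by decide), h1]
    have e8 : υ.reg 8 = 1 := by rw [hF'.reg 8 (by decide), h₁.1]
    have e9 : υ.reg 9 = n + 1 := by rw [hF'.reg 9 (by decide), h₁.2.1]
    have et : υ.arr 0 = tail := by rw [hF'.arr 0 (by decide), hF₁.arr 0 (by decide), htail]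
    have eh : υ.arr 1 = head := by rw [hF'.arr 1 (by decide), hF₁.arr 1 (by decide), hhead]
    have b1 := ht j hj
    have b2 := hh j hj
    obtain ⟨i1, i2, i3, i4, i5⟩ := hI
    have b3 := i5 _ b1
    have b4 := lastBefore_le tail j (tail j)
    simp [e0, e1, e8, e9, et, eh, hυ, -Order.lt_add_one_iff, b3]
    refine ⟨by omega, by omega, by omega, by omega, by omega, by omega, by omega, by omega,
      fun a ha => ?_,
      fun a ha => ?_, fun a ha => ?_, fun a ha => ?_, fun x hx => ?_⟩
    · rw [Function.update_of_ne (by omega)]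
      by_cases haj : a = j
      · simp [haj]
      · rw [Function.update_of_ne haj, i1 a (by omega)]
    · rw [Function.update_of_ne (by omega)]
      by_cases haj : a = j
      · simp [haj]
      · rw [Function.update_of_ne haj, i2 a (by omega)]
    · by_cases haj : a = j
      · simp [haj]
      · rw [Function.update_of_ne (by omega), Function.update_of_ne (by omega), i3 a (by omega)]
    · by_cases haj : a = j
      · simp [haj]
      · rw [Function.update_of_ne (by omega), Function.update_of_ne (by omega), i4 a (by omega)]
    · rw [lastBefore]
      by_cases hxt : x = tail j
      · simp [hxt]
      · rw [Function.update_of_ne hxt, if_neg (Ne.symm hxt), i5 x hx]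
  obtain ⟨i1, i2, i3, i4, i5⟩ := h₂
  refine Runs.seq (.of_wp (Q := fun τ => τ.reg 18 = 0) (by simp; omega) le_rfl)
    fun τ₃ hF₃ h₃ => ?_
  refine (Runs.for (c := 18) (K := n) (I := fun j τ =>
    (∀ a < 2 * m, τ.arr 4 a = auxTl n m a) ∧ (∀ a < 2 * m, τ.arr 5 a = auxHd n m tail head a) ∧
    (∀ x < j, τ.arr 4 (2 * m + x) = x) ∧
    ∀ x < j, τ.arr 5 (2 * m + x) = n + lastBefore tail m x) (by decide) h₃
    ?_ ?_ fun j υ hj hF' hυ hI => .of_wp ?_ (by decide)).mono le_rfl fun τ₄ hF₄ h₄ => ?_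
  · rw [hF₃.reg 0 (by decide), hF₂.reg 0 (by decide), hF₁.reg 0 (by decide), h0]
  · rw [hF₃.arr 4 (by decide), hF₃.arr 5 (by decide)]
    refine ⟨fun a ha => ?_, fun a ha => ?_, by simp, by simp⟩
    · rcases lt_or_ge a m with h | h
      · rw [i1 a h, auxTl_of_lt n m h]
      · obtain ⟨b, rfl⟩ := Nat.exists_eq_add_of_le h
        rw [i3 b (by omega), auxTl_add n m (by omega)]
    · rcases lt_or_ge a m with h | h
      · rw [i2 a h, auxHd_of_lt n m tail head h]
      · obtain ⟨b, rfl⟩ := Nat.exists_eq_add_of_le h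
        rw [i4 b (by omega), auxHd_add n m tail head (by omega)]
  · have e0 : υ.reg 0 = n := by
      rw [hF'.reg 0 (by decide), hF₃.reg 0 (by decide), hF₂.reg 0 (by decide),
        hF₁.reg 0 (by decide), h0]
    have e8 : υ.reg 8 = 1 := by
      rw [hF'.reg 8 (by decide), hF₃.reg 8 (by decide), hF₂.reg 8 (by decide), h₁.1]
    have e11 : υ.reg 11 = 2 * m := by
      rw [hF'.reg 11 (by decide), hF₃.reg 11 (by decide), hF₂.reg 11 (by decide), h₁.2.2.2.1]
    have e14 : υ.arr 14 j = lastBefore tail m j := by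
      rw [hF'.arr 14 (by decide), hF₃.arr 14 (by decide), i5 j hj]
    have b4 := lastBefore_le tail m j
    obtain ⟨k1, k2, k3, k4⟩ := hI
    simp [e0, e8, e11, e14, hυ, -Order.lt_add_one_iff]
    refine ⟨by omega, by omega, by omega, by omega, by omega, fun a ha => ?_, fun a ha => ?_,
      fun x hx => ?_, fun x hx => ?_⟩
    · rw [Function.update_of_ne (by omega), k1 a ha]
    · rw [Function.update_of_ne (by omega), k2 a ha]
    · by_cases hxj : x = j
      · simp [hxj]
      · rw [Function.update_of_ne (by omega), k3 x (by omega)]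
    · by_cases hxj : x = j
      · simp [hxj]
      · rw [Function.update_of_ne (by omega), k4 x (by omega)]
  · obtain ⟨k1, k2, k3, k4⟩ := h₄
    have hreg : ∀ r ∈ [2, 6, 7], τ₄.reg r = σ.reg r := fun r hr => by
      have d1 : ∀ r ∈ [2, 6, 7], r ∉ setup.regs := by decide
      have := d1 r hr
      simp only [setup, Prog.regs, List.mem_append, not_or] at this
      rw [hF₄.reg r (by simpa only [Prog.regs, List.mem_append, not_or] using this.2.2.2),
        hF₃.reg r (by simpa only [Prog.regs, List.mem_append, not_or] using this.2.2.1),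
        hF₂.reg r (by simpa only [Prog.regs, List.mem_append, not_or] using this.2.1),
        hF₁.reg r (by simpa only [Prog.regs, List.mem_append, not_or] using this.1)]
    refine ⟨by rw [hreg 2 (by decide), h2], by rw [hreg 6 (by decide), h6],
      by rw [hreg 7 (by decide), h7], ?_, ?_, ?_, fun a ha => ?_, fun a ha => ?_⟩
    · rw [hF₄.reg 8 (by decide), hF₃.reg 8 (by decide), hF₂.reg 8 (by decide), h₁.1]
    · rw [hF₄.reg 10 (by decide), hF₃.reg 10 (by decide), hF₂.reg 10 (by decide), h₁.2.2.1]
    · rw [hF₄.reg 12 (by decide), hF₃.reg 12 (by decide), hF₂.reg 12 (by decide), h₁.2.2.2.2.1]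
    · rcases lt_or_ge a (2 * m) with h | h
      · exact k1 a h
      · obtain ⟨x, rfl⟩ := Nat.exists_eq_add_of_le h
        rw [k3 x (by omega), auxTl_two_mul_add]
    · rcases lt_or_ge a (2 * m) with h | h
      · exact k2 a h
      · obtain ⟨x, rfl⟩ := Nat.exists_eq_add_of_le h
        rw [k4 x (by omega), auxHd_two_mul_add]

/-- List the remaining edges. -/
def output : Prog :=
  .instr (.const 18 0) ;;
  .loop (.lt 18 1) (
    .instr (.load 24 6 18) ;;
    .ite (.eq 24 7) (
      .instr (.load 25 0 18) ;; .instr (.store 2 5 25) ;;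
      .instr (.load 25 1 18) ;; .instr (.store 3 5 25) ;; .instr (.add 5 5 8)) .skip ;;
    .instr (.add 18 18 8))

theorem runs_output {W n m : ℕ} {tail head : ℕ → ℕ} {σ : State}
    (hW : n + m + 2 < W) (h1 : σ.reg 1 = m) (h5 : σ.reg 5 = 0) (h7 : σ.reg 7 = 0)
    (h8 : σ.reg 8 = 1) (htail : σ.arr 0 = tail) (hhead : σ.arr 1 = head)
    (ht : ∀ e < m, tail e < n) (hh : ∀ e < m, head e < n)
    (hinj : Set.InjOn (fun e => (tail e, head e)) (Set.Iio m)) (hδ : ∀ a < m, σ.arr 6 a ≤ 1) :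
    Runs W output σ (9 * m + 2) fun τ =>
      Set.BijOn (fun i => (τ.arr 2 i, τ.arr 3 i)) (Set.Iio (τ.reg 5))
        ((fun e => (tail e, head e)) '' {e | e < m ∧ σ.arr 6 e = 0}) := by
  refine (Runs.seq (T₁ := 1) (T₂ := (8 + 1) * m + 1)
    (.of_wp (Q := fun τ => τ.reg 18 = 0) (by simp; omega) le_rfl)
    fun τ hF hτ => (Runs.for (I := fun j τ => τ.reg 5 ≤ j ∧
      Set.BijOn (fun i => (τ.arr 2 i, τ.arr 3 i)) (Set.Iio (τ.reg 5))
        ((fun e => (tail e, head e)) '' {e | e < j ∧ σ.arr 6 e = 0}))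
      (by decide) hτ ((hF.reg 1 (by decide)).trans h1) ?_
      fun j υ hj hF' hυ hI => .of_wp ?_ (by decide)).mono le_rfl fun _ _ h => h.2).mono
        (by omega) fun _ _ => id
  · rw [hF.reg 5 (by decide), h5]
    refine ⟨le_rfl, ?_⟩
    simp [Set.BijOn, Set.MapsTo, Set.SurjOn]
  · have e7 : υ.reg 7 = 0 := by rw [hF'.reg 7 (by decide), hF.reg 7 (by decide), h7]
    have e8 : υ.reg 8 = 1 := by rw [hF'.reg 8 (by decide), hF.reg 8 (by decide), h8]
    have et : υ.arr 0 = tail := by rw [hF'.arr 0 (by decide), hF.arr 0 (by decide), htail]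
    have eh : υ.arr 1 = head := by rw [hF'.arr 1 (by decide), hF.arr 1 (by decide), hhead]
    have e6 : υ.arr 6 = σ.arr 6 := by rw [hF'.arr 6 (by decide), hF.arr 6 (by decide)]
    have b1 := ht j hj
    have b2 := hh j hj
    have b3 := hδ j hj
    obtain ⟨i1, i2⟩ := hI
    have hbij : σ.arr 6 j = 0 → Set.BijOn (fun i => (Function.update (υ.arr 2) (υ.reg 5) (tail j) i,
        Function.update (υ.arr 3) (υ.reg 5) (head j) i)) (Set.Iio (υ.reg 5 + 1))
        ((fun e => (tail e, head e)) '' {e | e < j + 1 ∧ σ.arr 6 e = 0}) := by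
      intro h0
      have s1 : Set.Iio (υ.reg 5 + 1) = insert (υ.reg 5) (Set.Iio (υ.reg 5)) := by
        ext i
        simp only [Set.mem_Iio, Set.mem_insert_iff]
        omega
      have s2 : {e | e < j + 1 ∧ σ.arr 6 e = 0} = insert j {e | e < j ∧ σ.arr 6 e = 0} := by
        ext e
        simp only [Set.mem_ofPred_eq, Set.mem_insert_iff]
        constructor
        · rintro ⟨h, h'⟩
          rcases Nat.lt_succ_iff_lt_or_eq.1 h with h | h
          · exact Or.inr ⟨h, h'⟩
          · exact Or.inl h
        · rintro (rfl | ⟨h, h'⟩)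
          · exact ⟨by omega, h0⟩
          · exact ⟨by omega, h'⟩
      rw [s1, s2, Set.image_insert_eq]
      have i3 : Set.BijOn (fun i => (Function.update (υ.arr 2) (υ.reg 5) (tail j) i,
          Function.update (υ.arr 3) (υ.reg 5) (head j) i)) (Set.Iio (υ.reg 5))
          ((fun e => (tail e, head e)) '' {e | e < j ∧ σ.arr 6 e = 0}) := by
        refine i2.congr fun i hi => ?_
        have hi : i < υ.reg 5 := hi
        simp only [Function.update_of_ne hi.ne]
      have i4 := i3.insert (a := υ.reg 5) (by
        simp only [Function.update_self]
        rintro ⟨e, ⟨he, -⟩, h⟩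
        have := hinj (he.trans hj) hj h
        omega)
      simpa only [Function.update_self] using i4
    have hskip : σ.arr 6 j ≠ 0 → {e | e < j + 1 ∧ σ.arr 6 e = 0} = {e | e < j ∧ σ.arr 6 e = 0} := by
      intro h0
      ext e
      simp only [Set.mem_ofPred_eq]
      constructor
      · rintro ⟨h, h'⟩
        rcases Nat.lt_succ_iff_lt_or_eq.1 h with h | rfl
        · exact ⟨h, h'⟩
        · exact absurd h' h0
      · rintro ⟨h, h'⟩
        exact ⟨by omega, h'⟩
    simp [hυ, e7, e8, et, eh, e6, -Order.lt_add_one_iff]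
    refine ⟨by omega, fun h0 => ⟨by omega, by omega, by omega, by omega, by omega, hbij h0⟩,
      fun h0 => ⟨by omega, by omega, ?_⟩⟩
    rw [hskip h0]
    exact i2

end RAM

/-! ### The whole program and its step count -/

namespace RAM

open ArcGraph FTRS

theorem isNetwork_aux {n m s : ℕ} {tail head : ℕ → ℕ} (hs : s < n) (hh : ∀ e < m, head e < n) :
    IsNetwork (n + 1 + m) (2 * m + n) m s (auxTl n m) (auxHd n m tail head) where
  tl_lt _ ha := auxTl_lt n m ha
  hd_lt _ ha := auxHd_lt n m tail head hh ha
  s_lt := by omega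
  m_le := by omega
  out_s := by convert card_auxTl_eq_le_one n m hs
  out x := by convert card_auxTl_eq_le_two n m x
  into a ha e he h := by
    refine lt_of_auxHd_lt n m tail head ha ?_
    rw [h, auxHd_of_lt n m tail head he]
    exact hh e he
  loopless a ha e he := by
    rw [auxTl_of_lt n m ha, auxHd_of_lt n m tail head he]
    have := hh e he
    omega

/-- The program that computes a fault tolerant reachability subgraph. -/
def main : Prog :=
  .instr (.add 6 3 4) ;; .ite (.eq 6 7) .skip (.ite (.eq 1 7) .skip
    (setup ;; .instr (.const 13 0) ;; .loop (.lt 13 1) process ;; output))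

/-- A bound for the number of steps of `main`. -/
def mainSteps (n m p : ℕ) : ℕ :=
  ((50 * (2 * n + 3 * m + 1) + 21) * (2 ^ (p - 1) + p) + 13 * (2 * n + 3 * m + 1) + 14) * m +
    22 * m + 7 * n + 16

/-- Vertices are treated through the edges into them, possibly repeatedly. Preservation is
transitive, and a degree bound once reached persists because arcs are only ever deleted. -/
theorem runs_main {W n m s l k : ℕ} {tail head : ℕ → ℕ} {σ : State}
    (hW : 2 * n + 3 * m + (l + k) + 3 + (2 * m + n) < W) (hs : s < n) (hp : 0 < l + k) (hm : 0 < m)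
    (h0 : σ.reg 0 = n) (h1 : σ.reg 1 = m) (h2 : σ.reg 2 = s) (h3 : σ.reg 3 = l)
    (h4 : σ.reg 4 = k) (hreg : ∀ r, 5 ≤ r → σ.reg r = 0)
    (htail : σ.arr 0 = tail) (hhead : σ.arr 1 = head)
    (ht : ∀ e < m, tail e < n) (hh : ∀ e < m, head e < n)
    (hinj : Set.InjOn (fun e => (tail e, head e)) (Set.Iio m))
    (harr : ∀ a i, 2 ≤ a → σ.arr a i = 0) :
    Runs W main σ (mainSteps n m (l + k)) fun τ => ∃ A ⊆ Finset.range (2 * m + n),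
      Preserves (auxTl n m) (auxHd n m tail head) (Finset.range (2 * m + n)) A s (l + k - 1) ∧
      (∀ v, ((Finset.range m).filter fun e => e ∈ A ∧ head e = v).card ≤
        2 ^ (l + k - 1) + 2) ∧
      Set.BijOn (fun i => (τ.arr 2 i, τ.arr 3 i)) (Set.Iio (τ.reg 5))
        ((fun e => (tail e, head e)) '' {e | e < m ∧ e ∈ A}) := by
  set p := l + k with hpdef
  set B := (50 * (2 * n + 3 * m + 1) + 21) * (2 ^ (p - 1) + p) + 13 * (2 * n + 3 * m + 1) + 13
    with hB
  have hN := isNetwork_aux (tail := tail) hs hh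
  refine Runs.mono
    (T₁ := 1 + ((((13 * m + 7 * n + 9) + (1 + (((B + 1) * m + 1) + (9 * m + 2)))) + 1)
    + 1)) (Runs.seq (.of_wp (Q := fun τ => τ.reg 6 = p) (by simp [h3, h4]; omega) le_rfl)
    fun τ₁ hF₁ h6 => Runs.ite (fun hb => ?_) fun _ => Runs.ite (fun hb => ?_) fun _ => ?_)
    (by rw [mainSteps, hB]; ring_nf; omega) fun _ _ => id
  · simp only [Test.Holds, h6, hF₁.reg 7 (by decide), hreg 7 (by decide)] at hb
    omega
  · simp only [Test.Holds, hF₁.reg 1 (by decide), h1, hF₁.reg 7 (by decide),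
      hreg 7 (by decide)] at hb
    omega
  refine (runs_setup (s := s) (by omega) ((hF₁.reg 0 (by decide)).trans h0)
    ((hF₁.reg 1 (by decide)).trans h1) ((hF₁.reg 2 (by decide)).trans h2) h6
    ((hF₁.reg 7 (by decide)).trans (hreg 7 (by decide))) ((hF₁.arr 0 (by decide)).trans htail)
    ((hF₁.arr 1 (by decide)).trans hhead) ht hh
    fun x => by rw [hF₁.arr 14 (by decide), harr 14 x (by decide)]).seq fun τ₂ hF₂ hE₂ => ?_
  refine Runs.seq (.of_wp (Q := fun τ => τ.reg 13 = 0) (by simp; omega) le_rfl)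
    fun τ₃ hF₃ h13 => ?_
  have hE₃ := hE₂.of_frame hF₃ (by decide) (by decide)
  have r1 : τ₃.reg 1 = m := by
    rw [hF₃.reg 1 (by decide), hF₂.reg 1 (by decide), hF₁.reg 1 (by decide), h1]
  have r5 : τ₃.reg 5 = 0 := by
    rw [hF₃.reg 5 (by decide), hF₂.reg 5 (by decide), hF₁.reg 5 (by decide), hreg 5 le_rfl]
  have a0 : τ₃.arr 0 = tail := by
    rw [hF₃.arr 0 (by decide), hF₂.arr 0 (by decide), hF₁.arr 0 (by decide), htail]
  have a1 : τ₃.arr 1 = head := by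
    rw [hF₃.arr 1 (by decide), hF₂.arr 1 (by decide), hF₁.arr 1 (by decide), hhead]
  have a6 : ∀ x, τ₃.arr 6 x = 0 := fun x => by
    rw [hF₃.arr 6 (by decide), hF₂.arr 6 (by decide), hF₁.arr 6 (by decide), harr 6 x (by decide)]
  have hu : unmarked (τ₃.arr 6) (2 * m + n) = Finset.range (2 * m + n) :=
    Finset.filter_true_of_mem fun a _ => a6 a
  have hK : n + 1 + m + (2 * m + n) = 2 * n + 3 * m + 1 := by ring
  refine Runs.seq (Runs.for (c := 13) (K := m) (T := B) (I := fun j τ =>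
    (∀ a < 2 * m + n, τ.arr 6 a ≤ 1) ∧
    Preserves (auxTl n m) (auxHd n m tail head) (Finset.range (2 * m + n))
      (unmarked (τ.arr 6) (2 * m + n)) s (p - 1) ∧
    ∀ e < j, ((unmarked (τ.arr 6) (2 * m + n)).filter fun a =>
      auxHd n m tail head a = auxHd n m tail head e).card ≤ 2 ^ (p - 1) + 2)
    (by decide) h13 r1 ?_ fun j υ hj hF' hυ hI => ?_) fun τ₄ hF₄ h₄ => ?_
  · rw [hu]
    exact ⟨fun a _ => by simp [a6 a], Preserves.refl _ _ _, by simp⟩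
  · have hE' := hE₃.of_frame hF' (by decide) (by decide)
    have := runs_process (W := W) (e := j) hE' (by omega) hN hp ((hF'.reg 1 (by decide)).trans r1)
      hj hυ
      (by rw [hF'.arr 1 (by decide), a1, auxHd_of_lt n m tail head hj]) hI.1
    rw [hK] at this
    refine this.mono le_rfl fun ω _ ⟨k1, k2, k3, k4, k5⟩ => ⟨k1, k2, hI.2.1.trans k4,
      fun e he => ?_⟩
    rcases Nat.lt_succ_iff_lt_or_eq.1 he with h | rfl
    · exact (Finset.card_le_card (Finset.filter_subset_filter _ k3)).trans (hI.2.2 e h)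
    · exact k5
  · have hE₄ := hE₃.of_frame hF₄ (by decide) (by decide)
    refine (runs_output (by omega) ((hF₄.reg 1 (by decide)).trans r1)
      ((hF₄.reg 5 (by decide)).trans r5) hE₄.r7 hE₄.r8 ((hF₄.arr 0 (by decide)).trans a0)
      ((hF₄.arr 1 (by decide)).trans a1) ht hh hinj fun a ha => h₄.1 a (by omega)).mono le_rfl
      fun ω _ hω => ⟨unmarked (τ₄.arr 6) (2 * m + n), Finset.filter_subset _ _, h₄.2.1,
        fun v => ?_, ?_⟩
    · by_cases hv : ∃ e < m, head e = v
      · obtain ⟨e, he, rfl⟩ := hv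
        refine le_trans (Finset.card_le_card fun a ha => ?_) (h₄.2.2 e he)
        simp only [Finset.mem_filter, Finset.mem_range] at ha ⊢
        rw [auxHd_of_lt n m tail head he, auxHd_of_lt n m tail head ha.1]
        exact ha.2
      · push Not at hv
        rw [Finset.filter_eq_empty_iff.2]
        · simp
        · intro e he h
          exact hv e (Finset.mem_range.1 he) h.2
    · have : {e | e < m ∧ e ∈ unmarked (τ₄.arr 6) (2 * m + n)} =
          {e | e < m ∧ τ₄.arr 6 e = 0} := by
        ext e
        simp only [Set.mem_ofPred_eq, mem_unmarked]
        constructor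
        · exact fun h => ⟨h.1, h.2.2⟩
        · exact fun h => ⟨h.1, by omega, h.2⟩
      rwa [this]

/-- The left sides are the number of rounds per edge and the in-degree bound actually achieved. The
case `p = 0` is excluded because both right sides vanish there. -/
theorem two_pow_add_le {p : ℕ} (hp : 0 < p) : 2 ^ (p - 1) + p ≤ 4 ^ p * p ^ 2 ∧
    2 ^ (p - 1) + 2 ≤ p * 4 ^ p := by
  obtain ⟨q, rfl⟩ := Nat.exists_eq_add_of_lt hp
  simp only [zero_add, Nat.add_sub_cancel]
  have h1 : q < 2 ^ q := Nat.lt_two_pow_self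
  have h2 : (2 : ℕ) ^ q ≤ 4 ^ q := Nat.pow_le_pow_left (by norm_num) q
  have h3 : (4 : ℕ) ^ (q + 1) = 4 * 4 ^ q := pow_succ' 4 q
  have h4 : 4 ^ (q + 1) * 1 ≤ 4 ^ (q + 1) * (q + 1) ^ 2 :=
    Nat.mul_le_mul_left _ (Nat.one_le_pow _ _ (by omega))
  have h5 : 1 * 4 ^ (q + 1) ≤ (q + 1) * 4 ^ (q + 1) := Nat.mul_le_mul_right _ (by omega)
  omega

theorem mainSteps_le {n m p : ℕ} (hn : 0 < n) (hm : 0 < m) (hp : 0 < p) :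
    mainSteps n m p ≤ 500 * (4 ^ p * p ^ 2 * (m + n) * m + 1) := by
  have h1 := (two_pow_add_le hp).1
  set Y := 4 ^ p * p ^ 2
  have hY : 1 ≤ Y := Nat.mul_pos (by positivity) (by positivity)
  have h2 : 2 * n + 3 * m + 1 ≤ 4 * (m + n) := by omega
  -- `221 = 50 * 4 + 21`, using `1 ≤ m + n`.
  have h3 : (50 * (2 * n + 3 * m + 1) + 21) * (2 ^ (p - 1) + p) ≤ (221 * (m + n)) * Y :=
    Nat.mul_le_mul (by omega) h1
  have h4 : m + n ≤ Y * (m + n) := Nat.le_mul_of_pos_left _ hY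
  have h5 : Y * (m + n) ≤ Y * (m + n) * m := Nat.le_mul_of_pos_right _ hm
  have h6 : ((50 * (2 * n + 3 * m + 1) + 21) * (2 ^ (p - 1) + p) +
      13 * (2 * n + 3 * m + 1) + 14) * m
      ≤ (400 * (Y * (m + n))) * m := by
    refine Nat.mul_le_mul_right _ ?_
    have : 221 * (m + n) * Y = 221 * (Y * (m + n)) := by ring
    omega
  have h7 : 400 * (Y * (m + n)) * m = 400 * (Y * (m + n) * m) := by ring
  rw [mainSteps]
  omega

end RAM

/-! ### Existence and running time -/

namespace FTRS

variable {V : Type*}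

theorem isFTRS_self (G : Digraph V) (s : V) (l k : ℕ) : IsFTRS G s l k G :=
  ⟨le_rfl, fun _ _ _ _ => Iff.rfl, fun _ _ _ => Iff.rfl⟩

theorem isFTRS_zero {G H : Digraph V} (h : H ≤ G) (s : V) (k : ℕ) : IsFTRS G s 0 k H :=
  ⟨h, fun _ _ _ _ => iff_of_true (hasDisjointPaths_zero _ _ _) (hasDisjointPaths_zero _ _ _),
    fun _ _ _ => iff_of_true (hasDisjointPaths_zero _ _ _) (hasDisjointPaths_zero _ _ _)⟩

theorem inDegree_eq_zero {G : Digraph V} (h : edgeSet G = ∅) (v : V) : inDegree G v = 0 := by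
  have : {u | G.Adj u v} = ∅ := Set.eq_empty_of_forall_notMem fun u hu => by
    have h1 : (u, v) ∈ edgeSet G := hu
    simp [h] at h1
  rw [inDegree, this, Set.ncard_empty]

theorem edgeSet_bot : edgeSet (⊥ : Digraph V) = ∅ :=
  Set.eq_empty_of_forall_notMem fun _ h => h

theorem edgeSet_eq_empty [Finite V] {G : Digraph V} (h : numEdges G = 0) : edgeSet G = ∅ :=
  (Set.ncard_eq_zero (Set.toFinite _)).1 h

theorem isOutput_of_edgeSet_eq_empty {n : ℕ} {H : Digraph (Fin n)} (hH : edgeSet H = ∅)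
    {τ : RAM.State} (h5 : τ.reg 5 = 0) : IsOutput H τ := by
  have h0 : numEdges H = 0 := by rw [numEdges, hH, Set.ncard_empty]
  refine ⟨h5.trans h0.symm, ?_⟩
  rw [h0, IsEdgeList, hH]
  simp [Set.BijOn, Set.MapsTo, Set.SurjOn]

theorem exists_edgeList [Finite V] (G : Digraph V) (φ : V → ℕ) (hφ : Function.Injective φ) :
    ∃ tail head : ℕ → ℕ, Set.BijOn (fun i => (tail i, head i)) (Set.Iio (numEdges G))
      ((fun e : V × V => (φ e.1, φ e.2)) '' edgeSet G) := by
  have e : Fin (numEdges G) ≃ edgeSet G :=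
    (finCongr (Nat.card_coe_set_eq (edgeSet G)).symm).trans (Finite.equivFin _).symm
  refine ⟨fun i => if h : i < numEdges G then φ (e ⟨i, h⟩).1.1 else 0,
    fun i => if h : i < numEdges G then φ (e ⟨i, h⟩).1.2 else 0, fun i hi => ?_,
    fun i hi j hj h => ?_, ?_⟩
  · have hi : i < numEdges G := hi
    exact ⟨(e ⟨i, hi⟩).1, (e ⟨i, hi⟩).2, by simp [hi]⟩
  · have hi : i < numEdges G := hi
    have hj : j < numEdges G := hj
    simp only [hi, hj, dif_pos, Prod.mk.injEq] at h
    have h1 := e.injective (Subtype.ext (Prod.ext (hφ h.1) (hφ h.2)))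
    simpa using h1
  · rintro _ ⟨x, hx, rfl⟩
    refine ⟨(e.symm ⟨x, hx⟩ : ℕ), (e.symm ⟨x, hx⟩).2, ?_⟩
    simp

/-- Vertices are numbered, the graph is loaded into a memory, and the program is run; the set of
arcs that it leaves is the witness. -/
theorem exists_isFTRS [Finite V] (G : Digraph V) (s : V) (l k : ℕ) :
    ∃ H : Digraph V, IsFTRS G s l k H ∧ ∀ v, inDegree H v ≤ (k + l) * 4 ^ (k + l) := by
  rcases Nat.eq_zero_or_pos (l + k) with hp | hp
  · obtain rfl : l = 0 := by omega
    exact ⟨⊥, isFTRS_zero bot_le s k, fun v => by simp [inDegree_eq_zero edgeSet_bot]⟩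
  rcases Nat.eq_zero_or_pos (numEdges G) with hm | hm
  · exact ⟨G, isFTRS_self G s l k, fun v => by simp [inDegree_eq_zero (edgeSet_eq_empty hm)]⟩
  let e := Finite.equivFin V
  let φ : V → ℕ := fun v => e v
  have hφ : Function.Injective φ := Fin.val_injective.comp e.injective
  have hn : ∀ v, φ v < Nat.card V := fun v => (e v).2
  obtain ⟨tail, head, hE⟩ := exists_edgeList G φ hφ
  have hlt : ∀ i < numEdges G, tail i < Nat.card V ∧ head i < Nat.card V := fun i hi => by
    obtain ⟨x, -, h⟩ := hE.mapsTo hi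
    rw [Prod.mk.injEq] at h
    exact ⟨h.1 ▸ hn _, h.2 ▸ hn _⟩
  obtain ⟨-, -, -, -, A, hA, hP, hd, -⟩ := RAM.runs_main (n := Nat.card V) (m := numEdges G)
    (s := φ s) (l := l) (k := k) (tail := tail) (head := head)
    (σ := ⟨fun r => if r = 0 then Nat.card V else if r = 1 then numEdges G else if r = 2 then φ s
      else if r = 3 then l else if r = 4 then k else 0,
      fun a i => if a = 0 then tail i else if a = 1 then head i else 0⟩)
    -- No word size is prescribed here, so the word bound is taken as the successor of the number it
    -- has to exceed.
    (Nat.lt_succ_self _) (hn s) hp hm rfl rfl rfl rfl rfl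
    (fun r hr => by
      simp only
      rw [if_neg (by omega), if_neg (by omega), if_neg (by omega), if_neg (by omega),
        if_neg (by omega)]) rfl rfl (fun i hi => (hlt i hi).1) (fun i hi => (hlt i hi).2) hE.injOn
    (fun a i ha => by
      simp only
      rw [if_neg (by omega), if_neg (by omega)])
  refine ⟨subgraphOf φ (numEdges G) tail head A, isFTRS_subgraphOf hφ hn hE hA hP, fun v => ?_⟩
  rw [Nat.add_comm k l]
  exact inDegree_subgraphOf_le hφ ((hd _).trans (RAM.two_pow_add_le hp).2)

theorem exec_main (n : ℕ) (G : Digraph (Fin n)) (s : Fin n) (l k : ℕ) (σ : RAM.State)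
    (hσ : IsInput G s l k σ) : ∃ (t : ℕ) (τ : RAM.State) (H : Digraph (Fin n)),
      RAM.Exec ((n + numEdges G + l + k + 2) ^ 3) RAM.main σ t τ ∧
      t ≤ 500 * (4 ^ (k + l) * (k + l) ^ 2 * (numEdges G + n) * numEdges G + 1) ∧
      IsOutput H τ ∧ IsFTRS G s l k H ∧ ∀ v, inDegree H v ≤ (k + l) * 4 ^ (k + l) := by
  have hs := s.2
  -- There is a vertex, so the base is at least `3`; nine times the base already exceeds the
  -- required linear bound, hence so does its cube.
  have hW : 2 * n + 3 * numEdges G + (l + k) + 3 + (2 * numEdges G + n) <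
      (n + numEdges G + l + k + 2) ^ 3 := by
    set m := numEdges G
    have h1 : 3 ^ 2 ≤ (n + m + l + k + 2) ^ 2 := Nat.pow_le_pow_left (by omega) 2
    have h2 : (n + m + l + k + 2) * 3 ^ 2 ≤ (n + m + l + k + 2) * (n + m + l + k + 2) ^ 2 :=
      Nat.mul_le_mul_left _ h1
    have h3 : (n + m + l + k + 2) ^ 3 = (n + m + l + k + 2) * (n + m + l + k + 2) ^ 2 := by ring
    rw [h3]
    omega
  -- In these cases `main` stops after its tests, with register `5` still `0`: the output is the
  -- empty edge list.
  have htriv : (l + k = 0 ∨ numEdges G = 0) →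
      ∃ t τ, RAM.Exec ((n + numEdges G + l + k + 2) ^ 3) RAM.main σ t τ ∧ t ≤ 4 ∧ τ.reg 5 = 0 := by
    intro h
    refine RAM.Runs.seq (T₁ := 1) (T₂ := 1 + 1 + 1) (.of_wp (Q := fun τ => τ.reg 6 = l + k)
      (by simp [hσ.reg_three, hσ.reg_four]; omega) le_rfl) fun τ₁ hF₁ h6 =>
      RAM.Runs.ite (fun _ => ?_) fun h7 => RAM.Runs.ite (fun _ => ?_) fun h8 => ?_
    · exact .of_wp ((hF₁.reg 5 (by decide)).trans (hσ.reg_rest 5 le_rfl)) (by simp [RAM.Prog.cost])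
    · exact .of_wp ((hF₁.reg 5 (by decide)).trans (hσ.reg_rest 5 le_rfl)) le_rfl
    · simp only [RAM.Test.Holds, h6, hF₁.reg 7 (by decide), hσ.reg_rest 7 (by decide)] at h7
      simp only [RAM.Test.Holds, hF₁.reg 1 (by decide), hσ.reg_one, hF₁.reg 7 (by decide),
        hσ.reg_rest 7 (by decide)] at h8
      omega
  rcases Nat.eq_zero_or_pos (l + k) with hp | hp
  · obtain ⟨t, τ, h1, h2, h3⟩ := htriv (Or.inl hp)
    obtain rfl : l = 0 := by omega
    exact ⟨t, τ, ⊥, h1, by omega, isOutput_of_edgeSet_eq_empty edgeSet_bot h3,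
      isFTRS_zero bot_le s k, fun v => by simp [inDegree_eq_zero edgeSet_bot]⟩
  rcases Nat.eq_zero_or_pos (numEdges G) with hm | hm
  · obtain ⟨t, τ, h1, h2, h3⟩ := htriv (Or.inr hm)
    have h4 := edgeSet_eq_empty hm
    exact ⟨t, τ, G, h1, by omega, isOutput_of_edgeSet_eq_empty h4 h3, isFTRS_self G s l k,
      fun v => by simp [inDegree_eq_zero h4]⟩
  have hE : Set.BijOn (fun i => (σ.arr 0 i, σ.arr 1 i)) (Set.Iio (numEdges G))
    ((fun e : Fin n × Fin n => ((e.1 : ℕ), (e.2 : ℕ))) '' edgeSet G) := hσ.edges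
  have hlt : ∀ i < numEdges G, σ.arr 0 i < n ∧ σ.arr 1 i < n := fun i hi => by
    obtain ⟨x, -, h⟩ := hE.mapsTo hi
    rw [Prod.mk.injEq] at h
    exact ⟨h.1 ▸ x.1.2, h.2 ▸ x.2.2⟩
  obtain ⟨t, τ, ht, htT, A, hA, hP, hd, hout⟩ := RAM.runs_main hW hs hp hm hσ.reg_zero hσ.reg_one
    hσ.reg_two hσ.reg_three hσ.reg_four hσ.reg_rest rfl rfl (fun i hi => (hlt i hi).1)
    (fun i hi => (hlt i hi).2) hE.injOn hσ.arr_rest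
  set H : Digraph (Fin n) := subgraphOf Fin.val (numEdges G) (σ.arr 0) (σ.arr 1) A with hH
  have himage : (fun e : Fin n × Fin n => ((e.1 : ℕ), (e.2 : ℕ))) '' edgeSet H =
      (fun e => (σ.arr 0 e, σ.arr 1 e)) '' {e | e < numEdges G ∧ e ∈ A} := by
    ext ⟨x, y⟩
    constructor
    · rintro ⟨⟨u, v⟩, ⟨e, he, heA, h1, h2⟩, h⟩
      exact ⟨e, ⟨he, heA⟩, by rw [← h]; exact Prod.ext h1 h2⟩
    · rintro ⟨e, ⟨he, heA⟩, h⟩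
      rw [Prod.mk.injEq] at h
      obtain ⟨h1, h2⟩ := hlt e he
      exact ⟨(⟨_, h1⟩, ⟨_, h2⟩), ⟨e, he, heA, rfl, rfl⟩, Prod.ext h.1 h.2⟩
  -- The listed pairs biject with the edges of `H`, so the output counter equals their number.
  have hnum : τ.reg 5 = numEdges H := by
    have h1 := hout.ncard_eq
    rw [← himage, Set.ncard_image_of_injective] at h1
    · rw [numEdges, ← h1]
      simp [Set.ncard_eq_toFinset_card']
    · rintro ⟨a, b⟩ ⟨c, d⟩ h
      simpa [Fin.ext_iff] using h
  refine ⟨t, τ, H, ht, ?_, ⟨hnum, ?_⟩, isFTRS_subgraphOf Fin.val_injective (fun v => v.2) hE hA hP,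
    fun v => ?_⟩
  · rw [Nat.add_comm k l]
    exact htT.trans (RAM.mainSteps_le (by omega) hm hp)
  · rw [IsEdgeList, himage, ← hnum]
    exact hout
  · rw [Nat.add_comm k l]
    exact inDegree_subgraphOf_le Fin.val_injective ((hd _).trans (RAM.two_pow_add_le hp).2)

end FTRS

theorem theorem1 :
    (∀ (V : Type*) [Finite V] (G : Digraph V) (s : V) (l k : ℕ),
      ∃ H : Digraph V, FTRS.IsFTRS G s l k H ∧
        ∀ v, FTRS.inDegree H v ≤ (k + l) * 4 ^ (k + l)) ∧
    (∃ (p : RAM.Prog) (C c : ℕ), ∀ (n : ℕ) (G : Digraph (Fin n)) (s : Fin n) (l k : ℕ)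
      (σ : RAM.State), FTRS.IsInput G s l k σ →
        ∃ (t : ℕ) (τ : RAM.State) (H : Digraph (Fin n)),
          RAM.Exec ((n + FTRS.numEdges G + l + k + 2) ^ c) p σ t τ ∧
          t ≤ C * (4 ^ (k + l) * (k + l) ^ 2 * (FTRS.numEdges G + n) * FTRS.numEdges G + 1) ∧
          FTRS.IsOutput H τ ∧
          FTRS.IsFTRS G s l k H ∧
          ∀ v, FTRS.inDegree H v ≤ (k + l) * 4 ^ (k + l)) :=
  ⟨fun _ _ G s l k => FTRS.exists_isFTRS G s l k, RAM.main, 500, 3, FTRS.exec_main⟩
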